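/- **Model.** A job $j$ has an arrival time $a_j\ge 0$, a deadline $d_j$ and an execution time $c_j>0$. A processor is busy, in standby, or off; it uses $\psi_b$ units of energy per unit of time when busy, $\psi_\sigma$ in standby ($0<\psi_\sigma\le\psi_b$) and none when off, and every turn-on costs $E_w\ge 0$. Let $\mathcal B=E_w/\psi_\sigma$ be the break-even time. A schedule on finitely many processors specifies, for each processor, a finite set of separated time intervals during which it is on, and which job (if any) occupies it at each time. Its energy is the sum, over the processors, of $E_w$ times the number of on-intervals and of the integral over these intervals of $\psi_b$ (when occupied by a job) or $\psi_\sigma$ (otherwise). It is feasible for a set of jobs if each job $j$ of the set is executed on one processor, within $[a_j,d_j]$, for a total time of at least $c_j$ (with preemption allowed). For a job set $\mathcal J$ let $\mathcal J(t)=\{j\in\mathcal J: a_j\le t\}$. **Algorithm $\mathcal S$** (on two processors $M_1,M_2$, with parameter $\lambda\in[0,1]$). Let $Q(t)$ be the set of jobs of $\mathcal J(t)$ not finished at time $t$, and $W(t,t^\dagger)$ the total remaining execution time at time $t$ of the jobs of $Q(t)$ with deadline at most $t^\dagger$. The energy-efficient anchor of $j$ is $h_j=\max\{a_j,d_j-\lambda\mathcal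 B\}$. The system is off if both processors are off; it is in standby if it is not off and no processor is executing a job. Initially the system is off and the urgency flag is false. At every time $t$ the following rules are applied in this order, except that (B) governs which jobs are executed in the resulting state. (A) (a) If the system is off and either $h_j\le t$ for some $j\in Q(t)$ or $W(t,t^\dagger)\ge t^\dagger-t$ for some $t^\dagger>t$, turn on $M_1$. (b) If the urgency flag is false and $W(t,t^\dagger)>t^\dagger-t$ for some $t^\dagger>t$, turn on $M_1$ if it is off, turn on $M_2$, set $t^*:=t$, and set the urgency flag to true. (B) If the urgency flag is true, run earliest-deadline-first (EDF, ties broken arbitrarily) on $M_1$ with the jobs of $Q(t)$ that arrived before $t^*$, and on $M_2$ with the other jobs of $Q(t)$. If it is false and the system is not off, run EDF with the jobs of $Q(t)$ on the processor that is on. (C) (a) If the urgency flag is true and no job of $Q(t)$ arrived before $t^*$, turn off $M_1$ and set the flag to false. (b) If the urgency flag is false, the system is in standby and $t-t_1\ge\mathcal B$, where $t_1$ is the time at which $M_1$ was last turned on, turn off all processors. **Theorem.** Let $\mathcal J$ be a finite set of jobs such that for all $\ell<r$ $$\sum_{j\in\mathcal J:\ \ell\le a_j,\ d_j\le r} c_j\le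 r-\ell .$$ Then, with $\lambda=1$, algorithm $\mathcal S$ is well defined on $\mathcal J$ (it has a run, with finitely many turn-ons, for all times $t\ge 0$), and every schedule it produces (it uses at most two processors) is feasible for $\mathcal J$ and $4$-competitive: for every $T\ge 0$, the energy it consumes up to time $T$ is at most $4$ times the energy of any schedule, on any number of processors, that is feasible for $\mathcal J(T)$; and its total energy is at most $4$ times the energy of any schedule, on any number of processors, that is feasible for $\mathcal J$. -/

import Mathlib

open Set Filter Topology MeasureTheory

noncomputable section

namespace PowerSched

/-- A job with its arrival time, deadline and execution time. -/
structure Job where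
  arrival : ℝ
  deadline : ℝ
  exec : ℝ
  arrival_nonneg : 0 ≤ arrival
  exec_pos : 0 < exec

/-- The energy parameters: the energy of one turn-on, and the energy per unit of time of a processor
that is busy, respectively in standby.  A processor that is off consumes nothing. -/
structure PowerModel where
  wake : ℝ
  busy : ℝ
  standby : ℝ
  wake_nonneg : 0 ≤ wake
  standby_pos : 0 < standby
  standby_le_busy : standby ≤ busy

/-- The break-even time. -/
def PowerModel.breakEven (P : PowerModel) : ℝ := P.wake / P.standby

/-- Schedulability condition: for every interval `(l, r)`, the jobs that arrive at or after `l` and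
are due by `r` have total execution time at most `r - l`. -/
def EDFCondition {ι : Type*} [Fintype ι] (J : ι → Job) : Prop :=
  ∀ l r : ℝ, l < r →
    ∑ j with l ≤ (J j).arrival ∧ (J j).deadline ≤ r, (J j).exec ≤ r - l

/-- A schedule on `k` processors.  `on m` is the set of the intervals `[ℓ, r)` (stored as pairs)
during which processor `m` is turned on, and `job m t` is the job that occupies processor `m` at
time `t` (`none` if there is none).  Between two on-intervals of a processor it is really off. -/
structure Schedule (ι : Type*) (k : ℕ) where
  on : Fin k → Finset (ℝ × ℝ)
  job : Fin k → ℝ → Option ι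
  on_nonneg : ∀ m, ∀ I ∈ on m, 0 ≤ I.1
  on_lt : ∀ m, ∀ I ∈ on m, I.1 < I.2
  on_separated : ∀ m, ∀ I ∈ on m, ∀ I' ∈ on m, I ≠ I' → I.2 < I'.1 ∨ I'.2 < I.1
  job_measurable : ∀ m x, MeasurableSet {t | job m t = x}

namespace Schedule

variable {ι : Type*} {k : ℕ}

/-- The amount of time, within the set `A` of times, that processor `m` is on and executes `j`. -/
def executed (S : Schedule ι k) (m : Fin k) (j : ι) (A : Set ℝ) : ℝ :=
  ∑ I ∈ S.on m, ∫ t in Ico I.1 I.2 ∩ A, {s | S.job m s = some j}.indicator (fun _ => (1 : ℝ)) t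

/-- `S` is feasible for the jobs in `A`: each of them is executed, on one processor and between its
arrival and its deadline, for at least its execution time. -/
def Feasible (S : Schedule ι k) (J : ι → Job) (A : Set ι) : Prop :=
  ∀ j ∈ A, ∃ m, (J j).exec ≤ S.executed m j (Icc (J j).arrival (J j).deadline)

/-- The power drawn by processor `m` at time `t`, provided that it is on. -/
def power (S : Schedule ι k) (P : PowerModel) (m : Fin k) (t : ℝ) : ℝ :=
  if (S.job m t).isSome then P.busy else P.standby

/-- The total energy consumption. -/
def energy (S : Schedule ι k) (P : PowerModel) : ℝ :=
  ∑ m, (P.wake * (S.on m).card + ∑ I ∈ S.on m, ∫ t in Ico I.1 I.2, S.power P m t)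

/-- The energy consumed up to time `T`, including the turn-ons at time `T`. -/
def energyUpTo (S : Schedule ι k) (P : PowerModel) (T : ℝ) : ℝ :=
  ∑ m, (P.wake * ((S.on m).filter (fun I => I.1 ≤ T)).card +
    ∑ I ∈ S.on m, ∫ t in Ico I.1 I.2 ∩ Iic T, S.power P m t)

/-- The remaining execution time of job `j` at time `t`. -/
def remaining (S : Schedule ι k) (J : ι → Job) (j : ι) (t : ℝ) : ℝ :=
  (J j).exec - ∑ m, S.executed m j (Icc 0 t)

/-- `Q(t)`: the jobs that have arrived by time `t` and are not finished at time `t`. -/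
def queue (S : Schedule ι k) (J : ι → Job) (t : ℝ) : Set ι :=
  {j | (J j).arrival ≤ t ∧ 0 < S.remaining J j t}

open Classical in
/-- `W(t, x)`: the total remaining execution time of the jobs of `Q(t)` that are due by `x`. -/
def workload [Fintype ι] (S : Schedule ι k) (J : ι → Job) (t x : ℝ) : ℝ :=
  ∑ j with j ∈ S.queue J t ∧ (J j).deadline ≤ x, S.remaining J j t

end Schedule

/-- The energy-efficient anchor of a job. -/
def anchor (P : PowerModel) (lam : ℝ) (j : Job) : ℝ :=
  max j.arrival (j.deadline - lam * P.breakEven)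

/-- What the online algorithm remembers: which of the processors `M₁` (index `0`) and `M₂`
(index `1`) are on, the urgency flag, the time `t₁` at which `M₁` was last turned on, and the time
`t*` at which the urgency flag was last raised. -/
@[ext]
structure SysState where
  on : Fin 2 → Bool
  urgent : Bool
  t1 : ℝ
  tStar : ℝ

namespace SysState

/-- At the beginning both processors are off and the urgency flag is false. -/
def initial : SysState := ⟨fun _ => false, false, 0, 0⟩

def IsOff (s : SysState) : Prop := ∀ m, s.on m = false

def turnOnM1 (s : SysState) (t : ℝ) : SysState :=
  { s with on := Function.update s.on 0 true, t1 := t }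

open Classical in
/-- Rule (A), first part: if the system is off, and the anchor of an unfinished job is reached or
the unfinished jobs leave no slack (`Q` is the queue and `W x` the work in it due by `x`), then turn
on `M₁`. -/
def wakeUp {ι : Type*} (P : PowerModel) (lam : ℝ) (J : ι → Job) (Q : Set ι) (W : ℝ → ℝ) (t : ℝ)
    (s : SysState) : SysState :=
  if s.IsOff ∧ ((∃ j ∈ Q, anchor P lam (J j) ≤ t) ∨ ∃ x, t < x ∧ x - t ≤ W x) then
    s.turnOnM1 t
  else s

open Classical in
/-- Rule (A), second part: if the urgency flag is false and the unfinished jobs do not fit on one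
processor, then turn on `M₁` if it is off, turn on `M₂`, and raise the flag. -/
def raiseUrgency (W : ℝ → ℝ) (t : ℝ) (s : SysState) : SysState :=
  if s.urgent = false ∧ ∃ x, t < x ∧ x - t < W x then
    let s' := if s.on 0 = false then s.turnOnM1 t else s
    { s' with on := Function.update s'.on 1 true, urgent := true, tStar := t }
  else s

open Classical in
/-- Rule (C), first part: if the urgency flag is true and no unfinished job arrived before `t*`,
then turn off `M₁` and clear the flag. -/
def clearUrgency {ι : Type*} (J : ι → Job) (Q : Set ι) (s : SysState) : SysState :=
  if s.urgent = true ∧ ∀ j ∈ Q, s.tStar ≤ (J j).arrival then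
    { s with on := Function.update s.on 0 false, urgent := false }
  else s

open Classical in
/-- Rule (C), second part: if the urgency flag is false, the system is in standby (it is not off,
and there is no unfinished job to execute) and at least the break-even time has passed since `M₁`
was turned on, then turn off all processors. -/
def shutDown {ι : Type*} (P : PowerModel) (Q : Set ι) (t : ℝ) (s : SysState) : SysState :=
  if s.urgent = false ∧ ¬ s.IsOff ∧ Q = ∅ ∧ P.breakEven ≤ t - s.t1 then
    { s with on := fun _ => false }
  else s

/-- All switching rules, applied at time `t` to the state just before `t`. -/
def update {ι : Type*} (P : PowerModel) (lam : ℝ) (J : ι → Job) (Q : Set ι) (W : ℝ → ℝ) (t : ℝ)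
    (s : SysState) : SysState :=
  ((((s.wakeUp P lam J Q W t).raiseUrgency W t).clearUrgency J Q).shutDown P Q t)

/-- Rule (B): the jobs of the queue `Q` that processor `m` may execute in state `s`.  When the
urgency flag is true, `M₁` gets the jobs that arrived before `t*` and `M₂` gets the others;
otherwise the processor that is on gets all of them. -/
def eligible {ι : Type*} (J : ι → Job) (Q : Set ι) (s : SysState) (m : Fin 2) : Set ι :=
  {j ∈ Q | s.on m = true ∧
    (s.urgent = true → if m = 0 then (J j).arrival < s.tStar else s.tStar ≤ (J j).arrival)}

end SysState

/-- Earliest deadline first: execute an available job whose deadline is smallest (ties are broken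
arbitrarily), and nothing if and only if no job is available. -/
def EDFChoice {ι : Type*} (J : ι → Job) (A : Set ι) : Option ι → Prop
  | none => A = ∅
  | some j => j ∈ A ∧ ∀ i ∈ A, (J j).deadline ≤ (J i).deadline

/-- The schedule `S` on two processors is produced by the online algorithm with parameter `lam` on
the jobs `J`; `σ t` is the state of the algorithm at time `t`, after the rules have been applied at
time `t`.  The state is piecewise constant in time; at every time it results from the state just
before by the switching rules, which see only the jobs that have arrived. -/
structure IsRun {ι : Type*} [Fintype ι] (P : PowerModel) (lam : ℝ) (J : ι → Job)
    (S : Schedule ι 2) (σ : ℝ → SysState) : Prop where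
  init : σ 0 = SysState.initial.update P lam J (S.queue J 0) (S.workload J 0) 0
  step : ∀ t, 0 < t → ∃ s : SysState, (∀ᶠ u in 𝓝[<] t, σ u = s) ∧
    σ t = s.update P lam J (S.queue J t) (S.workload J t) t
  right : ∀ t, 0 ≤ t → ∀ᶠ u in 𝓝[>] t, σ u = σ t
  on_iff : ∀ t, 0 ≤ t → ∀ m, (σ t).on m = true ↔ ∃ I ∈ S.on m, t ∈ Ico I.1 I.2
  edf : ∀ t, 0 ≤ t → ∀ m, EDFChoice J ((σ t).eligible J (S.queue J t) m) (S.job m t)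

/-- `S` is a `ρ`-competitive schedule for the jobs `J`: at every time `T`, the energy consumed up to
`T` is at most `ρ` times the energy of any schedule, on any number of processors, that is feasible
for the jobs which have arrived by `T`; and the total energy is at most `ρ` times the energy of any
feasible schedule for all jobs. -/
def IsCompetitive {ι : Type*} {k : ℕ} (ρ : ℝ) (P : PowerModel) (J : ι → Job)
    (S : Schedule ι k) : Prop :=
  (∀ T : ℝ, 0 ≤ T → ∀ (n : ℕ) (O : Schedule ι n), O.Feasible J {j | (J j).arrival ≤ T} →
    S.energyUpTo P T ≤ ρ * O.energy P) ∧
  ∀ (n : ℕ) (O : Schedule ι n), O.Feasible J univ → S.energy P ≤ ρ * O.energy P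

end PowerSched

end

/-! Time is cut into periods, each consisting of an off-time, which begins at the last turn-off `e`,
and an on-time, which begins at the wake-up `t1`. After division by the standby power, a turn-on
costs the break-even time `B` and on-time costs its length. The excess of busy over standby power is
proportional to the work done and is treated separately.

Cost of the algorithm. A period without urgency has one turn-on, and `M₁` is in standby only before
`t1 + B`, hence for at most `B`. In a period with urgency there are two turn-ons, `M₁` has no
standby time, and the standby time of `M₂` is at most the execution time of the jobs that arrived
after `e` and up to `t*`. The last claim rests on `PreSingle.raise`: backlog that does not fit must
include jobs from the off-time, whose deadlines are at least `t1 + B`, so the work that arrived in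
the period is at least `B`. Altogether turn-ons and standby cost at most `2B` per period plus the
total execution time `C` of the arrived jobs (`Record`, `PrePhase.ledger_le`).

Cost of a competitor `O` with `k` on-intervals and on-time `L ≥ C`. In each complete period an
on-interval of `O` starts or ends, or `O` is on throughout, or `O` is off throughout. The first case
is charged to the `2k` ends and the second to the on-time. In the third case the jobs that caused
the wake-up at `w` must be executed later, and as much work as fits into some `[w, x]` has to be
done before `x`; this work is laid out on `[w, x]` and covers the period after `w`
(`Windows.exists_cover`, `Schedule.volume_union_le`). With `n` periods this gives `B n ≤ 2 B k + L`
(`Record.turnOns_le`). So the algorithm pays at most `2 B n + 2 C ≤ 4 (B k + L)`.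

Feasibility. While one processor handles everything, the negated urgency test says that the pending
work fits. After the flag is raised, `M₁` keeps the older jobs, which did fit, and `M₂` receives
only jobs arriving from `t*` on, for which EDF on a single processor succeeds by `EDFCondition`
(`slack_fits`).

These facts are invariants of four phases (off, `M₁` alone, urgent, `M₂` alone). `Segment` collects
what the phases need to know about a time interval with constant state and no inner arrivals. It is
derived for an arbitrary run (`IsRun.segment`, with real induction) and for an explicitly built
piece of a run (`Uneventful.segment`). Existence then follows from a bound on the number of future
events (`exists_continuation`). -/

noncomputable section

namespace PowerSched

/-! ### Sums over jobs, the four phases, and their evolution while the state is constant. -/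

section Configurations

variable {ι : Type*} [Fintype ι]

open Classical in
/-- The sum of `f` over the indices that satisfy `A`. -/
def total (A : ι → Prop) (f : ι → ℝ) : ℝ := ∑ j, if A j then f j else 0

open Classical in
theorem total_le_total {A B : ι → Prop} {f g : ι → ℝ}
    (h : ∀ j, (if A j then f j else 0) ≤ if B j then g j else 0) : total A f ≤ total B g :=
  Finset.sum_le_sum fun j _ => h j

theorem total_congr {A B : ι → Prop} {f g : ι → ℝ} (h : ∀ j, A j ↔ B j)
    (hf : ∀ j, A j → f j = g j) : total A f = total B g := by
  classical
  refine Finset.sum_congr rfl fun j _ => ?_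
  by_cases hA : A j
  · simp [hA, (h j).1 hA, hf j hA]
  · have : ¬ B j := fun hB => hA ((h j).2 hB)
    simp [hA, this]

theorem total_mono {A B : ι → Prop} {f : ι → ℝ} (hf : ∀ j, 0 ≤ f j) (h : ∀ j, A j → B j) :
    total A f ≤ total B f := by
  classical
  refine total_le_total fun j => ?_
  by_cases hA : A j
  · simp [hA, h j hA]
  · by_cases hB : B j <;> simp [hA, hB, hf j]

theorem total_nonneg {A : ι → Prop} {f : ι → ℝ} (hf : ∀ j, A j → 0 ≤ f j) : 0 ≤ total A f := by
  classical
  refine Finset.sum_nonneg fun j _ => ?_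
  split_ifs with h
  · exact hf j h
  · exact le_rfl

theorem total_eq_zero {A : ι → Prop} {f : ι → ℝ} (hf : ∀ j, A j → f j = 0) : total A f = 0 := by
  classical
  refine Finset.sum_eq_zero fun j _ => ?_
  split_ifs with h
  · exact hf j h
  · rfl

theorem single_le_total {A : ι → Prop} {f : ι → ℝ} (hf : ∀ j, 0 ≤ f j) {j : ι} (hj : A j) :
    f j ≤ total A f := by
  classical
  have := Finset.single_le_sum (f := fun j => if A j then f j else 0)
    (fun i _ => by split_ifs <;> simp [hf i]) (Finset.mem_univ j)
  simpa [hj, total] using this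

theorem exists_of_total_pos {A : ι → Prop} {f : ι → ℝ} (h : 0 < total A f) :
    ∃ j, A j ∧ 0 < f j := by
  by_contra hc
  push Not at hc
  classical
  refine absurd h (not_lt.2 (Finset.sum_nonpos fun j _ => ?_))
  split_ifs with hA
  · exact hc j hA
  · exact le_rfl

theorem total_sub (A : ι → Prop) (f g : ι → ℝ) :
    total A (fun j => f j - g j) = total A f - total A g := by
  classical
  unfold total
  rw [← Finset.sum_sub_distrib]
  refine Finset.sum_congr rfl fun j _ => ?_
  split_ifs <;> simp

theorem total_split {A B C : ι → Prop} (f : ι → ℝ) (h : ∀ j, A j ↔ B j ∨ C j)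
    (hd : ∀ j, B j → ¬ C j) : total A f = total B f + total C f := by
  classical
  unfold total
  rw [← Finset.sum_add_distrib]
  refine Finset.sum_congr rfl fun j _ => ?_
  by_cases hB : B j
  · simp [h j, hB, hd j hB]
  · simp [h j, hB]

/-- The arrived jobs with positive remaining execution time. -/
def openJobs (J : ι → Job) (r : ι → ℝ) (t : ℝ) : Set ι := {j | (J j).arrival ≤ t ∧ 0 < r j}

open Classical in
/-- The remaining execution time of the open jobs that are due by `x`. -/
def dueWork (J : ι → Job) (r : ι → ℝ) (t x : ℝ) : ℝ :=
  ∑ j with j ∈ openJobs J r t ∧ (J j).deadline ≤ x, r j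

theorem dueWork_eq {J : ι → Job} {r : ι → ℝ} (hr : ∀ j, 0 ≤ r j) (t x : ℝ) :
    dueWork J r t x = total (fun j => (J j).arrival ≤ t ∧ (J j).deadline ≤ x) r := by
  classical
  unfold dueWork total
  rw [Finset.sum_filter]
  refine Finset.sum_congr rfl fun j _ => ?_
  rcases (hr j).eq_or_lt with h | h
  · simp [← h]
  · simp [openJobs, h]

theorem PowerModel.breakEven_nonneg (P : PowerModel) : 0 ≤ P.breakEven :=
  div_nonneg P.wake_nonneg P.standby_pos.le

theorem PowerModel.standby_mul_breakEven (P : PowerModel) : P.standby * P.breakEven = P.wake :=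
  mul_div_cancel₀ _ P.standby_pos.ne'

theorem EDFCondition.total_le {J : ι → Job} (hJ : EDFCondition J) {l r : ℝ} (h : l < r) :
    total (fun j => l ≤ (J j).arrival ∧ (J j).deadline ≤ r) (fun j => (J j).exec) ≤ r - l := by
  classical
  have := hJ l r h
  rw [Finset.sum_filter] at this
  unfold total
  convert this using 3

/-- Otherwise the job would count in an interval that starts at its arrival and has half its
execution time as length. -/
theorem EDFCondition.arrival_lt_deadline {J : ι → Job} (hJ : EDFCondition J) (j : ι) :
    (J j).arrival < (J j).deadline := by
  by_contra hc
  push Not at hc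
  have h1 := hJ.total_le (l := (J j).arrival) (r := (J j).arrival + (J j).exec / 2)
    (by linarith [(J j).exec_pos])
  have h2 := single_le_total (A := fun i => (J j).arrival ≤ (J i).arrival ∧
    (J i).deadline ≤ (J j).arrival + (J j).exec / 2) (f := fun i => (J i).exec)
    (fun i => (J i).exec_pos.le) (j := j) ⟨le_rfl, by linarith [(J j).exec_pos]⟩
  linarith [(J j).exec_pos]

theorem exists_deadline_bound (J : ι → Job) (y : ℝ) : ∃ X, y < X ∧ ∀ j, (J j).deadline ≤ X := by
  obtain ⟨X, hX⟩ := (Set.finite_range fun j => (J j).deadline).bddAbove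
  exact ⟨max X (y + 1), lt_max_of_lt_right (by linarith),
    fun j => (hX ⟨j, rfl⟩).trans (le_max_left _ _)⟩

/-- What justifies turning the system on at time `w` after it was last turned off at time `e`. -/
def Trigger (P : PowerModel) (J : ι → Job) (e w : ℝ) : Prop :=
  (∃ j, e < (J j).arrival ∧ (J j).arrival ≤ w ∧ (J j).deadline ≤ w + P.breakEven) ∨
  ∃ x, w < x ∧ x - w ≤ total (fun j => (e < (J j).arrival ∧ (J j).arrival ≤ w) ∧
    (J j).deadline ≤ x) fun j => (J j).exec

theorem Trigger.exists_job {P : PowerModel} {J : ι → Job} {e w : ℝ} (h : Trigger P J e w) :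
    ∃ j, e < (J j).arrival ∧ (J j).arrival ≤ w := by
  rcases h with ⟨j, h1, h2, _⟩ | ⟨x, h1, h2⟩
  · exact ⟨j, h1, h2⟩
  · obtain ⟨j, hj, _⟩ := exists_of_total_pos (lt_of_lt_of_le (sub_pos.2 h1) h2)
    exact ⟨j, hj.1⟩

/-- Facts about the remaining execution times `r` at time `t`, where the system was last turned off
at time `e`. -/
structure Base (J : ι → Job) (t e : ℝ) (r : ι → ℝ) : Prop where
  nonneg : ∀ j, 0 ≤ r j
  le_exec : ∀ j, r j ≤ (J j).exec
  future : ∀ j, t ≤ (J j).arrival → r j = (J j).exec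
  past : ∀ j, (J j).arrival ≤ e → r j = 0
  due : ∀ j, (J j).deadline ≤ t → r j = 0
  e_le : e ≤ t

/-- The system is off, and the rules have not yet been applied at time `t`. -/
structure PreOff (P : PowerModel) (J : ι → Job) (t e : ℝ) (r : ι → ℝ) (s : SysState) : Prop where
  base : Base J t e r
  off : s.IsOff
  calm : s.urgent = false
  unstarted : ∀ j, e < (J j).arrival → r j = (J j).exec
  early : ∀ j, e < (J j).arrival → (J j).arrival < t → t + P.breakEven ≤ (J j).deadline
  fits : ∀ x, t ≤ x → total (fun j => (J j).arrival < t ∧ (J j).deadline ≤ x) r ≤ x - t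

/-- The system is off. -/
structure OffPhase (P : PowerModel) (J : ι → Job) (t e : ℝ) (r : ι → ℝ) (s : SysState) : Prop where
  base : Base J t e r
  off : s.IsOff
  calm : s.urgent = false
  unstarted : ∀ j, e < (J j).arrival → r j = (J j).exec
  relaxed : ∀ j ∈ openJobs J r t, t < anchor P 1 (J j)
  loose : ∀ x, t < x → total (fun j => (J j).arrival ≤ t ∧ (J j).deadline ≤ x) r < x - t

/-- Only `M₁` is on, and the rules have not yet been applied at time `t`. -/
structure PreSingle (P : PowerModel) (J : ι → Job) (t e : ℝ) (r : ι → ℝ) (s : SysState) :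
    Prop where
  base : Base J t e r
  on0 : s.on 0 = true
  on1 : s.on 1 = false
  calm : s.urgent = false
  e_lt : e < s.t1
  t1_le : s.t1 ≤ t
  trig : Trigger P J e s.t1
  -- Had such a job been due earlier, its anchor would have woken the system before `t1`.
  early : ∀ j, e < (J j).arrival → (J j).arrival < s.t1 → s.t1 + P.breakEven ≤ (J j).deadline
  fits : ∀ x, t ≤ x → total (fun j => (J j).arrival < t ∧ (J j).deadline ≤ x) r ≤ x - t
  -- Busy-period dichotomy for the jobs due by `x`: `M₁` has worked on them without pause since
  -- `t1`, or since some `y` at which only new arrivals were pending. The first alternative involves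
  -- jobs older than `t1`, so only the second one is controlled by `EDFCondition`.
  slack : ∀ x, total (fun j => (J j).arrival ≤ t ∧ (J j).deadline ≤ x) r + (t - s.t1) ≤
      total (fun j => (e < (J j).arrival ∧ (J j).arrival ≤ t) ∧ (J j).deadline ≤ x)
        (fun j => (J j).exec) ∨
    ∃ y, s.t1 ≤ y ∧ y ≤ t ∧
      total (fun j => (J j).arrival ≤ t ∧ (J j).deadline ≤ x) r + (t - y) ≤
      total (fun j => (y ≤ (J j).arrival ∧ (J j).arrival ≤ t) ∧ (J j).deadline ≤ x)
        (fun j => (J j).exec)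
  -- The left side is the standby time of `M₁` in the current period.
  idle : (t - s.t1) - total (fun j => e < (J j).arrival) (fun j => (J j).exec - r j) ≤ P.breakEven

/-- Only `M₁` is on. -/
structure SinglePhase (P : PowerModel) (J : ι → Job) (t e : ℝ) (r : ι → ℝ) (s : SysState) : Prop
    extends PreSingle P J t e r s where
  loose : ∀ x, t < x → total (fun j => (J j).arrival ≤ t ∧ (J j).deadline ≤ x) r ≤ x - t
  awake : (openJobs J r t).Nonempty ∨ t < s.t1 + P.breakEven

/-- The urgency flag is true, and the rules have not yet been applied at time `t`. -/
structure PreUrgent (P : PowerModel) (J : ι → Job) (t e : ℝ) (r : ι → ℝ) (s : SysState) :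
    Prop where
  base : Base J t e r
  on0 : s.on 0 = true
  on1 : s.on 1 = true
  flag : s.urgent = true
  e_lt : e < s.t1
  t1_le : s.t1 ≤ s.tStar
  tStar_le : s.tStar ≤ t
  trig : Trigger P J e s.t1
  bulk : P.breakEven ≤ total (fun j => e < (J j).arrival ∧ (J j).arrival ≤ s.tStar)
    (fun j => (J j).exec)
  -- `M₁` has been busy ever since `t1`.
  oldDone : t - s.t1 ≤ total (fun j => e < (J j).arrival ∧ (J j).arrival < s.tStar)
    (fun j => (J j).exec - r j)
  fitsOld : ∀ x, t ≤ x →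
    total (fun j => (J j).arrival < s.tStar ∧ (J j).deadline ≤ x) r ≤ x - t
  slack : ∀ x, ∃ y, s.tStar ≤ y ∧ y ≤ t ∧
      total (fun j => (s.tStar ≤ (J j).arrival ∧ (J j).arrival ≤ t) ∧ (J j).deadline ≤ x) r
        + (t - y) ≤
      total (fun j => (y ≤ (J j).arrival ∧ (J j).arrival ≤ t) ∧ (J j).deadline ≤ x)
        (fun j => (J j).exec)

/-- The urgency flag is true. -/
structure UrgentPhase (P : PowerModel) (J : ι → Job) (t e : ℝ) (r : ι → ℝ) (s : SysState) : Prop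
    extends PreUrgent P J t e r s where
  busy : ∃ j ∈ openJobs J r t, (J j).arrival < s.tStar

/-- Only `M₂` is on, and the rules have not yet been applied at time `t`. -/
structure PreTail (P : PowerModel) (J : ι → Job) (t e : ℝ) (r : ι → ℝ) (s : SysState) :
    Prop where
  base : Base J t e r
  on0 : s.on 0 = false
  on1 : s.on 1 = true
  calm : s.urgent = false
  e_lt : e < s.t1
  t1_le : s.t1 ≤ s.tStar
  tStar_le : s.tStar ≤ t
  trig : Trigger P J e s.t1
  bulk : P.breakEven ≤ total (fun j => e < (J j).arrival ∧ (J j).arrival ≤ s.tStar)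
    (fun j => (J j).exec)
  oldDone : ∀ j, (J j).arrival < s.tStar → r j = 0
  -- The left side is the standby time of `M₂`, which executes only jobs arriving from `tStar` on.
  idle : (t - s.tStar) - total (fun j => s.tStar ≤ (J j).arrival) (fun j => (J j).exec - r j) ≤
    total (fun j => e < (J j).arrival ∧ (J j).arrival ≤ s.tStar) (fun j => (J j).exec)
  slack : ∀ x, ∃ y, s.tStar ≤ y ∧ y ≤ t ∧
      total (fun j => (s.tStar ≤ (J j).arrival ∧ (J j).arrival ≤ t) ∧ (J j).deadline ≤ x) r
        + (t - y) ≤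
      total (fun j => (y ≤ (J j).arrival ∧ (J j).arrival ≤ t) ∧ (J j).deadline ≤ x)
        (fun j => (J j).exec)

/-- Only `M₂` is on. -/
structure TailPhase (P : PowerModel) (J : ι → Job) (t e : ℝ) (r : ι → ℝ) (s : SysState) : Prop
    extends PreTail P J t e r s where
  awake : (openJobs J r t).Nonempty ∨ t < s.t1 + P.breakEven

/-- In state `s`, the jobs that processor `m` is responsible for. -/
def responsible (J : ι → Job) (s : SysState) (m : Fin 2) (j : ι) : Prop :=
  s.urgent = true → if m = 0 then (J j).arrival < s.tStar else s.tStar ≤ (J j).arrival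

/-- The evolution of the remaining execution times from `r` at time `u` to `r'` at time `t` while
the system is in state `s` and no job arrives strictly in between. -/
structure Segment (P : PowerModel) (J : ι → Job) (s : SysState) (u : ℝ) (r : ι → ℝ) (t : ℝ)
    (r' : ι → ℝ) : Prop where
  lt : u < t
  quiet : ∀ j, (J j).arrival ≤ u ∨ t ≤ (J j).arrival
  nonneg : ∀ j, 0 ≤ r' j
  anti : ∀ j, r' j ≤ r j
  unarrived : ∀ j, t ≤ (J j).arrival → r' j = r j
  frozen : s.IsOff → r' = r
  drain : ∀ m, s.on m = true → ∀ x,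
    total (fun j => ((J j).arrival ≤ u ∧ responsible J s m j) ∧ (J j).deadline ≤ x) r' =
    max 0 (total (fun j => ((J j).arrival ≤ u ∧ responsible J s m j) ∧ (J j).deadline ≤ x) r
      - (t - u))
  stay_off : s.IsOff → (∀ j, (J j).arrival ≤ u → 0 < r j → t ≤ anchor P 1 (J j)) ∧
    ∀ x, t ≤ x → total (fun j => (J j).arrival ≤ u ∧ (J j).deadline ≤ x) r ≤ x - t
  stay_on : s.urgent = false → ¬ s.IsOff → total (fun j => (J j).arrival ≤ u) r < t - u →
    t ≤ s.t1 + P.breakEven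
  stay_urgent : s.urgent = true →
    t - u ≤ total (fun j => (J j).arrival ≤ u ∧ (J j).arrival < s.tStar) r

variable {P : PowerModel} {J : ι → Job} {s : SysState} {t u e : ℝ} {r r' : ι → ℝ}

theorem Base.eq_zero (h : Base J t e r) {A : ι → Prop} {x : ℝ} (hx : total A r ≤ x)
    (hx0 : x ≤ 0) {j : ι} (hj : A j) : r j = 0 :=
  le_antisymm ((single_le_total h.nonneg hj).trans (hx.trans hx0)) (h.nonneg j)

/-- The routine part of `Base` at the end of a segment. -/
theorem Segment.base (h : Segment P J s u r t r') (hJ : EDFCondition J) (hb : Base J u e r)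
    (hdue : ∀ j, (J j).arrival ≤ u → (J j).deadline ≤ t → u < (J j).deadline → r' j = 0) :
    Base J t e r' where
  nonneg := h.nonneg
  le_exec j := (h.anti j).trans (hb.le_exec j)
  future j hj := by rw [h.unarrived j hj, hb.future j (h.lt.le.trans hj)]
  past j hj := le_antisymm ((h.anti j).trans (hb.past j hj).le) (h.nonneg j)
  due j hj := by
    rcases h.quiet j with h1 | h1
    · rcases le_or_gt (J j).deadline u with h2 | h2
      · exact le_antisymm ((h.anti j).trans (hb.due j h2).le) (h.nonneg j)
      · exact hdue j h1 hj h2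
    · exact absurd (hJ.arrival_lt_deadline j) (not_lt.2 (hj.trans h1))
  e_le := hb.e_le.trans h.lt.le

theorem OffPhase.segment (hp : OffPhase P J u e r s) (hJ : EDFCondition J)
    (h : Segment P J s u r t r') : PreOff P J t e r' s := by
  obtain rfl := h.frozen hp.off
  obtain ⟨h1, h2⟩ := h.stay_off hp.off
  have hlt : ∀ j, (J j).arrival < t ↔ (J j).arrival ≤ u := fun j =>
    ⟨fun hj => (h.quiet j).resolve_right (not_le.2 hj), fun hj => hj.trans_lt h.lt⟩
  refine ⟨h.base hJ hp.base fun j hj hd _ => ?_, hp.off, hp.calm, hp.unstarted,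
    fun j hj hjt => ?_, fun x hx => ?_⟩
  · exact hp.base.eq_zero (h2 t le_rfl) (sub_self t).le ⟨hj, hd⟩
  -- Since `j` arrived before `t`, the bound by the anchor concerns its second entry, which for
  -- parameter `1` is the deadline minus the break-even time.
  · have := h1 j ((hlt j).1 hjt) (by rw [hp.unstarted j hj]; exact (J j).exec_pos)
    rcases le_max_iff.1 this with h3 | h3
    · linarith
    · linarith
  · simpa only [hlt] using h2 x hx

theorem exists_total_eq (J : ι → Job) (A : ι → Prop) (r r' : ι → ℝ) :
    ∃ X, total (fun j => A j ∧ (J j).deadline ≤ X) r = total A r ∧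
      total (fun j => A j ∧ (J j).deadline ≤ X) r' = total A r' := by
  obtain ⟨X, -, hX⟩ := exists_deadline_bound J 0
  exact ⟨X, total_congr (fun j => and_iff_left (hX j)) (fun _ _ => rfl),
    total_congr (fun j => and_iff_left (hX j)) (fun _ _ => rfl)⟩

theorem Segment.drain_all (h : Segment P J s u r t r') {m : Fin 2} (hm : s.on m = true) :
    total (fun j => (J j).arrival ≤ u ∧ responsible J s m j) r' =
    max 0 (total (fun j => (J j).arrival ≤ u ∧ responsible J s m j) r - (t - u)) := by
  obtain ⟨X, h1, h2⟩ :=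
    exists_total_eq J (fun j => (J j).arrival ≤ u ∧ responsible J s m j) r r'
  rw [← h1, ← h2]
  exact h.drain m hm X

theorem responsible_of_calm {ι : Type*} {J : ι → Job} {s : SysState} (hs : s.urgent = false) (m : Fin 2) (j : ι) : responsible J s m j :=
  fun h => by simp [hs] at h

theorem responsible_disjoint {ι : Type*} {J : ι → Job} {s : SysState}
    (hs : s.urgent = false → s.on 0 = false ∨ s.on 1 = false) {m m' : Fin 2} (hne : m ≠ m') {j : ι}
    (h : s.on m = true ∧ responsible J s m j) : ¬ (s.on m' = true ∧ responsible J s m' j) := by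
  rintro ⟨h1, h2⟩
  cases hur : s.urgent
  · have := hs hur
    fin_cases m <;> fin_cases m' <;> simp_all
  · have h3 := h.2 hur
    have h4 := h2 hur
    fin_cases m <;> fin_cases m'
    · exact hne rfl
    · simp at h3 h4; linarith
    · simp at h3 h4; linarith
    · exact hne rfl

/-- After the arrivals at the end of a segment, the pending work either has decreased at unit speed,
or consists of these arrivals only. -/
theorem Segment.slack (h : Segment P J s u r t r') (hb : Base J u e r) {A : ι → Prop} {x : ℝ}
    (hA : ∀ j, t ≤ (J j).arrival → A j)
    (hd : total (fun j => ((J j).arrival ≤ u ∧ A j) ∧ (J j).deadline ≤ x) r' =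
      max 0 (total (fun j => ((J j).arrival ≤ u ∧ A j) ∧ (J j).deadline ≤ x) r - (t - u))) :
    total (fun j => ((J j).arrival ≤ t ∧ A j) ∧ (J j).deadline ≤ x) r' + (t - u) =
      total (fun j => ((J j).arrival ≤ u ∧ A j) ∧ (J j).deadline ≤ x) r +
      total (fun j => (u < (J j).arrival ∧ (J j).arrival ≤ t) ∧ (J j).deadline ≤ x)
        (fun j => (J j).exec) ∨
    total (fun j => ((J j).arrival ≤ t ∧ A j) ∧ (J j).deadline ≤ x) r' =
      total (fun j => (t ≤ (J j).arrival ∧ (J j).arrival ≤ t) ∧ (J j).deadline ≤ x)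
        (fun j => (J j).exec) := by
  have hsp : total (fun j => ((J j).arrival ≤ t ∧ A j) ∧ (J j).deadline ≤ x) r' =
      total (fun j => ((J j).arrival ≤ u ∧ A j) ∧ (J j).deadline ≤ x) r' +
      total (fun j => (u < (J j).arrival ∧ (J j).arrival ≤ t) ∧ (J j).deadline ≤ x) r' := by
    refine total_split _ (fun j => ⟨fun hj => ?_, fun hj => ?_⟩) fun j hj hj' =>
      absurd hj.1.1 (not_le.2 hj'.1.1)
    · rcases le_or_gt (J j).arrival u with h1 | h1
      · exact Or.inl ⟨⟨h1, hj.1.2⟩, hj.2⟩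
      · exact Or.inr ⟨⟨h1, hj.1.1⟩, hj.2⟩
    · rcases hj with hj | hj
      · exact ⟨⟨hj.1.1.trans h.lt.le, hj.1.2⟩, hj.2⟩
      · exact ⟨⟨hj.1.2, hA j ((h.quiet j).resolve_left (not_le.2 hj.1.1))⟩, hj.2⟩
  have hnew : total (fun j => (u < (J j).arrival ∧ (J j).arrival ≤ t) ∧ (J j).deadline ≤ x) r' =
      total (fun j => (u < (J j).arrival ∧ (J j).arrival ≤ t) ∧ (J j).deadline ≤ x)
        (fun j => (J j).exec) := by
    refine total_congr (fun _ => Iff.rfl) fun j hj => ?_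
    rw [h.unarrived j ((h.quiet j).resolve_left (not_le.2 hj.1.1)), hb.future j hj.1.1.le]
  rcases max_choice 0 (total (fun j => ((J j).arrival ≤ u ∧ A j) ∧ (J j).deadline ≤ x) r - (t - u))
    with h0 | h0
  · right
    rw [hsp, hd, h0, hnew, zero_add]
    refine total_congr (fun j => ?_) fun _ _ => rfl
    refine and_congr_left fun _ => and_congr_left fun _ => ⟨fun hj => ?_, fun hj => h.lt.trans_le hj⟩
    exact (h.quiet j).resolve_left (not_le.2 hj)
  · left
    rw [hsp, hd, h0, hnew]
    ring

/-- Late arrivals add to a sum of execution times. -/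
theorem total_exec_add (hut : u ≤ t) (A : ι → Prop) (x : ℝ) (hA : ∀ j, u < (J j).arrival → A j) :
    total (fun j => (A j ∧ (J j).arrival ≤ u) ∧ (J j).deadline ≤ x) (fun j => (J j).exec) +
    total (fun j => (u < (J j).arrival ∧ (J j).arrival ≤ t) ∧ (J j).deadline ≤ x)
        (fun j => (J j).exec) =
    total (fun j => (A j ∧ (J j).arrival ≤ t) ∧ (J j).deadline ≤ x) (fun j => (J j).exec) := by
  symm
  refine total_split _ (fun j => ⟨fun hj => ?_, fun hj => ?_⟩) fun j hj hj' =>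
      absurd hj.1.2 (not_le.2 hj'.1.1)
  · rcases le_or_gt (J j).arrival u with h1 | h1
    · exact Or.inl ⟨⟨hj.1.1, h1⟩, hj.2⟩
    · exact Or.inr ⟨⟨h1, hj.1.2⟩, hj.2⟩
  · rcases hj with hj | hj
    · exact ⟨⟨hj.1.1, hj.1.2.trans hut⟩, hj.2⟩
    · exact ⟨⟨hA j hj.1.1, hj.1.2⟩, hj.2⟩

theorem SinglePhase.segment (hp : SinglePhase P J u e r s) (hJ : EDFCondition J)
    (h : Segment P J s u r t r') : PreSingle P J t e r' s := by
  have hlt : ∀ j, (J j).arrival < t ↔ (J j).arrival ≤ u := fun j =>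
    ⟨fun hj => (h.quiet j).resolve_right (not_le.2 hj), fun hj => hj.trans_lt h.lt⟩
  have hr : ∀ j, responsible J s 0 j ↔ True := fun j => by
    simp [responsible_of_calm hp.calm]
  have hd := h.drain 0 hp.on0
  simp only [hr] at hd
  have fits : ∀ x, t ≤ x →
      total (fun j => (J j).arrival < t ∧ (J j).deadline ≤ x) r' ≤ x - t := by
    intro x hx
    have h1 := hd x
    have h2 := hp.loose x (h.lt.trans_le hx)
    simp only [and_true] at h1
    simp only [hlt, h1]
    exact max_le (by linarith) (by linarith)
  have hoff : ¬ s.IsOff := fun ho => by simpa [hp.on0] using ho 0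
  have hbase : Base J t e r' := by
    refine h.base hJ hp.base fun j hj hdj _ => ?_
    have h1 := single_le_total h.nonneg (A := fun j => (J j).arrival < t ∧ (J j).deadline ≤ t) (j := j)
      ⟨(hlt j).2 hj, hdj⟩
    exact le_antisymm (h1.trans ((fits t le_rfl).trans (sub_self t).le)) (h.nonneg j)
  refine ⟨hbase, hp.on0, hp.on1, hp.calm, hp.e_lt, hp.t1_le.trans h.lt.le, hp.trig, hp.early, fits,
    fun x => ?_, ?_⟩
  · have h1 := h.slack hp.base (A := fun _ => True) (fun _ _ => trivial) (hd x)
    simp only [and_true] at h1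
    rcases h1 with h1 | h1
    · rcases hp.slack x with h2 | ⟨y, hy1, hy2, h2⟩
      · left
        rw [← total_exec_add h.lt.le (fun j => e < (J j).arrival) x
          fun j hj => hp.base.e_le.trans_lt hj]
        linarith
      · refine Or.inr ⟨y, hy1, hy2.trans h.lt.le, ?_⟩
        rw [← total_exec_add h.lt.le (fun j => y ≤ (J j).arrival) x
          fun j hj => hy2.trans hj.le]
        linarith
    -- The work due by `x` ran out within the segment, and a new busy period starts at `t`.
    · exact Or.inr ⟨t, hp.t1_le.trans h.lt.le, le_rfl, by rw [h1]; simp⟩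
  · have h1 := h.drain_all hp.on0
    simp only [hr, and_true] at h1
    have h3 := hp.idle
    have h4 : total (fun j => e < (J j).arrival) (fun j => (J j).exec - r' j) -
        total (fun j => e < (J j).arrival) (fun j => (J j).exec - r j) =
        total (fun j => (J j).arrival ≤ u) r - total (fun j => (J j).arrival ≤ u) r' := by
      rw [← total_sub, ← total_sub]
      classical
      refine Finset.sum_congr rfl fun j _ => ?_
      rcases le_or_gt (J j).arrival u with h5 | h5
      · rcases le_or_gt (J j).arrival e with h6 | h6
        · simp [h5, not_lt.2 h6, hp.base.past j h6, hbase.past j h6]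
        · simp [h5, h6]
      · simp [not_le.2 h5, h.unarrived j ((h.quiet j).resolve_left (not_le.2 h5))]
    rcases lt_or_ge (total (fun j => (J j).arrival ≤ u) r) (t - u) with h2 | h2
    · have h5 := h.stay_on hp.calm hoff h2
      have h6 : 0 ≤ total (fun j => e < (J j).arrival) (fun j => (J j).exec - r' j) :=
        total_nonneg fun j _ => sub_nonneg.2 (hbase.le_exec j)
      linarith
    · rw [max_eq_right (by linarith)] at h1
      linarith

/-- The jobs counted on the right arrive from `y` on and are due by `x`, so their total is at most
`x - y`, of which `t - y` has already been worked off. -/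
theorem slack_fits (hJ : EDFCondition J) {A : ι → Prop} {a x : ℝ} (hux : t < x)
    (h : ∃ y, a ≤ y ∧ y ≤ t ∧ total A r + (t - y) ≤
      total (fun j => (y ≤ (J j).arrival ∧ (J j).arrival ≤ t) ∧ (J j).deadline ≤ x)
        (fun j => (J j).exec)) : total A r ≤ x - t := by
  obtain ⟨y, h1, h2, h3⟩ := h
  have h4 := hJ.total_le (l := y) (r := x) (by linarith)
  have h5 := total_mono (f := fun j => (J j).exec) (fun j => (J j).exec_pos.le)
    (A := fun j => (y ≤ (J j).arrival ∧ (J j).arrival ≤ t) ∧ (J j).deadline ≤ x)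
    (B := fun j => y ≤ (J j).arrival ∧ (J j).deadline ≤ x) fun j hj => ⟨hj.1.1, hj.2⟩
  linarith

/-- The slack condition of `M₂` survives a segment. -/
theorem Segment.slack_late (h : Segment P J s u r t r') (hb : Base J u e r) {a x : ℝ} (ha : a ≤ u)
    (hd : total (fun j => ((J j).arrival ≤ u ∧ a ≤ (J j).arrival) ∧ (J j).deadline ≤ x) r' =
      max 0 (total (fun j => ((J j).arrival ≤ u ∧ a ≤ (J j).arrival) ∧ (J j).deadline ≤ x) r
        - (t - u)))
    (hs : ∃ y, a ≤ y ∧ y ≤ u ∧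
      total (fun j => (a ≤ (J j).arrival ∧ (J j).arrival ≤ u) ∧ (J j).deadline ≤ x) r
        + (u - y) ≤
      total (fun j => (y ≤ (J j).arrival ∧ (J j).arrival ≤ u) ∧ (J j).deadline ≤ x)
        (fun j => (J j).exec)) :
    ∃ y, a ≤ y ∧ y ≤ t ∧
      total (fun j => (a ≤ (J j).arrival ∧ (J j).arrival ≤ t) ∧ (J j).deadline ≤ x) r'
        + (t - y) ≤
      total (fun j => (y ≤ (J j).arrival ∧ (J j).arrival ≤ t) ∧ (J j).deadline ≤ x)
        (fun j => (J j).exec) := by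
  have h1 := h.slack hb (A := fun j => a ≤ (J j).arrival)
    (fun j hj => ha.trans (h.lt.le.trans hj)) hd
  simp only [and_comm (b := a ≤ _)] at h1
  rcases h1 with h1 | h1
  · obtain ⟨y, hy1, hy2, h2⟩ := hs
    refine ⟨y, hy1, hy2.trans h.lt.le, ?_⟩
    rw [← total_exec_add h.lt.le (fun j => y ≤ (J j).arrival) x fun j hj => hy2.trans hj.le]
    linarith
  · exact ⟨t, ha.trans h.lt.le, le_rfl, by rw [h1]; simp⟩

theorem UrgentPhase.segment (hp : UrgentPhase P J u e r s) (hJ : EDFCondition J)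
    (h : Segment P J s u r t r') : PreUrgent P J t e r' s := by
  have hr0 : ∀ j, responsible J s 0 j ↔ (J j).arrival < s.tStar := fun j => by
    simp [responsible, hp.flag]
  have hr1 : ∀ j, responsible J s 1 j ↔ s.tStar ≤ (J j).arrival := fun j => by
    simp [responsible, hp.flag]
  have hd0 := h.drain 0 hp.on0
  have hd1 := h.drain 1 hp.on1
  simp only [hr0] at hd0
  simp only [hr1] at hd1
  have hold : ∀ j, (J j).arrival < s.tStar ↔ (J j).arrival ≤ u ∧ (J j).arrival < s.tStar :=
    fun j => ⟨fun hj => ⟨hj.le.trans hp.tStar_le, hj⟩, fun hj => hj.2⟩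
  have fitsOld : ∀ x, t ≤ x →
      total (fun j => (J j).arrival < s.tStar ∧ (J j).deadline ≤ x) r' ≤ x - t := by
    intro x hx
    have h2 := hp.fitsOld x (h.lt.le.trans hx)
    simp only [fun j => (and_congr_left fun _ => hold j :
      (J j).arrival < s.tStar ∧ (J j).deadline ≤ x ↔ _)] at h2 ⊢
    rw [hd0 x]
    exact max_le (by linarith) (by linarith)
  have hslack := fun x => h.slack_late hp.base hp.tStar_le (hd1 x) (hp.slack x)
  have hbase : Base J t e r' := by
    refine h.base hJ hp.base fun j hj hdj hud => ?_
    rcases lt_or_ge (J j).arrival s.tStar with h1 | h1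
    · have h2 := single_le_total h.nonneg
        (A := fun j => (J j).arrival < s.tStar ∧ (J j).deadline ≤ t) (j := j) ⟨h1, hdj⟩
      exact le_antisymm (h2.trans ((fitsOld t le_rfl).trans (sub_self t).le)) (h.nonneg j)
    -- At time `u` the late work due by the deadline of `j` is at most this deadline minus `u`,
    -- hence at most `t - u`; `M₂` finishes it within the segment.
    · have h2 := slack_fits hJ hud (hp.slack (J j).deadline)
      have h3 := hd1 (J j).deadline
      simp only [and_comm (b := s.tStar ≤ _)] at h3
      rw [max_eq_left (by linarith)] at h3
      have h2 := single_le_total h.nonneg (A := fun i => (s.tStar ≤ (J i).arrival ∧ (J i).arrival ≤ u) ∧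
        (J i).deadline ≤ (J j).deadline) (j := j) ⟨⟨h1, hj⟩, le_rfl⟩
      exact le_antisymm (h2.trans h3.le) (h.nonneg j)
  refine ⟨hbase, hp.on0, hp.on1, hp.flag, hp.e_lt, hp.t1_le, hp.tStar_le.trans h.lt.le, hp.trig,
    hp.bulk, ?_, fitsOld, hslack⟩
  have h1 := h.drain_all hp.on0
  have h2 := h.stay_urgent hp.flag
  simp only [hr0] at h1
  rw [max_eq_right (by linarith)] at h1
  have h3 := hp.oldDone
  have h4 : total (fun j => e < (J j).arrival ∧ (J j).arrival < s.tStar)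
        (fun j => (J j).exec - r' j) -
      total (fun j => e < (J j).arrival ∧ (J j).arrival < s.tStar) (fun j => (J j).exec - r j) =
      total (fun j => (J j).arrival ≤ u ∧ (J j).arrival < s.tStar) r -
      total (fun j => (J j).arrival ≤ u ∧ (J j).arrival < s.tStar) r' := by
    rw [← total_sub, ← total_sub]
    classical
    refine Finset.sum_congr rfl fun j _ => ?_
    simp only [← hold j]
    rcases le_or_gt (J j).arrival e with h6 | h6
    · simp [not_lt.2 h6, hp.base.past j h6, hbase.past j h6]
    · simp [h6]
  linarith

theorem TailPhase.segment (hp : TailPhase P J u e r s) (hJ : EDFCondition J)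
    (h : Segment P J s u r t r') : PreTail P J t e r' s := by
  have hr : ∀ j, responsible J s 1 j ↔ True := fun j => by
    simp [responsible_of_calm hp.calm]
  have hoff : ¬ s.IsOff := fun ho => by simpa [hp.on1] using ho 1
  have hzero' : ∀ j, (J j).arrival < s.tStar → r' j = 0 := fun j hj =>
    le_antisymm ((h.anti j).trans (hp.oldDone j hj).le) (h.nonneg j)
  have key : ∀ {f : ι → ℝ} (A : ι → Prop), (∀ j, (J j).arrival < s.tStar → f j = 0) →
      total (fun j => ((J j).arrival ≤ u ∧ s.tStar ≤ (J j).arrival) ∧ A j) f =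
      total (fun j => (J j).arrival ≤ u ∧ A j) f := by
    intro f A hf
    classical
    refine Finset.sum_congr rfl fun j _ => ?_
    rcases lt_or_ge (J j).arrival s.tStar with h1 | h1
    · simp [hf j h1]
    · simp [h1]
  have hd1 : ∀ x, total (fun j => ((J j).arrival ≤ u ∧ s.tStar ≤ (J j).arrival) ∧
        (J j).deadline ≤ x) r' =
      max 0 (total (fun j => ((J j).arrival ≤ u ∧ s.tStar ≤ (J j).arrival) ∧
        (J j).deadline ≤ x) r - (t - u)) := by
    intro x
    have hd := h.drain 1 hp.on1 x
    simp only [hr, and_true] at hd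
    rw [key _ hzero', key _ hp.oldDone, hd]
  have hslack := fun x => h.slack_late hp.base hp.tStar_le (hd1 x) (hp.slack x)
  have hbase : Base J t e r' := by
    refine h.base hJ hp.base fun j hj hdj hud => ?_
    rcases lt_or_ge (J j).arrival s.tStar with h1 | h1
    · exact hzero' j h1
    · have h2 := slack_fits hJ hud (hp.slack (J j).deadline)
      have h3 := hd1 (J j).deadline
      simp only [and_comm (b := s.tStar ≤ _)] at h3
      rw [max_eq_left (by linarith)] at h3
      have h2 := single_le_total h.nonneg (A := fun i => (s.tStar ≤ (J i).arrival ∧ (J i).arrival ≤ u) ∧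
        (J i).deadline ≤ (J j).deadline) (j := j) ⟨⟨h1, hj⟩, le_rfl⟩
      exact le_antisymm (h2.trans h3.le) (h.nonneg j)
  refine ⟨hbase, hp.on0, hp.on1, hp.calm, hp.e_lt, hp.t1_le, hp.tStar_le.trans h.lt.le, hp.trig,
    hp.bulk, hzero', ?_, hslack⟩
  have h1 := h.drain_all hp.on1
  simp only [hr, and_true] at h1
  have h3 := hp.idle
  have h4 : total (fun j => s.tStar ≤ (J j).arrival) (fun j => (J j).exec - r' j) -
      total (fun j => s.tStar ≤ (J j).arrival) (fun j => (J j).exec - r j) =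
      total (fun j => (J j).arrival ≤ u) r - total (fun j => (J j).arrival ≤ u) r' := by
    rw [← total_sub, ← total_sub]
    classical
    refine Finset.sum_congr rfl fun j _ => ?_
    rcases le_or_gt (J j).arrival u with h5 | h5
    · rcases lt_or_ge (J j).arrival s.tStar with h6 | h6
      · simp [h5, not_le.2 h6, hp.oldDone j h6, hzero' j h6]
      · simp [h5, h6]
    · simp [not_le.2 h5, h.unarrived j ((h.quiet j).resolve_left (not_le.2 h5))]
  -- If `M₂` runs out of work, then `t ≤ t1 + B ≤ tStar + B`, and `bulk` covers the whole time since
  -- `tStar`. Otherwise its standby time does not change.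
  rcases lt_or_ge (total (fun j => (J j).arrival ≤ u) r) (t - u) with h2 | h2
  · have h5 := h.stay_on hp.calm hoff h2
    have h6 : 0 ≤ total (fun j => s.tStar ≤ (J j).arrival) (fun j => (J j).exec - r' j) :=
      total_nonneg fun j _ => sub_nonneg.2 (hbase.le_exec j)
    linarith [hp.bulk, hp.t1_le]
  · rw [max_eq_right (by linarith)] at h1
    linarith

end Configurations

/-! ### Effect of the switching rules on the phases. -/

section Transitions

variable {ι : Type*} [Fintype ι] {P : PowerModel} {J : ι → Job} {s : SysState} {t e : ℝ}
  {r : ι → ℝ}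

theorem SysState.wakeUp_of_on {ι : Type*} {P : PowerModel} {J : ι → Job} {s : SysState} {t : ℝ}
    {lam : ℝ} {Q : Set ι} {W : ℝ → ℝ} {m : Fin 2}
    (h : s.on m = true) : s.wakeUp P lam J Q W t = s :=
  if_neg fun hc => by simpa [h] using hc.1 m

theorem SysState.raiseUrgency_of_fits {s : SysState} {t : ℝ} {W : ℝ → ℝ}
    (h : ∀ x, t < x → W x ≤ x - t) : s.raiseUrgency W t = s :=
  if_neg fun ⟨_, x, hx, hW⟩ => absurd (h x hx) (not_le.2 hW)

theorem SysState.raiseUrgency_of_urgent {s : SysState} {t : ℝ} {W : ℝ → ℝ}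
    (h : s.urgent = true) : s.raiseUrgency W t = s :=
  if_neg fun hc => by simp [h] at hc

theorem SysState.clearUrgency_of_calm {ι : Type*} {J : ι → Job} {s : SysState} {Q : Set ι}
    (h : s.urgent = false) : s.clearUrgency J Q = s :=
  if_neg fun hc => by simp [h] at hc

theorem SysState.shutDown_of_awake {ι : Type*} {P : PowerModel} {s : SysState} {t : ℝ} {Q : Set ι}
    (h : Q.Nonempty ∨ t < s.t1 + P.breakEven) : s.shutDown P Q t = s :=
  if_neg fun hc => h.elim (fun h => h.ne_empty hc.2.2.1) fun h => by linarith [hc.2.2.2]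

theorem OffPhase.update_eq (h : OffPhase P J t e r s) :
    s.update P 1 J (openJobs J r t) (dueWork J r t) t = s := by
  have h1 : s.wakeUp P 1 J (openJobs J r t) (dueWork J r t) t = s := by
    refine if_neg fun hc => ?_
    rcases hc.2 with ⟨j, hj, ha⟩ | ⟨x, hx, hW⟩
    · exact absurd (h.relaxed j hj) (not_lt.2 ha)
    · rw [dueWork_eq h.base.nonneg] at hW
      exact absurd (h.loose x hx) (not_lt.2 hW)
  rw [SysState.update, h1, SysState.raiseUrgency_of_fits, SysState.clearUrgency_of_calm h.calm]
  · exact if_neg fun hc => hc.2.1 h.off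
  · intro x hx
    rw [dueWork_eq h.base.nonneg]
    exact (h.loose x hx).le

theorem SinglePhase.update_eq (h : SinglePhase P J t e r s) :
    s.update P 1 J (openJobs J r t) (dueWork J r t) t = s := by
  rw [SysState.update, SysState.wakeUp_of_on h.on0, SysState.raiseUrgency_of_fits,
    SysState.clearUrgency_of_calm h.calm, SysState.shutDown_of_awake h.awake]
  intro x hx
  rw [dueWork_eq h.base.nonneg]
  exact h.loose x hx

theorem UrgentPhase.update_eq (h : UrgentPhase P J t e r s) :
    s.update P 1 J (openJobs J r t) (dueWork J r t) t = s := by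
  obtain ⟨j, hj, hjt⟩ := h.busy
  have h1 : s.clearUrgency J (openJobs J r t) = s :=
    if_neg fun hc => absurd (hc.2 j hj) (not_le.2 hjt)
  rw [SysState.update, SysState.wakeUp_of_on h.on0, SysState.raiseUrgency_of_urgent h.flag, h1,
    SysState.shutDown_of_awake (Or.inl ⟨j, hj⟩)]

/-- All pending jobs arrived from `tStar` on, so `EDFCondition` makes them fit. Hence urgency occurs
at most once in a period, and `M₁` is turned on only once. -/
theorem PreTail.fits (h : PreTail P J t e r s) (hJ : EDFCondition J) {x : ℝ} (hx : t < x) :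
    dueWork J r t x ≤ x - t := by
  rw [dueWork_eq h.base.nonneg]
  refine le_trans (le_of_eq ?_) (slack_fits hJ hx (h.slack x))
  classical
  refine Finset.sum_congr rfl fun j _ => ?_
  rcases lt_or_ge (J j).arrival s.tStar with h1 | h1
  · simp [h.oldDone j h1]
  · simp [h1]

theorem TailPhase.update_eq (h : TailPhase P J t e r s) (hJ : EDFCondition J) :
    s.update P 1 J (openJobs J r t) (dueWork J r t) t = s := by
  rw [SysState.update, SysState.wakeUp_of_on h.on1,
    SysState.raiseUrgency_of_fits fun x hx => h.fits hJ hx,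
    SysState.clearUrgency_of_calm h.calm, SysState.shutDown_of_awake h.awake]

/-- Turning everything off when no job is open. -/
theorem Base.shutDown (h : Base J t e r) (hQ : openJobs J r t = ∅) (hs : s.urgent = false)
    (hoff : s.IsOff) : OffPhase P J t t r s := by
  have h0 : ∀ j, (J j).arrival ≤ t → r j = 0 := fun j hj =>
    le_antisymm (not_lt.1 fun hr => by simpa [hQ] using (show j ∈ openJobs J r t from ⟨hj, hr⟩))
      (h.nonneg j)
  refine ⟨⟨h.nonneg, h.le_exec, h.future, h0, h.due, le_rfl⟩, hoff, hs,
    fun j hj => h.future j hj.le, by simp [hQ], fun x hx => ?_⟩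
  rw [total_eq_zero fun j hj => h0 j hj.1]
  linarith

/-- The state after the urgency flag has been raised at time `t`, when `M₁` is on. -/
def SysState.raised (s : SysState) (t : ℝ) : SysState :=
  { s with on := Function.update s.on 1 true, urgent := true, tStar := t }

/-- The central step: excessive backlog shows that `M₁` has been busy since `t1` and that work of at
least the break-even time has arrived in the period. The first fact saves the standby time of `M₁`,
the second pays for that of `M₂`. -/
theorem PreSingle.raise (h : PreSingle P J t e r s) (hJ : EDFCondition J) {x : ℝ} (hx : t < x)
    (hW : x - t < dueWork J r t x) : UrgentPhase P J t e r (s.raised t) := by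
  rw [dueWork_eq h.base.nonneg] at hW
  have h1 := (h.slack x).resolve_right fun hs => absurd (slack_fits hJ hx hs) (not_le.2 hW)
  have hexec : ∀ j, 0 ≤ (J j).exec := fun j => (J j).exec_pos.le
  -- Otherwise, by `early`, all jobs of the period due by `x` arrived from `t1` on, and their total
  -- is at most `x - t1`. But `M₁` has already done `t - t1` of this work, and more than `x - t` is
  -- left.
  have h2 : s.t1 + P.breakEven ≤ x := by
    by_contra hc
    have h3 := hJ.total_le (h.t1_le.trans_lt hx)
    have h4 : total (fun j => (e < (J j).arrival ∧ (J j).arrival ≤ t) ∧ (J j).deadline ≤ x)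
        (fun j => (J j).exec) ≤
        total (fun j => s.t1 ≤ (J j).arrival ∧ (J j).deadline ≤ x) (fun j => (J j).exec) := by
      refine total_mono hexec fun j hj => ⟨?_, hj.2⟩
      by_contra hj1
      exact hc ((h.early j hj.1.1 (not_le.1 hj1)).trans hj.2)
    linarith
  refine ⟨⟨h.base, by simpa [SysState.raised] using h.on0, by simp [SysState.raised], rfl,
    h.e_lt, h.t1_le, le_rfl, h.trig, ?_, ?_, h.fits, fun y => ⟨t, le_rfl, le_rfl, ?_⟩⟩, ?_⟩
  · have h3 : total (fun j => (e < (J j).arrival ∧ (J j).arrival ≤ t) ∧ (J j).deadline ≤ x)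
        (fun j => (J j).exec) ≤
        total (fun j => e < (J j).arrival ∧ (J j).arrival ≤ t) (fun j => (J j).exec) :=
      total_mono hexec fun j hj => hj.1
    simp only [SysState.raised]
    linarith
  · have h3 : total (fun j => (e < (J j).arrival ∧ (J j).arrival ≤ t) ∧ (J j).deadline ≤ x)
        (fun j => (J j).exec) -
        total (fun j => (J j).arrival ≤ t ∧ (J j).deadline ≤ x) r ≤
        total (fun j => e < (J j).arrival ∧ (J j).arrival < t) (fun j => (J j).exec - r j) := by
      unfold total
      rw [← Finset.sum_sub_distrib]
      refine Finset.sum_le_sum fun j _ => ?_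
      have := h.base.le_exec j
      rcases le_or_gt (J j).arrival e with h4 | h4
      · simp [not_lt.2 h4, h.base.past j h4]
      · rcases lt_trichotomy (J j).arrival t with h5 | h5 | h5
        · by_cases h6 : (J j).deadline ≤ x <;> simp [h4, h5, h5.le, h6, this]
        · by_cases h6 : (J j).deadline ≤ x <;> simp [h4, h5.le, h5.not_lt, h6, h.base.future j h5.ge]
        · simp [not_le.2 h5, not_lt.2 h5.le]
    simp only [SysState.raised]
    linarith
  · simp only [SysState.raised, sub_self, add_zero]
    refine total_le_total fun j => ?_
    split_ifs
    · exact h.base.le_exec j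
    · exact le_rfl
  -- Without an older open job the backlog would consist of arrivals at time `t` only, and these fit
  -- by `EDFCondition`.
  · by_contra hc
    have h3 := hJ.total_le hx
    have h4 : total (fun j => (J j).arrival ≤ t ∧ (J j).deadline ≤ x) r ≤
        total (fun j => t ≤ (J j).arrival ∧ (J j).deadline ≤ x) (fun j => (J j).exec) := by
      refine total_le_total fun j => ?_
      have h6 := (J j).exec_pos
      rcases lt_or_ge (J j).arrival t with h5 | h5
      · have : r j = 0 := le_antisymm (not_lt.1 fun hr => hc ⟨j, ⟨h5.le, hr⟩, h5⟩)
          (h.base.nonneg j)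
        simp [this, not_le.2 h5]
      · by_cases h7 : (J j).deadline ≤ x
        · by_cases h8 : (J j).arrival ≤ t
          · simp [h5, h7, h8, h.base.le_exec j]
          · simp [h5, h7, h8, h6.le]
        · simp [h7]
    linarith

/-- The rules after the wake-up rule are treated separately because they also act in the very
instant of a wake-up. -/
theorem PreSingle.rest (h : PreSingle P J t e r s) (hJ : EDFCondition J) (s' : SysState)
    (hs' : s' = ((s.raiseUrgency (dueWork J r t) t).clearUrgency J (openJobs J r t)).shutDown P
      (openJobs J r t) t) :
    (s' = s ∧ SinglePhase P J t e r s) ∨ (s' = s.raised t ∧ UrgentPhase P J t e r (s.raised t)) ∨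
    (s' = { s with on := fun _ => false } ∧ openJobs J r t = ∅ ∧ s.t1 + P.breakEven ≤ t ∧
      OffPhase P J t t r s') := by
  by_cases hW : ∃ x, t < x ∧ x - t < dueWork J r t x
  · right; left
    obtain ⟨x, hx, hWx⟩ := hW
    have h1 := h.raise hJ hx hWx
    have h2 : s.raiseUrgency (dueWork J r t) t = s.raised t := by
      rw [SysState.raiseUrgency, if_pos ⟨h.calm, x, hx, hWx⟩]
      simp [h.on0, SysState.raised]
    obtain ⟨j, hj, hjt⟩ := h1.busy
    have h3 : (s.raised t).clearUrgency J (openJobs J r t) = s.raised t :=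
      if_neg fun hc => absurd (hc.2 j hj) (not_le.2 hjt)
    refine ⟨?_, h1⟩
    rw [hs', h2, h3, SysState.shutDown_of_awake (Or.inl ⟨j, hj⟩)]
  · push Not at hW
    rw [SysState.raiseUrgency_of_fits hW, SysState.clearUrgency_of_calm h.calm] at hs'
    by_cases ha : (openJobs J r t).Nonempty ∨ t < s.t1 + P.breakEven
    · left
      rw [SysState.shutDown_of_awake ha] at hs'
      exact ⟨hs', h, fun x hx => by simpa only [dueWork_eq h.base.nonneg] using hW x hx, ha⟩
    · right; right
      push Not at ha
      have hoff : ¬ s.IsOff := fun ho => by simpa [h.on0] using ho 0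
      rw [SysState.shutDown, if_pos ⟨h.calm, hoff, ha.1, by linarith⟩] at hs'
      refine ⟨hs', ha.1, ha.2, ?_⟩
      subst hs'
      exact h.base.shutDown ha.1 h.calm fun _ => rfl

theorem PreSingle.update (h : PreSingle P J t e r s) (hJ : EDFCondition J) (s' : SysState)
    (hs' : s' = s.update P 1 J (openJobs J r t) (dueWork J r t) t) :
    (s' = s ∧ SinglePhase P J t e r s) ∨ (s' = s.raised t ∧ UrgentPhase P J t e r (s.raised t)) ∨
    (s' = { s with on := fun _ => false } ∧ openJobs J r t = ∅ ∧ s.t1 + P.breakEven ≤ t ∧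
      OffPhase P J t t r s') := by
  rw [SysState.update, SysState.wakeUp_of_on h.on0] at hs'
  exact h.rest hJ s' hs'

theorem PreOff.wake (h : PreOff P J t e r s)
    (hw : (∃ j ∈ openJobs J r t, anchor P 1 (J j) ≤ t) ∨ ∃ x, t < x ∧ x - t ≤ dueWork J r t x) :
    (openJobs J r t).Nonempty ∧ PreSingle P J t e r (s.turnOnM1 t) := by
  have hne : (openJobs J r t).Nonempty := by
    rcases hw with ⟨j, hj, _⟩ | ⟨x, hx, hW⟩
    · exact ⟨j, hj⟩
    · rw [dueWork_eq h.base.nonneg] at hW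
      obtain ⟨j, hj, hjr⟩ := exists_of_total_pos (lt_of_lt_of_le (sub_pos.2 hx) hW)
      exact ⟨j, hj.1, hjr⟩
  have hopen : ∀ j ∈ openJobs J r t, e < (J j).arrival := fun j hj =>
    not_le.1 fun hc => hj.2.ne' (h.base.past j hc)
  have hle : ∀ x, total (fun j => (J j).arrival ≤ t ∧ (J j).deadline ≤ x) r ≤
      total (fun j => (e < (J j).arrival ∧ (J j).arrival ≤ t) ∧ (J j).deadline ≤ x)
        (fun j => (J j).exec) := by
    intro x
    refine total_le_total fun j => ?_
    rcases le_or_gt (J j).arrival e with h1 | h1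
    · simp [h.base.past j h1, not_lt.2 h1]
    · simp only [h1, true_and]
      split_ifs
      · exact h.base.le_exec j
      · exact le_rfl
  refine ⟨hne, h.base, by simp [SysState.turnOnM1], by simpa [SysState.turnOnM1] using h.off 1,
    h.calm, ?_, le_rfl, ?_, h.early, h.fits, fun x => Or.inl ?_, ?_⟩
  · obtain ⟨j, hj⟩ := hne
    exact (hopen j hj).trans_le hj.1
  · rcases hw with ⟨j, hj, ha⟩ | ⟨x, hx, hW⟩
    · refine Or.inl ⟨j, hopen j hj, hj.1, ?_⟩
      have := (le_max_right _ _).trans ha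
      simp only [SysState.turnOnM1]
      linarith
    · rw [dueWork_eq h.base.nonneg] at hW
      exact Or.inr ⟨x, hx, hW.trans (hle x)⟩
  · simpa [SysState.turnOnM1] using hle x
  · have : 0 ≤ total (fun j => e < (J j).arrival) (fun j => (J j).exec - r j) :=
      total_nonneg fun j _ => sub_nonneg.2 (h.base.le_exec j)
    simp only [SysState.turnOnM1]
    linarith [P.breakEven_nonneg]

theorem PreOff.update (h : PreOff P J t e r s) (hJ : EDFCondition J) (s' : SysState)
    (hs' : s' = s.update P 1 J (openJobs J r t) (dueWork J r t) t) :
    (s' = s ∧ OffPhase P J t e r s) ∨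
    (s' = s.turnOnM1 t ∧ SinglePhase P J t e r (s.turnOnM1 t)) ∨
    (s' = (s.turnOnM1 t).raised t ∧ UrgentPhase P J t e r ((s.turnOnM1 t).raised t)) := by
  by_cases hw : (∃ j ∈ openJobs J r t, anchor P 1 (J j) ≤ t) ∨
      ∃ x, t < x ∧ x - t ≤ dueWork J r t x
  · obtain ⟨hne, h1⟩ := h.wake hw
    rw [SysState.update, SysState.wakeUp, if_pos ⟨h.off, hw⟩] at hs'
    rcases h1.rest hJ s' hs' with h2 | h2 | h2
    · exact Or.inr (Or.inl h2)
    · exact Or.inr (Or.inr h2)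
    · exact absurd h2.2.1 hne.ne_empty
  · push Not at hw
    have h1 : OffPhase P J t e r s := ⟨h.base, h.off, h.calm, h.unstarted, hw.1,
      fun x hx => by simpa only [dueWork_eq h.base.nonneg] using hw.2 x hx⟩
    exact Or.inl ⟨hs'.trans h1.update_eq, h1⟩

theorem PreTail.rest (h : PreTail P J t e r s) (s' : SysState)
    (hs' : s' = s.shutDown P (openJobs J r t) t) :
    (s' = s ∧ TailPhase P J t e r s) ∨
    (s' = { s with on := fun _ => false } ∧ openJobs J r t = ∅ ∧ s.t1 + P.breakEven ≤ t ∧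
      OffPhase P J t t r s') := by
  by_cases ha : (openJobs J r t).Nonempty ∨ t < s.t1 + P.breakEven
  · left
    rw [SysState.shutDown_of_awake ha] at hs'
    exact ⟨hs', h, ha⟩
  · right
    push Not at ha
    have hoff : ¬ s.IsOff := fun ho => by simpa [h.on1] using ho 1
    rw [SysState.shutDown, if_pos ⟨h.calm, hoff, ha.1, by linarith⟩] at hs'
    refine ⟨hs', ha.1, ha.2, ?_⟩
    subst hs'
    exact h.base.shutDown ha.1 h.calm fun _ => rfl

theorem PreTail.update (h : PreTail P J t e r s) (hJ : EDFCondition J) (s' : SysState)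
    (hs' : s' = s.update P 1 J (openJobs J r t) (dueWork J r t) t) :
    (s' = s ∧ TailPhase P J t e r s) ∨
    (s' = { s with on := fun _ => false } ∧ openJobs J r t = ∅ ∧ s.t1 + P.breakEven ≤ t ∧
      OffPhase P J t t r s') := by
  rw [SysState.update, SysState.wakeUp_of_on h.on1,
    SysState.raiseUrgency_of_fits fun x hx => h.fits hJ hx,
    SysState.clearUrgency_of_calm h.calm] at hs'
  exact h.rest s' hs'

/-- The state after the urgency flag has been cleared. -/
def SysState.cleared (s : SysState) : SysState :=
  { s with on := Function.update s.on 0 false, urgent := false }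

/-- The on-time of `M₂` is at most the time since `t1`, all of which `M₁` has spent on jobs older
than `tStar`. -/
theorem PreUrgent.idle_le (h : PreUrgent P J t e r s) :
    (t - s.tStar) - total (fun j => s.tStar ≤ (J j).arrival) (fun j => (J j).exec - r j) ≤
    total (fun j => e < (J j).arrival ∧ (J j).arrival ≤ s.tStar) (fun j => (J j).exec) := by
  have h2 : 0 ≤ total (fun j => s.tStar ≤ (J j).arrival) (fun j => (J j).exec - r j) :=
    total_nonneg fun j _ => sub_nonneg.2 (h.base.le_exec j)
  have h3 : total (fun j => e < (J j).arrival ∧ (J j).arrival < s.tStar)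
      (fun j => (J j).exec - r j) ≤
      total (fun j => e < (J j).arrival ∧ (J j).arrival ≤ s.tStar)
      (fun j => (J j).exec) := by
    refine total_le_total fun j => ?_
    have h4 := (J j).exec_pos
    have h5 := h.base.nonneg j
    by_cases h6 : e < (J j).arrival ∧ (J j).arrival < s.tStar
    · rw [if_pos h6, if_pos ⟨h6.1, h6.2.le⟩]
      linarith
    · rw [if_neg h6]
      split_ifs
      · exact h4.le
      · exact le_rfl
  linarith [h.oldDone, h.t1_le]

theorem PreUrgent.update (h : PreUrgent P J t e r s) (s' : SysState)
    (hs' : s' = s.update P 1 J (openJobs J r t) (dueWork J r t) t) :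
    (s' = s ∧ UrgentPhase P J t e r s) ∨ (s' = s.cleared ∧ TailPhase P J t e r s.cleared) ∨
    (s' = { s.cleared with on := fun _ => false } ∧ openJobs J r t = ∅ ∧
      s.t1 + P.breakEven ≤ t ∧ OffPhase P J t t r s') := by
  by_cases hb : ∃ j ∈ openJobs J r t, (J j).arrival < s.tStar
  · have h1 : UrgentPhase P J t e r s := ⟨h, hb⟩
    exact Or.inl ⟨hs'.trans h1.update_eq, h1⟩
  · right
    push Not at hb
    have hc : s.clearUrgency J (openJobs J r t) = s.cleared := by
      rw [SysState.clearUrgency, if_pos ⟨h.flag, hb⟩, SysState.cleared]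
    rw [SysState.update, SysState.wakeUp_of_on h.on0, SysState.raiseUrgency_of_urgent h.flag,
      hc] at hs'
    have h1 : PreTail P J t e r s.cleared := by
      refine ⟨h.base, by simp [SysState.cleared], by simpa [SysState.cleared] using h.on1, rfl,
        h.e_lt, h.t1_le, h.tStar_le, h.trig, h.bulk, fun j hj => ?_, h.idle_le, h.slack⟩
      refine le_antisymm (not_lt.1 fun hr => ?_) (h.base.nonneg j)
      exact absurd (hb j ⟨hj.le.trans h.tStar_le, hr⟩) (not_le.2 hj)
    exact h1.rest s' hs'

/-- The fictitious turn-off time `-1` precedes all arrivals, so jobs arriving at time `0` belong to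
the first period. -/
theorem PreOff.initial (hJ : EDFCondition J) :
    PreOff P J 0 (-1) (fun j => (J j).exec) SysState.initial := by
  have h0 : ∀ j, ¬ (J j).arrival < 0 := fun j => not_lt.2 (J j).arrival_nonneg
  refine ⟨⟨fun j => (J j).exec_pos.le, fun _ => le_rfl, fun _ _ => rfl, fun j hj => ?_,
    fun j hj => ?_, by norm_num⟩, fun _ => rfl, rfl, fun _ _ => rfl,
    fun j _ hj => absurd hj (h0 j), fun x hx => ?_⟩
  · linarith [(J j).arrival_nonneg]
  · linarith [(J j).arrival_nonneg, hJ.arrival_lt_deadline j]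
  · simpa [h0, total] using hx

end Transitions

/-! ### Induction over continuous time. -/

section Induction

/-- The supremum of the times up to which `p` holds satisfies `p` by `left`, and `right` would move
it further. -/
theorem real_induction {p : ℝ → Prop} (h0 : p 0)
    (right : ∀ t, 0 ≤ t → p t → ∀ᶠ v in 𝓝[>] t, p v)
    (left : ∀ t, 0 < t → (∀ v ∈ Ico 0 t, p v) → p t) {t : ℝ} (ht : 0 ≤ t) : p t := by
  by_contra hc
  set A : Set ℝ := {x | 0 ≤ x ∧ x ≤ t ∧ ∀ y ∈ Icc 0 x, p y} with hA
  have hA0 : (0 : ℝ) ∈ A := ⟨le_rfl, ht, fun y hy => by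
    rwa [le_antisymm hy.2 hy.1]⟩
  have hbdd : BddAbove A := ⟨t, fun x hx => hx.2.1⟩
  have hc0 : 0 ≤ sSup A := le_csSup hbdd hA0
  have hct : sSup A ≤ t := csSup_le ⟨0, hA0⟩ fun x hx => hx.2.1
  have hlt : ∀ v ∈ Ico 0 (sSup A), p v := by
    intro v hv
    obtain ⟨x, hx, hvx⟩ := exists_lt_of_lt_csSup ⟨0, hA0⟩ hv.2
    exact hx.2.2 v ⟨hv.1, hvx.le⟩
  have hsup : p (sSup A) := by
    rcases hc0.eq_or_lt with h | h
    · rwa [← h]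
    · exact left _ h hlt
  have hne : sSup A < t := hct.lt_of_ne fun h => hc (h ▸ hsup)
  obtain ⟨b, hb, hbp⟩ := (mem_nhdsGT_iff_exists_Ioo_subset' hne).1 (right _ hc0 hsup)
  have hm : sSup A < min ((sSup A + b) / 2) t := lt_min (by linarith [mem_Ioi.1 hb]) hne
  refine absurd (le_csSup hbdd (show min ((sSup A + b) / 2) t ∈ A from
    ⟨hc0.trans hm.le, min_le_right _ _, fun y hy => ?_⟩)) (not_le.2 hm)
  rcases lt_trichotomy y (sSup A) with h | h | h
  · exact hlt y ⟨hy.1, h⟩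
  · rwa [h]
  · refine hbp ⟨h, (hy.2.trans (min_le_left _ _)).trans_lt ?_⟩
    linarith [mem_Ioi.1 hb]

variable {ι : Type*} [Fintype ι] {P : PowerModel} {J : ι → Job} {S : Schedule ι 2}
  {σ : ℝ → SysState} {lam : ℝ}

/-- The state is constant on a one-sided neighbourhood on either side of every time, and there are
finitely many arrivals; so no count of the switching times is needed. -/
theorem IsRun.induction (h : IsRun P lam J S σ) {p : ℝ → Prop} (h0 : p 0)
    (hstep : ∀ u t, 0 ≤ u → u < t → (∀ v ∈ Ico u t, σ v = σ u) →
      (∀ j, (J j).arrival ≤ u ∨ t ≤ (J j).arrival) → p u → p t) {t : ℝ} (ht : 0 ≤ t) : p t := by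
  refine real_induction h0 (fun t ht hp => ?_) (fun t ht hp => ?_) ht
  · have h1 : ∀ᶠ v in 𝓝[>] t, ∀ j, (J j).arrival ≤ t ∨ v ≤ (J j).arrival := by
      refine eventually_all.2 fun j => ?_
      rcases le_or_gt (J j).arrival t with h2 | h2
      · exact Eventually.of_forall fun _ => Or.inl h2
      · filter_upwards [Ioo_mem_nhdsGT h2] with v hv using Or.inr hv.2.le
    obtain ⟨b, hb, hbp⟩ := mem_nhdsGT_iff_exists_Ioo_subset.1 ((h.right t ht).and h1)
    filter_upwards [Ioo_mem_nhdsGT hb] with v hv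
    refine hstep t v ht hv.1 (fun w hw => ?_) (hbp hv).2 hp
    rcases hw.1.eq_or_lt with h3 | h3
    · rw [h3]
    · exact (hbp ⟨h3, hw.2.trans hv.2⟩).1
  · obtain ⟨s, hs, -⟩ := h.step t ht
    have h1 : ∀ᶠ v in 𝓝[<] t, ∀ j, (J j).arrival ≤ v ∨ t ≤ (J j).arrival := by
      refine eventually_all.2 fun j => ?_
      rcases le_or_gt t (J j).arrival with h2 | h2
      · exact Eventually.of_forall fun _ => Or.inr h2
      · filter_upwards [Ioo_mem_nhdsLT h2] with v hv using Or.inl hv.1.le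
    obtain ⟨b, hb, hbp⟩ := (mem_nhdsLT_iff_exists_Ioo_subset' ht).1
      ((hs.and h1).and (Ioo_mem_nhdsLT ht))
    have hm : (b + t) / 2 ∈ Ioo b t := ⟨by linarith [mem_Iio.1 hb], by linarith [mem_Iio.1 hb]⟩
    have h2 := hbp hm
    refine hstep _ t h2.2.1.le hm.2 (fun v hv => ?_) h2.1.2 (hp _ ⟨h2.2.1.le, hm.2⟩)
    rw [h2.1.1]
    exact (hbp ⟨hm.1.trans_le hv.1, hv.2⟩).1.1

theorem IsRun.update_left (h : IsRun P lam J S σ) {u t : ℝ} (hu : 0 ≤ u) (hut : u < t)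
    (hc : ∀ v ∈ Ico u t, σ v = σ u) :
    σ t = (σ u).update P lam J (S.queue J t) (S.workload J t) t := by
  obtain ⟨s, hs, hst⟩ := h.step t (hu.trans_lt hut)
  obtain ⟨v, hv1, hv2⟩ := (hs.and (Ioo_mem_nhdsLT hut)).exists
  rw [hst, ← hv1, hc v ⟨hv2.1.le, hv2.2⟩]

end Induction

/-! ### Remaining work along an arbitrary run. -/

section Execution

variable {ι : Type*} {k : ℕ}

/-- The time during which processor `m` is occupied by job `j`. -/
def Schedule.slot (S : Schedule ι k) (m : Fin k) (j : ι) : Set ℝ := {v | S.job m v = some j}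

theorem Schedule.measurableSet_slot (S : Schedule ι k) (m : Fin k) (j : ι) :
    MeasurableSet (S.slot m j) := S.job_measurable m (some j)

theorem Schedule.sum_on_volume (S : Schedule ι k) (m : Fin k) {E : Set ℝ} (hE : MeasurableSet E) :
    ∑ I ∈ S.on m, volume.real (Ico I.1 I.2 ∩ E) =
      volume.real ((⋃ I ∈ S.on m, Ico I.1 I.2) ∩ E) := by
  rw [iUnion₂_inter, measureReal_biUnion_finset (h := fun I _ =>
    ((measure_mono inter_subset_left).trans_lt measure_Ico_lt_top).ne)]
  · intro I hI I' hI' hne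
    refine Set.disjoint_left.2 fun v hv hv' => ?_
    rcases S.on_separated m I hI I' hI' hne with h | h
    · linarith [hv.1.2, hv'.1.1]
    · linarith [hv.1.1, hv'.1.2]
  · exact fun I _ => measurableSet_Ico.inter hE

theorem Schedule.executed_eq (S : Schedule ι k) (m : Fin k) (j : ι) (A : Set ℝ) :
    S.executed m j A = ∑ I ∈ S.on m, volume.real (Ico I.1 I.2 ∩ (A ∩ S.slot m j)) := by
  refine Finset.sum_congr rfl fun I _ => ?_
  rw [setIntegral_indicator (S.job_measurable m (some j)), setIntegral_const, smul_eq_mul,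
    mul_one, inter_assoc]
  rfl

theorem Schedule.executed_eq_of_subset (S : Schedule ι k) (m : Fin k) (j : ι) {A : Set ℝ}
    (hA : MeasurableSet A) (h : ∀ v ∈ A, S.job m v = some j → ∃ I ∈ S.on m, v ∈ Ico I.1 I.2) :
    S.executed m j A = volume.real (A ∩ S.slot m j) := by
  rw [S.executed_eq m j A, S.sum_on_volume m (hA.inter (S.measurableSet_slot m j)),
    inter_eq_right.2]
  intro v hv
  obtain ⟨I, hI, hvI⟩ := h v hv.1 hv.2
  exact mem_biUnion hI hvI

variable {P : PowerModel} {J : ι → Job} {S : Schedule ι 2} {σ : ℝ → SysState} {lam : ℝ}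

theorem volume_real_Icc_sub {E : Set ℝ} (hE : MeasurableSet E) {u t : ℝ} (hu : 0 ≤ u)
    (hut : u ≤ t) : volume.real (Icc 0 t ∩ E) - volume.real (Icc 0 u ∩ E) =
      volume.real (Ioo u t ∩ E) := by
  have h1 : volume.real (Ioo u t ∩ E) = volume.real (Ioc u t ∩ E) :=
    measureReal_congr ((ae_eq_set_inter Ioo_ae_eq_Ioc (ae_eq_refl _)))
  have h2 : Icc 0 t ∩ E = (Icc 0 u ∩ E) ∪ (Ioc u t ∩ E) := by
    rw [← union_inter_distrib_right, Icc_union_Ioc_eq_Icc hu hut]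
  rw [h1, h2, measureReal_union (h₁ := ((measure_mono inter_subset_left).trans_lt
    measure_Icc_lt_top).ne) (h₂ := ((measure_mono inter_subset_left).trans_lt
    measure_Ioc_lt_top).ne)]
  · ring
  · exact Set.disjoint_left.2 fun v hv hv' => absurd hv.1.2 (not_le.2 hv'.1.1)
  · exact measurableSet_Ioc.inter hE

variable [Fintype ι]

theorem IsRun.mem_eligible (h : IsRun P lam J S σ) {v : ℝ} (hv : 0 ≤ v) {m : Fin 2} {j : ι}
    (hj : v ∈ S.slot m j) : j ∈ (σ v).eligible J (S.queue J v) m := by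
  have h1 := h.edf v hv m
  rw [show S.job m v = some j from hj] at h1
  exact h1.1

theorem IsRun.executed_Icc (h : IsRun P lam J S σ) (m : Fin 2) (j : ι) (t : ℝ) :
    S.executed m j (Icc 0 t) = volume.real (Icc 0 t ∩ S.slot m j) :=
  S.executed_eq_of_subset m j measurableSet_Icc fun v hv hj =>
    (h.on_iff v hv.1 m).1 (h.mem_eligible hv.1 hj).2.1

theorem IsRun.executed_sub (h : IsRun P lam J S σ) (m : Fin 2) (j : ι) {u t : ℝ} (hu : 0 ≤ u)
    (hut : u ≤ t) : S.executed m j (Icc 0 t) - S.executed m j (Icc 0 u) =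
      volume.real (Ioo u t ∩ S.slot m j) := by
  rw [h.executed_Icc, h.executed_Icc, volume_real_Icc_sub (S.measurableSet_slot m j) hu hut]

theorem IsRun.remaining_sub (h : IsRun P lam J S σ) (j : ι) {u t : ℝ} (hu : 0 ≤ u)
    (hut : u ≤ t) : S.remaining J j u - S.remaining J j t =
      ∑ m, volume.real (Ioo u t ∩ S.slot m j) := by
  simp only [← fun m => h.executed_sub m j hu hut, Finset.sum_sub_distrib, Schedule.remaining]
  ring

theorem IsRun.remaining_anti (h : IsRun P lam J S σ) (j : ι) {u t : ℝ} (hu : 0 ≤ u)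
    (hut : u ≤ t) : S.remaining J j t ≤ S.remaining J j u := by
  have h1 := h.remaining_sub j hu hut
  have h2 : 0 ≤ ∑ m, volume.real (Ioo u t ∩ S.slot m j) :=
    Finset.sum_nonneg fun m _ => measureReal_nonneg
  linarith

theorem IsRun.remaining_zero (h : IsRun P lam J S σ) (j : ι) :
    S.remaining J j 0 = (J j).exec := by
  have h1 : ∀ m, S.executed m j (Icc 0 0) = 0 := by
    intro m
    rw [h.executed_Icc, Icc_self, measureReal_def,
      measure_mono_null inter_subset_left (measure_singleton (0 : ℝ))]
    rfl
  rw [Schedule.remaining, Finset.sum_eq_zero fun m _ => h1 m, sub_zero]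

/-- The remaining time is continuous (Lipschitz with constant `2`, for two processors), so it would
vanish before becoming negative. From then on the job is not in the queue and is not executed. -/
theorem IsRun.remaining_nonneg (h : IsRun P lam J S σ) (j : ι) {t : ℝ} (ht : 0 ≤ t) :
    0 ≤ S.remaining J j t := by
  by_contra hc
  push Not at hc
  have hlip : ∀ u ∈ Icc (0 : ℝ) t, ∀ v ∈ Icc (0 : ℝ) t, u ≤ v →
      dist (S.remaining J j u) (S.remaining J j v) ≤ 2 * dist u v := by
    intro u hu v _ huv
    have h1 := h.remaining_sub j hu.1 huv
    have h2 : ∀ m, volume.real (Ioo u v ∩ S.slot m j) ≤ v - u := fun m => by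
      refine (measureReal_mono inter_subset_left measure_Ioo_lt_top.ne).trans ?_
      rw [Real.volume_real_Ioo_of_le huv]
    rw [Fin.sum_univ_two] at h1
    rw [Real.dist_eq, Real.dist_eq, abs_of_nonneg (by linarith [h.remaining_anti j hu.1 huv]),
      abs_of_nonpos (by linarith), h1]
    linarith [h2 0, h2 1]
  have hcont : ContinuousOn (fun v => S.remaining J j v) (Icc 0 t) := by
    refine (LipschitzOnWith.of_dist_le_mul (K := 2) fun u hu v hv => ?_).continuousOn
    rcases le_total u v with huv | huv
    · exact hlip u hu v hv huv
    · rw [dist_comm, dist_comm u]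
      exact hlip v hv u hu huv
  obtain ⟨w, hw, hw0⟩ := intermediate_value_Icc' ht hcont
    ⟨hc.le, by rw [h.remaining_zero]; exact (J j).exec_pos.le⟩
  have h1 := h.remaining_sub j hw.1 hw.2
  have h2 : ∀ m, Ioo w t ∩ S.slot m j = ∅ := by
    intro m
    refine eq_empty_of_forall_notMem fun v hv => ?_
    have h3 := (h.mem_eligible (hw.1.trans hv.1.1.le) hv.2).1.2
    have h4 := h.remaining_anti j hw.1 hv.1.1.le
    simp only at hw0
    linarith
  simp only [h2, measureReal_empty, Finset.sum_const_zero] at h1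
  simp only at hw0
  linarith

theorem IsRun.not_slot (h : IsRun P lam J S σ) {s : SysState} {u t : ℝ} (hu : 0 ≤ u)
    (hc : ∀ v ∈ Ioo u t, σ v = s) {m : Fin 2} {j : ι}
    (hj : s.on m = true → responsible J s m j → t ≤ (J j).arrival) :
    volume.real (Ioo u t ∩ S.slot m j) = 0 := by
  have : Ioo u t ∩ S.slot m j = ∅ := by
    refine eq_empty_of_forall_notMem fun v hv => ?_
    have h1 := h.mem_eligible (hu.trans hv.1.1.le) hv.2
    rw [hc v hv.1] at h1
    have h2 : (J j).arrival ≤ v := h1.1.1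
    exact absurd (hj h1.2.1 h1.2.2) (not_le.2 (h2.trans_lt hv.1.2))
  rw [this, measureReal_empty]

/-- EDF executes a job due by `x` whenever one is available. If such work is left at `t`, it has
decreased at unit speed throughout; if none is left, there was at most `t - u` of it. -/
theorem IsRun.drain (h : IsRun P lam J S σ) {s : SysState} {u t : ℝ} (hu : 0 ≤ u) (hut : u < t)
    (hc : ∀ v ∈ Ioo u t, σ v = s) (hq : ∀ j, (J j).arrival ≤ u ∨ t ≤ (J j).arrival)
    (hs : s.urgent = false → s.on 0 = false ∨ s.on 1 = false) {m : Fin 2} (hm : s.on m = true)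
    (x : ℝ) :
    total (fun j => ((J j).arrival ≤ u ∧ responsible J s m j) ∧ (J j).deadline ≤ x)
      (fun j => S.remaining J j t) =
    max 0 (total (fun j => ((J j).arrival ≤ u ∧ responsible J s m j) ∧ (J j).deadline ≤ x)
      (fun j => S.remaining J j u) - (t - u)) := by
  classical
  set A : ι → Prop := fun j => ((J j).arrival ≤ u ∧ responsible J s m j) ∧ (J j).deadline ≤ x
  have ht : 0 ≤ t := hu.trans hut.le
  have hdiff : total A (fun j => S.remaining J j u) - total A (fun j => S.remaining J j t) =
      volume.real (Ioo u t ∩ ⋃ j ∈ Finset.univ.filter A, S.slot m j) := by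
    rw [← total_sub, inter_iUnion₂, measureReal_biUnion_finset (h := fun j _ =>
      ((measure_mono inter_subset_left).trans_lt measure_Ioo_lt_top).ne)]
    · rw [Finset.sum_filter]
      refine Finset.sum_congr rfl fun j _ => ?_
      split_ifs with hA
      · refine (h.remaining_sub j hu hut.le).trans ?_
        refine Finset.sum_eq_single m (fun m' _ hne => ?_) (by simp)
        refine h.not_slot hu hc fun hm' hr' => ?_
        exact absurd ⟨hm', hr'⟩ (responsible_disjoint hs hne.symm ⟨hm, hA.1.2⟩)
      · rfl
    · intro i _ j _ hne
      refine Set.disjoint_left.2 fun v hv hv' => hne ?_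
      exact Option.some.inj (hv.2.symm.trans hv'.2)
    · exact fun j _ => measurableSet_Ioo.inter (S.measurableSet_slot m j)
  have hnn : 0 ≤ total A (fun j => S.remaining J j t) :=
    total_nonneg fun j _ => h.remaining_nonneg j ht
  rcases hnn.eq_or_lt with h0 | h0
  · have h1 : volume.real (Ioo u t ∩ ⋃ j ∈ Finset.univ.filter A, S.slot m j) ≤ t - u := by
      refine (measureReal_mono inter_subset_left measure_Ioo_lt_top.ne).trans ?_
      rw [Real.volume_real_Ioo_of_le hut.le]
    rw [← h0, max_eq_left]
    linarith
  · obtain ⟨j, hA, hj⟩ := exists_of_total_pos h0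
    have h1 : Ioo u t ∩ ⋃ j ∈ Finset.univ.filter A, S.slot m j = Ioo u t := by
      refine inter_eq_left.2 fun v hv => ?_
      have hv0 : 0 ≤ v := hu.trans hv.1.le
      have hel : j ∈ (σ v).eligible J (S.queue J v) m := by
        rw [hc v hv]
        exact ⟨⟨hA.1.1.trans hv.1.le, hj.trans_le (h.remaining_anti j hv0 hv.2.le)⟩, hm, hA.1.2⟩
      have he := h.edf v hv0 m
      cases hjob : S.job m v with
      | none =>
        rw [hjob] at he
        exact absurd hel (by rw [show _ = ∅ from he]; simp)
      | some i =>
        have hi := h.mem_eligible hv0 hjob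
        rw [hjob] at he
        rw [hc v hv] at hi
        have h2 : (J i).arrival ≤ v := hi.1.1
        refine mem_biUnion (x := i) ?_ hjob
        simp only [Finset.coe_filter, Finset.mem_univ, true_and, mem_ofPred_eq]
        exact ⟨⟨(hq i).resolve_right (not_le.2 (h2.trans_lt hv.2)), hi.2.2⟩,
          (he.2 j hel).trans hA.2⟩
    rw [h1, Real.volume_real_Ioo_of_le hut.le] at hdiff
    rw [max_eq_right] <;> linarith

theorem IsRun.workload_eq (h : IsRun P lam J S σ) {t : ℝ} (ht : 0 ≤ t) (x : ℝ) :
    S.workload J t x = total (fun j => (J j).arrival ≤ t ∧ (J j).deadline ≤ x)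
      (fun j => S.remaining J j t) :=
  dueWork_eq (fun j => h.remaining_nonneg j ht) t x

/-- The rules act at every inner time and leave the state unchanged. Each `stay` fact holds because
its failure would make some rule change the state at a suitable inner time. -/
theorem IsRun.segment (h : IsRun P 1 J S σ) {u t : ℝ} (hu : 0 ≤ u) (hut : u < t)
    (hc : ∀ v ∈ Ico u t, σ v = σ u) (hq : ∀ j, (J j).arrival ≤ u ∨ t ≤ (J j).arrival)
    (hs : (σ u).urgent = false → (σ u).on 0 = false ∨ (σ u).on 1 = false)
    (hs' : (σ u).urgent = true → (σ u).on 0 = true) :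
    Segment P J (σ u) u (fun j => S.remaining J j u) t (fun j => S.remaining J j t) := by
  have hc' : ∀ v ∈ Ioo u t, σ v = σ u := fun v hv => hc v ⟨hv.1.le, hv.2⟩
  have hupd : ∀ v ∈ Ioo u t,
      σ u = (σ u).update P 1 J (S.queue J v) (S.workload J v) v := fun v hv => by
    rw [← h.update_left hu hv.1 fun w hw => hc w ⟨hw.1, hw.2.trans hv.2⟩, hc' v hv]
  have harr : ∀ v ∈ Ioo u t, ∀ j, (J j).arrival ≤ v ↔ (J j).arrival ≤ u := fun v hv j =>
    ⟨fun hj => (hq j).resolve_right (not_le.2 (hj.trans_lt hv.2)), fun hj => hj.trans hv.1.le⟩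
  have hsame : ∀ {v}, v ≤ t → u ≤ v → ∀ j, (∀ m, (σ u).on m = true → responsible J (σ u) m j →
      v ≤ (J j).arrival) → S.remaining J j v = S.remaining J j u := by
    intro v hvt huv j hj
    have h1 := h.remaining_sub j hu huv
    rw [Finset.sum_eq_zero fun m _ => h.not_slot hu
      (fun w hw => hc' w ⟨hw.1, hw.2.trans_le hvt⟩) (hj m)] at h1
    linarith
  have hdr : ∀ {v}, u < v → v ≤ t → ∀ {m}, (σ u).on m = true → ∀ x, _ := fun huv hvt m hm =>
    h.drain hu huv (fun w hw => hc' w ⟨hw.1, hw.2.trans_le hvt⟩)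
      (fun j => (hq j).imp_right hvt.trans) hs (m := m) hm
  refine ⟨hut, hq, fun j => h.remaining_nonneg j (hu.trans hut.le),
    fun j => h.remaining_anti j hu hut.le,
    fun j hj => hsame le_rfl hut.le j fun _ _ _ => hj,
    fun ho => funext fun j => hsame le_rfl hut.le j fun m hm _ => by simp [ho m] at hm,
    fun m hm => hdr hut le_rfl hm, fun ho => ?_, fun hcalm ho htot => ?_, fun hur => ?_⟩
  · have hcalm : (σ u).urgent = false := by
      cases hur : (σ u).urgent
      · rfl
      · simpa [ho 0] using hs' hur
    have hno : ∀ v ∈ Ioo u t, ¬ ((∃ j ∈ S.queue J v, anchor P 1 (J j) ≤ v) ∨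
        ∃ x, v < x ∧ x - v ≤ S.workload J v x) := by
      intro v hv hw
      have hne : S.queue J v ≠ ∅ := by
        refine Set.Nonempty.ne_empty ?_
        rcases hw with ⟨j, hj, _⟩ | ⟨x, hx, hW⟩
        · exact ⟨j, hj⟩
        · rw [h.workload_eq (hu.trans hv.1.le)] at hW
          obtain ⟨j, hj, hjr⟩ := exists_of_total_pos (lt_of_lt_of_le (sub_pos.2 hx) hW)
          exact ⟨j, hj.1, hjr⟩
      have h1 := hupd v hv
      have h2 : ∀ s' : SysState, s'.shutDown P (S.queue J v) v = s' := fun s' =>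
        if_neg fun hc => hne hc.2.2.1
      rw [SysState.update, h2, SysState.wakeUp, if_pos ⟨ho, hw⟩] at h1
      -- A wake-up at `v` cannot be undone at `v`: the nonempty queue prevents a shut-down, and
      -- clearing a flag just raised would still leave `M₂` on.
      by_cases hr : ∃ x, v < x ∧ x - v < S.workload J v x
      · have h3 := congrArg (fun s => s.on 1) h1
        simp only [ho 1] at h3
        rw [SysState.raiseUrgency, if_pos ⟨hcalm, hr⟩] at h3
        unfold SysState.clearUrgency at h3
        split_ifs at h3 <;> simp at h3
      · rw [SysState.raiseUrgency, if_neg fun hc => hr hc.2,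
          SysState.clearUrgency_of_calm (s := (σ u).turnOnM1 v) hcalm] at h1
        have h3 := congrArg (fun s => s.on 0) h1
        simp [ho 0, SysState.turnOnM1] at h3
    have hfix : ∀ v ∈ Ioo u t, ∀ j, S.remaining J j v = S.remaining J j u := fun v hv j =>
      hsame hv.2.le hv.1.le j fun m hm _ => by simp [ho m] at hm
    refine ⟨fun j hj hr => ?_, fun x hx => ?_⟩
    · refine le_of_forall_gt_imp_ge_of_dense fun b hb => ?_
      by_contra hbt
      push Not at hbt
      have hv : max b ((u + t) / 2) ∈ Ioo u t :=
        ⟨lt_max_of_lt_right (by linarith), max_lt hbt (by linarith)⟩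
      refine hno _ hv (Or.inl ⟨j, ⟨(harr _ hv j).2 hj, ?_⟩, hb.le.trans (le_max_left _ _)⟩)
      rwa [hfix _ hv]
    · by_contra hlt
      push Not at hlt
      set W := total (fun j => (J j).arrival ≤ u ∧ (J j).deadline ≤ x)
        (fun j => S.remaining J j u)
      have hv : max (x - W) ((u + t) / 2) ∈ Ioo u t :=
        ⟨lt_max_of_lt_right (by linarith), max_lt (by linarith) (by linarith)⟩
      refine hno _ hv (Or.inr ⟨x, hv.2.trans_le hx, ?_⟩)
      rw [h.workload_eq (hu.trans hv.1.le)]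
      simp only [harr _ hv, hfix _ hv]
      linarith [le_max_left (x - W) ((u + t) / 2)]
  · by_contra hlt
    push Not at hlt
    obtain ⟨m, hm⟩ : ∃ m, (σ u).on m = true := by
      by_contra hno
      push Not at hno
      exact ho fun m => by simpa using hno m
    set R := total (fun j => (J j).arrival ≤ u) (fun j => S.remaining J j u)
    -- At `v` all work is done and the break-even time has passed, so the system would be shut down.
    obtain ⟨v, hv1, hv2⟩ := exists_between (max_lt (max_lt hut hlt) (show u + R < t by linarith))
    have hv : v ∈ Ioo u t := ⟨(le_max_left _ _).trans_lt ((le_max_left _ _).trans_lt hv1), hv2⟩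
    have hvB : (σ u).t1 + P.breakEven < v :=
      (le_max_right _ _).trans_lt ((le_max_left _ _).trans_lt hv1)
    have hvR : u + R < v := (le_max_right _ _).trans_lt hv1
    have hempty : S.queue J v = ∅ := by
      refine eq_empty_of_forall_notMem fun j hj => ?_
      have hj1 : (J j).arrival ≤ u := (harr v hv j).1 hj.1
      obtain ⟨X, hX1, hX2⟩ := exists_total_eq J (fun j => (J j).arrival ≤ u)
        (fun j => S.remaining J j u) (fun j => S.remaining J j v)
      have h1 := hdr hv.1 hv.2.le hm X
      simp only [fun j => iff_true_intro (responsible_of_calm hcalm m j : responsible J (σ u) m j),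
        and_true] at h1
      rw [hX1, hX2, max_eq_left (by linarith)] at h1
      have h2 := single_le_total (fun j => h.remaining_nonneg j (hu.trans hv.1.le))
        (A := fun j => (J j).arrival ≤ u) hj1
      exact absurd hj.2 (not_lt.2 (h2.trans h1.le))
    have h1 := hupd v hv
    rw [SysState.update, SysState.wakeUp_of_on hm, SysState.raiseUrgency_of_fits,
      SysState.clearUrgency_of_calm hcalm, SysState.shutDown,
      if_pos ⟨hcalm, ho, hempty, by linarith⟩] at h1
    · have := congrArg (fun s => s.on m) h1
      simp [hm] at this
    · intro x hx
      rw [h.workload_eq (hu.trans hv.1.le), total_eq_zero]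
      · linarith
      · intro j hj
        refine le_antisymm (not_lt.1 fun hr => ?_) (h.remaining_nonneg j (hu.trans hv.1.le))
        simpa [hempty] using (show j ∈ S.queue J v from ⟨hj.1, hr⟩)
  · by_contra hlt
    push Not at hlt
    set R := total (fun j => (J j).arrival ≤ u ∧ (J j).arrival < (σ u).tStar)
      (fun j => S.remaining J j u)
    have hr0 : ∀ j, responsible J (σ u) 0 j ↔ (J j).arrival < (σ u).tStar := fun j => by
      simp [responsible, hur]
    obtain ⟨v, hv1, hv2⟩ := exists_between (max_lt hut (show u + R < t by linarith))
    have hv : v ∈ Ioo u t := ⟨(le_max_left _ _).trans_lt hv1, hv2⟩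
    have hvR : u + R < v := (le_max_right _ _).trans_lt hv1
    have hclear : ∀ j ∈ S.queue J v, (σ u).tStar ≤ (J j).arrival := by
      intro j hj
      by_contra hjt
      push Not at hjt
      have hj1 : (J j).arrival ≤ u := (harr v hv j).1 hj.1
      obtain ⟨X, hX1, hX2⟩ := exists_total_eq J
        (fun j => (J j).arrival ≤ u ∧ (J j).arrival < (σ u).tStar)
        (fun j => S.remaining J j u) (fun j => S.remaining J j v)
      have h1 := hdr hv.1 hv.2.le (hs' hur) X
      simp only [hr0] at h1
      rw [hX1, hX2, max_eq_left (by linarith)] at h1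
      have h2 := single_le_total (fun j => h.remaining_nonneg j (hu.trans hv.1.le))
        (A := fun j => (J j).arrival ≤ u ∧ (J j).arrival < (σ u).tStar) ⟨hj1, hjt⟩
      exact absurd hj.2 (not_lt.2 (h2.trans h1.le))
    have h1 := hupd v hv
    rw [SysState.update, SysState.wakeUp_of_on (hs' hur), SysState.raiseUrgency_of_urgent hur,
      SysState.clearUrgency, if_pos ⟨hur, hclear⟩] at h1
    have h2 := congrArg SysState.urgent h1
    unfold SysState.shutDown at h2
    split_ifs at h2 <;> simp [hur] at h2

end Execution

/-! ### Amortised accounting of turn-ons and standby time. -/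

section Record

variable {ι : Type*} [Fintype ι]

/-- `n` complete periods, each consisting of an off-time from `p` to `w` and an on-time from `w`
to `q`, the last of which ends at the given time. -/
inductive Windows (P : PowerModel) (J : ι → Job) : ℕ → ℝ → Prop
  | zero : Windows P J 0 (-1)
  | succ {n : ℕ} {p w q : ℝ} : Windows P J n p → p < w → w + P.breakEven ≤ q →
      Trigger P J p w → Windows P J (n + 1) q

/-- The state of the system at time `t`, after the rules have been applied. -/
def Phase (P : PowerModel) (J : ι → Job) (t e : ℝ) (r : ι → ℝ) (s : SysState) : Prop :=
  OffPhase P J t e r s ∨ SinglePhase P J t e r s ∨ UrgentPhase P J t e r s ∨ TailPhase P J t e r s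

/-- Before the rules are applied at time `t`. -/
def PrePhase (P : PowerModel) (J : ι → Job) (t e : ℝ) (r : ι → ℝ) (s : SysState) : Prop :=
  PreOff P J t e r s ∨ PreSingle P J t e r s ∨ PreUrgent P J t e r s ∨ PreTail P J t e r s

open Classical in
/-- A bound for the energy that is not accounted for by two turn-ons per period. -/
def ledger (P : PowerModel) (J : ι → Job) (t e : ℝ) (r : ι → ℝ) (s : SysState) : ℝ :=
  -- Past periods are charged to their jobs. The current period adds the standby time of `M₂`, or,
  -- while `M₁` is alone, the standby time of `M₁` minus the `B` that its single turn-on leaves of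
  -- the allowance `2B`.
  total (fun j => (J j).arrival ≤ e) (fun j => (J j).exec) +
    if s.on 1 = true then
      (t - s.tStar) - total (fun j => s.tStar ≤ (J j).arrival) (fun j => (J j).exec - r j)
    else if s.on 0 = true then
      (t - s.t1) - total (fun j => e < (J j).arrival) (fun j => (J j).exec - r j) - P.breakEven
    else 0

/-- Bookkeeping of the history: `n m` is the number of turn-ons of processor `m`, `o` the total time
that the processors have been on, and `x m j` the time for which `m` has executed `j`. -/
structure Record (P : PowerModel) (J : ι → Job) (t e : ℝ) (r : ι → ℝ) (s : SysState)
    (n : Fin 2 → ℕ) (o : ℝ) (x : Fin 2 → ι → ℝ) : Prop where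
  -- On-time minus work done is the standby time of both processors, so the left side is the
  -- normalised cost of turn-ons and standby.
  cost : P.breakEven * (n 0 + n 1) + o - total (fun _ => True) (fun j => (J j).exec - r j) ≤
    2 * P.breakEven * n 0 + ledger P J t e r s
  windows : ∃ k, Windows P J k e ∧
    ((s.IsOff ∧ n 0 = k) ∨ (¬ s.IsOff ∧ n 0 = k + 1 ∧ e < s.t1 ∧ s.t1 ≤ t ∧ Trigger P J e s.t1))
  sole : ∀ j, x 0 j = 0 ∨ x 1 j = 0
  early : s.on 1 = true → ∀ j, e < (J j).arrival → (J j).arrival < s.tStar → x 1 j = 0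
  late : s.on 1 = true → ∀ j, s.tStar ≤ (J j).arrival → x 0 j = 0
  single : s.on 1 = false → ∀ j, e < (J j).arrival → x 1 j = 0

variable {P : PowerModel} {J : ι → Job} {s s' : SysState} {t u e : ℝ}
  {r r' : ι → ℝ} {n n' : Fin 2 → ℕ} {o o' : ℝ} {x x' : Fin 2 → ι → ℝ}

theorem total_exec_split (hu : e ≤ u) :
    total (fun j => (J j).arrival ≤ u) (fun j => (J j).exec) =
    total (fun j => (J j).arrival ≤ e) (fun j => (J j).exec) +
    total (fun j => e < (J j).arrival ∧ (J j).arrival ≤ u) (fun j => (J j).exec) := by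
  refine total_split _ (fun j => ⟨fun hj => ?_, fun hj => ?_⟩) fun j hj hj' =>
    absurd hj (not_le.2 hj'.1)
  · rcases le_or_gt (J j).arrival e with h | h
    · exact Or.inl h
    · exact Or.inr ⟨h, hj⟩
  · exact hj.elim (fun h => h.trans hu) fun h => h.2

theorem total_exec_mono (hu : e ≤ u) :
    total (fun j => (J j).arrival ≤ e) (fun j => (J j).exec) ≤
    total (fun j => (J j).arrival ≤ u) (fun j => (J j).exec) :=
  total_mono (fun j => (J j).exec_pos.le) fun _ hj => hj.trans hu

/-- The standby time of `M₂` is bounded by jobs that arrived after `e`, which are disjoint from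
those charged for earlier periods; the contribution of `M₁` alone is not positive. -/
theorem PrePhase.ledger_le (h : PrePhase P J t e r s) :
    ledger P J t e r s ≤ total (fun j => (J j).arrival ≤ t) (fun j => (J j).exec) := by
  rcases h with h | h | h | h
  · simpa [ledger, h.off 0, h.off 1] using total_exec_mono h.base.e_le
  · have h1 := total_exec_mono (J := J) h.base.e_le
    have h2 := h.idle
    simp only [ledger, h.on0, h.on1, Bool.false_eq_true, if_true, if_false]
    linarith
  · have h1 := total_exec_mono (J := J) h.tStar_le
    have h2 := h.idle_le
    have h3 := total_exec_split (J := J) (h.e_lt.le.trans h.t1_le)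
    simp only [ledger, h.on1, if_true]
    linarith
  · have h1 := total_exec_mono (J := J) h.tStar_le
    have h2 := h.idle
    have h3 := total_exec_split (J := J) (h.e_lt.le.trans h.t1_le)
    simp only [ledger, h.on1, if_true]
    linarith

theorem Phase.ledger_le (h : Phase P J t e r s) :
    ledger P J t e r s ≤ total (fun j => (J j).arrival ≤ t) (fun j => (J j).exec) := by
  rcases h with h | h | h | h
  · simpa [ledger, h.off 0, h.off 1] using total_exec_mono h.base.e_le
  · exact PrePhase.ledger_le (Or.inr (Or.inl h.toPreSingle))
  · exact PrePhase.ledger_le (Or.inr (Or.inr (Or.inl h.toPreUrgent)))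
  · exact PrePhase.ledger_le (Or.inr (Or.inr (Or.inr h.toPreTail)))

theorem Phase.base (h : Phase P J t e r s) : Base J t e r := by
  rcases h with h | h | h | h <;> exact h.base

theorem Phase.segment (hp : Phase P J u e r s) (hJ : EDFCondition J)
    (h : Segment P J s u r t r') : PrePhase P J t e r' s := by
  rcases hp with hp | hp | hp | hp
  · exact Or.inl (hp.segment hJ h)
  · exact Or.inr (Or.inl (hp.segment hJ h))
  · exact Or.inr (Or.inr (Or.inl (hp.segment hJ h)))
  · exact Or.inr (Or.inr (Or.inr (hp.segment hJ h)))

theorem total_true_split {A : ι → Prop} {f : ι → ℝ} (h : ∀ j, ¬ A j → f j = 0) :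
    total (fun _ => True) f = total A f := by
  classical
  refine Finset.sum_congr rfl fun j _ => ?_
  by_cases hA : A j
  · simp [hA]
  · simp [hA, h j hA]

/-- The bookkeeping over a segment. -/
theorem Record.segment (hrec : Record P J u e r s n o x) (hp : Phase P J u e r s)
    (hJ : EDFCondition J) (h : Segment P J s u r t r')
    (ho : o' = o + ∑ m, if s.on m = true then t - u else 0)
    (hmono : ∀ m j, x m j ≤ x' m j) (hsum : ∀ j, r j - r' j = ∑ m, (x' m j - x m j))
    (hx : ∀ m j, (s.on m = true → ¬ responsible J s m j) → x' m j = x m j) :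
    Record P J t e r' s n o' x' := by
  have hpre := hp.segment hJ h
  have hb' : Base J t e r' := by rcases hpre with h | h | h | h <;> exact h.base
  have hsame : ∀ m j, r j = 0 → x' m j = x m j := by
    intro m j hj
    have h1 := hsum j
    have h2 := h.nonneg j
    have h3 := hmono 0 j
    have h4 := hmono 1 j
    rw [Fin.sum_univ_two] at h1
    fin_cases m
    · simp only [Fin.zero_eta]; linarith
    · simp only [Fin.mk_one]; linarith
  have hd : total (fun _ => True) (fun j => (J j).exec - r' j) -
      total (fun _ => True) (fun j => (J j).exec - r j) =
      total (fun _ => True) (fun j => r j - r' j) := by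
    rw [← total_sub]
    exact total_congr (fun _ => Iff.rfl) fun j _ => by ring
  have hd' : ∀ A : ι → Prop, total A (fun j => (J j).exec - r' j) -
      total A (fun j => (J j).exec - r j) = total A (fun j => r j - r' j) := by
    intro A
    rw [← total_sub]
    exact total_congr (fun _ => Iff.rfl) fun j _ => by ring
  have hearly : ∀ j, (J j).arrival ≤ e → r j - r' j = 0 := fun j hj => by
    rw [hp.base.past j hj, hb'.past j hj, sub_zero]
  have hcost := hrec.cost
  rw [Fin.sum_univ_two] at ho
  refine ⟨?_, ?_, ?_, ?_, ?_, ?_⟩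
  · rcases hp with hp | hp | hp | hp
    · obtain rfl := h.frozen hp.off
      simp only [ledger, hp.off 0, hp.off 1, Bool.false_eq_true, if_false] at hcost ho ⊢
      linarith
    · have h1 : total (fun _ => True) (fun j => r j - r' j) =
          total (fun j => e < (J j).arrival) (fun j => r j - r' j) :=
        total_true_split fun j hj => hearly j (not_lt.1 hj)
      have h2 := hd' fun j => e < (J j).arrival
      simp only [ledger, hp.on0, hp.on1, Bool.false_eq_true, if_true, if_false] at hcost ho ⊢
      linarith
    · have hr0 : ∀ j, (J j).arrival ≤ u ∧ responsible J s 0 j ↔ (J j).arrival < s.tStar :=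
        fun j => by
          simp only [responsible, hp.flag, if_true, true_imp_iff, and_iff_right_iff_imp]
          exact fun hj => hj.le.trans hp.tStar_le
      have h1 : total (fun _ => True) (fun j => r j - r' j) =
          total (fun j => (J j).arrival < s.tStar) (fun j => r j - r' j) +
          total (fun j => s.tStar ≤ (J j).arrival) (fun j => r j - r' j) :=
        total_split _ (fun j => by simpa using lt_or_ge _ _) fun j hj => not_le.2 hj
      have h2 := hd' fun j => s.tStar ≤ (J j).arrival
      -- `M₁` is busy throughout, so only the standby time of `M₂` changes the ledger.
      have h3 := h.drain_all hp.on0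
      have h4 := h.stay_urgent hp.flag
      have h5 : total (fun j => (J j).arrival ≤ u ∧ (J j).arrival < s.tStar) r =
          total (fun j => (J j).arrival < s.tStar) r :=
        total_congr (fun j => and_iff_right_of_imp fun hj => hj.le.trans hp.tStar_le)
          fun _ _ => rfl
      simp only [hr0] at h3
      rw [max_eq_right (by linarith)] at h3
      rw [total_sub fun j => (J j).arrival < s.tStar] at h1
      simp only [ledger, hp.on0, hp.on1, if_true] at hcost ho ⊢
      linarith
    · have h1 : total (fun _ => True) (fun j => r j - r' j) =
          total (fun j => s.tStar ≤ (J j).arrival) (fun j => r j - r' j) :=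
        total_true_split fun j hj => by
          rw [hp.oldDone j (not_le.1 hj), zero_sub, neg_eq_zero]
          exact le_antisymm ((h.anti j).trans (hp.oldDone j (not_le.1 hj)).le) (h.nonneg j)
      have h2 := hd' fun j => s.tStar ≤ (J j).arrival
      simp only [ledger, hp.on0, hp.on1, Bool.false_eq_true, if_true, if_false] at hcost ho ⊢
      linarith
  · obtain ⟨k, hk, h1⟩ := hrec.windows
    exact ⟨k, hk, h1.imp_right fun h2 => ⟨h2.1, h2.2.1, h2.2.2.1, h2.2.2.2.1.trans h.lt.le,
      h2.2.2.2.2⟩⟩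
  · intro j
    rcases le_or_gt (J j).arrival e with hj | hj
    · rw [hsame 0 j (hp.base.past j hj), hsame 1 j (hp.base.past j hj)]
      exact hrec.sole j
    · rcases hp with hp | hp | hp | hp
      · rw [hx 0 j fun hc => by simp [hp.off 0] at hc, hx 1 j fun hc => by simp [hp.off 1] at hc]
        exact hrec.sole j
      · right
        rw [hx 1 j fun hc => by simp [hp.on1] at hc]
        exact hrec.single hp.on1 j hj
      · rcases lt_or_ge (J j).arrival s.tStar with h1 | h1
        · right
          rw [hx 1 j fun _ hc => by simpa [h1.not_ge] using hc hp.flag]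
          exact hrec.early hp.on1 j hj h1
        · left
          rw [hx 0 j fun _ hc => by simpa [h1.not_gt] using hc hp.flag]
          exact hrec.late hp.on1 j h1
      · rcases lt_or_ge (J j).arrival s.tStar with h1 | h1
        · rw [hsame 0 j (hp.oldDone j h1), hsame 1 j (hp.oldDone j h1)]
          exact hrec.sole j
        · left
          rw [hx 0 j fun hc => by simp [hp.on0] at hc]
          exact hrec.late hp.on1 j h1
  · intro hon j hj hjt
    rcases hp with hp | hp | hp | hp
    · simp [hp.off 1] at hon
    · simp [hp.on1] at hon
    · rw [hx 1 j fun _ hc => by simpa [hjt.not_ge] using hc hp.flag]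
      exact hrec.early hon j hj hjt
    · rw [hsame 1 j (hp.oldDone j hjt)]
      exact hrec.early hon j hj hjt
  · intro hon j hjt
    rcases hp with hp | hp | hp | hp
    · simp [hp.off 1] at hon
    · simp [hp.on1] at hon
    · rw [hx 0 j fun _ hc => by simpa [hjt.not_gt] using hc hp.flag]
      exact hrec.late hon j hjt
    · rw [hx 0 j fun hc => by simp [hp.on0] at hc]
      exact hrec.late hon j hjt
  · intro hon j hj
    rw [hx 1 j fun hc => by simp [hon] at hc]
    exact hrec.single hon j hj

/-- The bookkeeping when the rules are applied. -/
theorem Record.update (hrec : Record P J t e r s n o x) (hp : PrePhase P J t e r s)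
    (hJ : EDFCondition J) (hs' : s' = s.update P 1 J (openJobs J r t) (dueWork J r t) t)
    (hn : ∀ m, n' m = n m + if s.on m = false ∧ s'.on m = true then 1 else 0)
    (hx0 : ∀ m j, 0 ≤ x m j) (hsum : ∀ j, (J j).exec - r j = ∑ m, x m j) :
    ∃ e', Phase P J t e' r s' ∧ Record P J t e' r s' n' o x := by
  have hzero : ∀ m j, r j = (J j).exec → x m j = 0 := by
    intro m j hj
    have h1 := hsum j
    have h3 := hx0 0 j
    have h4 := hx0 1 j
    rw [Fin.sum_univ_two] at h1
    fin_cases m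
    · simp only [Fin.zero_eta]; linarith
    · simp only [Fin.mk_one]; linarith
  have hb : Base J t e r := by rcases hp with h | h | h | h <;> exact h.base
  have hcost := hrec.cost
  obtain ⟨k, hk, hwin⟩ := hrec.windows
  have hB := P.breakEven_nonneg
  have hled := hp.ledger_le
  have hoff : ∀ w : ℝ, OffPhase P J t t r s' → e < w → w + P.breakEven ≤ t → Trigger P J e w →
      n 0 = k + 1 → ∃ e', Phase P J t e' r s' ∧ Record P J t e' r s' n' o x := by
    intro w h hew hwt htr hnk
    obtain rfl : n' = n := funext fun m => by rw [hn m]; simp [h.off m]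
    refine ⟨t, Or.inl h, ?_, ⟨k + 1, .succ hk hew hwt htr, Or.inl ⟨h.off, hnk⟩⟩,
      hrec.sole, fun hc => by simp [h.off 1] at hc, fun hc => by simp [h.off 1] at hc,
      fun _ j hj => hzero 1 j (hb.future j hj.le)⟩
    -- Closing a period charges all arrived jobs; by `hled` this does not lower the ledger.
    have : ledger P J t t r s' = total (fun j => (J j).arrival ≤ t) (fun j => (J j).exec) := by
      simp [ledger, h.off 0, h.off 1]
    rw [this]
    linarith
  have hsame : Phase P J t e r s → s' = s →
      ∃ e', Phase P J t e' r s' ∧ Record P J t e' r s' n' o x := by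
    rintro h rfl
    obtain rfl : n' = n := funext fun m => by rw [hn m]; simp
    exact ⟨e, h, hrec⟩
  have hlate : total (fun j => t ≤ (J j).arrival) (fun j => (J j).exec - r j) = 0 :=
    total_eq_zero fun j hj => by rw [hb.future j hj, sub_self]
  rcases hp with hp | hp | hp | hp
  · have hnk : n 0 = k := by
      rcases hwin with h | h
      · exact h.2
      · exact absurd hp.off h.1
    have h0 : total (fun j => e < (J j).arrival) (fun j => (J j).exec - r j) = 0 :=
      total_eq_zero fun j hj => by rw [hp.unstarted j hj, sub_self]
    rcases hp.update hJ s' hs' with ⟨h1, h⟩ | ⟨rfl, h⟩ | ⟨rfl, h⟩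
    · exact hsame (Or.inl h) h1
    · have hn0 : n' 0 = n 0 + 1 := by rw [hn 0]; simp [hp.off 0, h.on0]
      have hn1 : n' 1 = n 1 := by rw [hn 1]; simp [h.on1]
      refine ⟨e, Or.inr (Or.inl h), ?_, ⟨k, hk, Or.inr ⟨fun ho => by simpa [h.on0] using ho 0,
        by rw [hn0, hnk], h.e_lt, h.t1_le, h.trig⟩⟩, hrec.sole, fun hc => by simp [h.on1] at hc,
        fun hc => by simp [h.on1] at hc, fun _ => hrec.single (hp.off 1)⟩
      simp only [ledger, h.on0, h.on1, hp.off 0, hp.off 1, Bool.false_eq_true, if_true, if_false,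
        hn0, hn1] at hcost ⊢
      simp only [SysState.turnOnM1, h0]
      push_cast
      linarith
    · have hn0 : n' 0 = n 0 + 1 := by rw [hn 0]; simp [hp.off 0, h.on0]
      have hn1 : n' 1 = n 1 + 1 := by rw [hn 1]; simp [hp.off 1, h.on1]
      refine ⟨e, Or.inr (Or.inr (Or.inl h)), ?_, ⟨k, hk, Or.inr ⟨fun ho => by
        simpa [h.on0] using ho 0, by rw [hn0, hnk], h.e_lt, h.t1_le.trans h.tStar_le, h.trig⟩⟩,
        hrec.sole, fun _ j hj _ => hzero 1 j (hp.unstarted j hj),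
        fun _ j hj => hzero 0 j (hb.future j hj), fun hc => by simp [h.on1] at hc⟩
      simp only [ledger, h.on1, hp.off 0, hp.off 1, Bool.false_eq_true, if_true, if_false,
        hn0, hn1] at hcost ⊢
      simp only [SysState.raised, hlate]
      push_cast
      linarith
  · have hnk : n 0 = k + 1 := by
      rcases hwin with h | h
      · simpa [hp.on0] using h.1 0
      · exact h.2.1
    rcases hp.update hJ s' hs' with ⟨h1, h⟩ | ⟨rfl, h⟩ | ⟨-, -, hwt, h⟩
    · exact hsame (Or.inr (Or.inl h)) h1
    · have hn0 : n' 0 = n 0 := by rw [hn 0]; simp [hp.on0]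
      have hn1 : n' 1 = n 1 + 1 := by rw [hn 1]; simp [hp.on1, h.on1]
      refine ⟨e, Or.inr (Or.inr (Or.inl h)), ?_, ⟨k, hk, Or.inr ⟨fun ho => by
        simpa [h.on0] using ho 0, by rw [hn0, hnk], h.e_lt, h.t1_le.trans h.tStar_le, h.trig⟩⟩,
        hrec.sole, fun _ j hj _ => hrec.single hp.on1 j hj,
        fun _ j hj => hzero 0 j (hb.future j hj), fun hc => by simp [h.on1] at hc⟩
      -- Turning on `M₂` uses up the `B` left of the allowance. The standby time of `M₁` disappears
      -- from the ledger, and `oldDone` shows that there was none.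
      have h2 := h.oldDone
      have h3 : total (fun j => e < (J j).arrival ∧ (J j).arrival < t)
          (fun j => (J j).exec - r j) ≤
          total (fun j => e < (J j).arrival) (fun j => (J j).exec - r j) :=
        total_mono (fun j => sub_nonneg.2 (hb.le_exec j)) fun j hj => hj.1
      simp only [ledger, h.on1, hp.on0, hp.on1, Bool.false_eq_true, if_true, if_false,
        hn0, hn1] at hcost ⊢
      simp only [SysState.raised, hlate] at h2 ⊢
      push_cast
      linarith
    · exact hoff _ h hp.e_lt hwt hp.trig hnk
  · have hnk : n 0 = k + 1 := by
      rcases hwin with h | h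
      · simpa [hp.on0] using h.1 0
      · exact h.2.1
    rcases hp.update s' hs' with ⟨h1, h⟩ | ⟨rfl, h⟩ | ⟨-, -, hwt, h⟩
    · exact hsame (Or.inr (Or.inr (Or.inl h))) h1
    · obtain rfl : n' = n := funext fun m => by
        rw [hn m]; fin_cases m <;> simp [hp.on1, h.on0]
      refine ⟨e, Or.inr (Or.inr (Or.inr h)), ?_, ⟨k, hk, Or.inr ⟨fun ho => by
        simpa [h.on1] using ho 1, hnk, h.e_lt, h.t1_le.trans h.tStar_le, h.trig⟩⟩,
        hrec.sole, fun _ => hrec.early hp.on1, fun _ => hrec.late hp.on1,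
        fun hc => by simp [h.on1] at hc⟩
      simp only [ledger, h.on1, hp.on1, if_true] at hcost ⊢
      simp only [SysState.cleared]
      linarith
    · exact hoff _ h hp.e_lt hwt hp.trig hnk
  · have hnk : n 0 = k + 1 := by
      rcases hwin with h | h
      · simpa [hp.on1] using h.1 1
      · exact h.2.1
    rcases hp.update hJ s' hs' with ⟨h1, h⟩ | ⟨-, -, hwt, h⟩
    · exact hsame (Or.inr (Or.inr (Or.inr h))) h1
    · exact hoff _ h hp.e_lt hwt hp.trig hnk

end Record

/-! ### The invariant of all runs, feasibility, and the energy formulas. -/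

section RunInvariant

variable {ι : Type*} {k : ℕ}

/-- The number of times processor `m` has been turned on up to time `t`. -/
def Schedule.turnOns (S : Schedule ι k) (m : Fin k) (t : ℝ) : ℕ :=
  ((S.on m).filter fun I => I.1 ≤ t).card

/-- The amount of time within `A` during which processor `m` is on. -/
def Schedule.onTime (S : Schedule ι k) (m : Fin k) (A : Set ℝ) : ℝ :=
  ∑ I ∈ S.on m, volume.real (Ico I.1 I.2 ∩ A)

theorem Schedule.eq_of_mem (S : Schedule ι k) {m : Fin k} {I I' : ℝ × ℝ} (hI : I ∈ S.on m)
    (hI' : I' ∈ S.on m) (h1 : I'.1 ≤ I.2) (h2 : I.1 ≤ I'.2) : I = I' := by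
  by_contra hne
  rcases S.on_separated m I hI I' hI' hne with h | h <;> linarith

theorem Schedule.onTime_zero (S : Schedule ι k) (m : Fin k) : S.onTime m (Icc 0 0) = 0 := by
  refine Finset.sum_eq_zero fun I _ => ?_
  rw [Icc_self, measureReal_def, measure_mono_null inter_subset_right (measure_singleton (0 : ℝ))]
  rfl

theorem Schedule.executed_nonneg (S : Schedule ι k) (m : Fin k) (j : ι) (A : Set ℝ) :
    0 ≤ S.executed m j A := by
  rw [S.executed_eq]
  exact Finset.sum_nonneg fun I _ => measureReal_nonneg

theorem Schedule.Ico_inter_Iic (S : Schedule ι k) {m : Fin k} {I : ℝ × ℝ} (hI : I ∈ S.on m)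
    (T : ℝ) : Ico I.1 I.2 ∩ Iic T = Ico I.1 I.2 ∩ Icc 0 T := by
  ext v
  exact ⟨fun hv => ⟨hv.1, (S.on_nonneg m I hI).trans hv.1.1, hv.2⟩, fun hv => ⟨hv.1, hv.2.2⟩⟩

variable {P : PowerModel} {J : ι → Job} {S : Schedule ι 2} {σ : ℝ → SysState} {lam : ℝ}
  [Fintype ι]

theorem IsRun.turnOns_step (h : IsRun P lam J S σ) {u t : ℝ} (hu : 0 ≤ u) (hut : u < t)
    (hc : ∀ v ∈ Ico u t, σ v = σ u) (m : Fin 2) : S.turnOns m t = S.turnOns m u +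
      if (σ u).on m = false ∧ (σ t).on m = true then 1 else 0 := by
  classical
  have hon : ∀ v ∈ Ico u t, ((σ u).on m = true ↔ ∃ I ∈ S.on m, v ∈ Ico I.1 I.2) := fun v hv => by
    rw [← hc v hv]
    exact h.on_iff v (hu.trans hv.1) m
  have hnew : ∀ I ∈ S.on m, u < I.1 → I.1 ≤ t → (σ u).on m = false ∧ I.1 = t := by
    intro I hI h1 h2
    have hoff : (σ u).on m = false := by
      by_contra hc
      rw [Bool.not_eq_false] at hc
      obtain ⟨I', hI', hu'⟩ := (hon u ⟨le_rfl, hut⟩).1 hc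
      -- If the interval ended earlier, another on-interval would have to contain its end, contrary
      -- to separation.
      have h3 : t ≤ I'.2 := by
        by_contra h4
        push Not at h4
        obtain ⟨I'', hI'', hv⟩ := (hon I'.2 ⟨hu'.2.le, h4⟩).1 hc
        have := S.eq_of_mem hI' hI'' hv.1 (hu'.1.trans (hu'.2.le.trans hv.2.le))
        rw [this] at hv
        exact lt_irrefl _ hv.2
      have := S.eq_of_mem hI' hI (h2.trans h3)
        (hu'.1.trans (h1.le.trans (S.on_lt m I hI).le))
      rw [this] at hu'
      linarith [hu'.1]
    refine ⟨hoff, h2.eq_of_not_lt fun h3 => ?_⟩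
    have := (hon I.1 ⟨h1.le, h3⟩).2 ⟨I, hI, le_rfl, S.on_lt m I hI⟩
    simp [hoff] at this
  split_ifs with hcase
  · obtain ⟨I, hI, hIt⟩ := (h.on_iff t (hu.trans hut.le) m).1 hcase.2
    have hIu : u < I.1 := by
      by_contra hle
      have := (hon u ⟨le_rfl, hut⟩).2 ⟨I, hI, not_lt.1 hle, hut.trans hIt.2⟩
      simp [hcase.1] at this
    have hset : (S.on m).filter (fun I => I.1 ≤ t) =
        insert I ((S.on m).filter fun I => I.1 ≤ u) := by
      ext I'
      simp only [Finset.mem_filter, Finset.mem_insert]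
      constructor
      · rintro ⟨h1, h2⟩
        rcases le_or_gt I'.1 u with h3 | h3
        · exact Or.inr ⟨h1, h3⟩
        · have h4 := (hnew I' h1 h3 h2).2
          exact Or.inl (S.eq_of_mem h1 hI
            (hIt.1.trans (h4.ge.trans (S.on_lt m I' h1).le)) (h4.le.trans hIt.2.le))
      · rintro (rfl | ⟨h1, h2⟩)
        · exact ⟨hI, hIt.1⟩
        · exact ⟨h1, h2.trans hut.le⟩
    rw [Schedule.turnOns, hset, Finset.card_insert_of_notMem]
    · rfl
    · simp [hIu]
  · rw [add_zero]
    refine congrArg Finset.card (Finset.filter_congr fun I hI => ⟨fun h1 => ?_, fun h1 =>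
      h1.trans hut.le⟩)
    by_contra h2
    obtain ⟨h3, h4⟩ := hnew I hI (not_le.1 h2) h1
    exact hcase ⟨h3, (h.on_iff t (hu.trans hut.le) m).2 ⟨I, hI, h1, h4 ▸ S.on_lt m I hI⟩⟩

theorem IsRun.turnOns_zero (h : IsRun P lam J S σ) (m : Fin 2) :
    S.turnOns m 0 = if (σ 0).on m = true then 1 else 0 := by
  split_ifs with hcase
  · obtain ⟨I, hI, hI0⟩ := (h.on_iff 0 le_rfl m).1 hcase
    refine Finset.card_eq_one.2 ⟨I, Finset.ext fun I' => ?_⟩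
    simp only [Finset.mem_filter, Finset.mem_singleton]
    constructor
    · rintro ⟨h1, h2⟩
      exact S.eq_of_mem h1 hI
        (hI0.1.trans ((S.on_nonneg m I' h1).trans (S.on_lt m I' h1).le)) (h2.trans hI0.2.le)
    · rintro rfl
      exact ⟨hI, hI0.1⟩
  · refine Finset.card_eq_zero.2 (Finset.filter_eq_empty_iff.2 fun I hI h1 => hcase ?_)
    exact (h.on_iff 0 le_rfl m).2 ⟨I, hI, h1, (S.on_nonneg m I hI).trans_lt (S.on_lt m I hI)⟩

theorem IsRun.onTime_step (h : IsRun P lam J S σ) {u t : ℝ} (hu : 0 ≤ u) (hut : u < t)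
    (hc : ∀ v ∈ Ico u t, σ v = σ u) (m : Fin 2) : S.onTime m (Icc 0 t) = S.onTime m (Icc 0 u) +
      if (σ u).on m = true then t - u else 0 := by
  have hU : MeasurableSet (⋃ I ∈ S.on m, Ico I.1 I.2) :=
    Finset.measurableSet_biUnion _ fun I _ => measurableSet_Ico
  have h1 := volume_real_Icc_sub hU hu hut.le
  simp only [inter_comm (Icc _ _), ← S.sum_on_volume m measurableSet_Icc] at h1
  rw [Schedule.onTime, Schedule.onTime, ← sub_eq_iff_eq_add', h1]
  have hmem : ∀ v ∈ Ioo u t, (v ∈ ⋃ I ∈ S.on m, Ico I.1 I.2) ↔ (σ u).on m = true := by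
    intro v hv
    rw [← hc v ⟨hv.1.le, hv.2⟩, h.on_iff v (hu.trans hv.1.le) m]
    simp only [mem_iUnion, exists_prop]
  split_ifs with hon
  · rw [inter_eq_left.2 fun v hv => (hmem v hv).2 hon, Real.volume_real_Ioo_of_le hut.le]
  · rw [show Ioo u t ∩ _ = ∅ from eq_empty_of_forall_notMem fun v hv =>
      hon ((hmem v hv.1).1 hv.2), measureReal_empty]

theorem IsRun.executed_zero (h : IsRun P lam J S σ) (m : Fin 2) (j : ι) :
    S.executed m j (Icc 0 0) = 0 := by
  rw [h.executed_Icc, Icc_self, measureReal_def,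
    measure_mono_null inter_subset_left (measure_singleton (0 : ℝ))]
  rfl

theorem IsRun.invariant (h : IsRun P 1 J S σ) (hJ : EDFCondition J) {t : ℝ} (ht : 0 ≤ t) :
    ∃ e, Phase P J t e (fun j => S.remaining J j t) (σ t) ∧
      Record P J t e (fun j => S.remaining J j t) (σ t) (fun m => S.turnOns m t)
        (∑ m, S.onTime m (Icc 0 t)) fun m j => S.executed m j (Icc 0 t) := by
  refine h.induction (p := fun t => ∃ e, Phase P J t e (fun j => S.remaining J j t) (σ t) ∧
      Record P J t e (fun j => S.remaining J j t) (σ t) (fun m => S.turnOns m t)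
        (∑ m, S.onTime m (Icc 0 t)) fun m j => S.executed m j (Icc 0 t)) ?_ ?_ ht
  · have h0 : (fun j => S.remaining J j 0) = fun j => (J j).exec :=
      funext fun j => h.remaining_zero j
    have hrec : Record P J 0 (-1) (fun j => S.remaining J j 0) SysState.initial (fun _ => 0)
        (∑ m, S.onTime m (Icc 0 0)) fun m j => S.executed m j (Icc 0 0) := by
      refine ⟨?_, ⟨0, .zero, Or.inl ⟨fun _ => rfl, rfl⟩⟩, fun j => Or.inl (h.executed_zero 0 j),
        fun _ j _ _ => h.executed_zero 1 j, fun _ j _ => h.executed_zero 0 j,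
        fun _ j _ => h.executed_zero 1 j⟩
      have h1 : 0 ≤ total (fun j => (J j).arrival ≤ -1) (fun j => (J j).exec) :=
        total_nonneg fun j _ => (J j).exec_pos.le
      have h2 : total (fun _ => True) (fun j => (J j).exec - S.remaining J j 0) = 0 :=
        total_eq_zero fun j _ => by rw [h.remaining_zero, sub_self]
      simp only [S.onTime_zero, h2, ledger, SysState.initial, Bool.false_eq_true, if_false,
        Finset.sum_const_zero]
      norm_num
      exact h1
    refine hrec.update (Or.inl ?_) hJ h.init (fun m => ?_) (fun m j => S.executed_nonneg m j _)
      fun j => ?_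
    · rw [h0]
      exact PreOff.initial hJ
    · rw [h.turnOns_zero]
      simp [SysState.initial]
    · simp [Schedule.remaining]
  · rintro u t hu hut hc hq ⟨e, hp, hrec⟩
    have hseg : Segment P J (σ u) u (fun j => S.remaining J j u) t
        (fun j => S.remaining J j t) := by
      refine h.segment hu hut hc hq (fun hs => ?_) fun hs => ?_
      · rcases hp with hp | hp | hp | hp
        · exact Or.inl (hp.off 0)
        · exact Or.inr hp.on1
        · simp [hp.flag] at hs
        · exact Or.inl hp.on0
      · rcases hp with hp | hp | hp | hp
        · simp [hp.calm] at hs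
        · exact hp.on0
        · exact hp.on0
        · simp [hp.calm] at hs
    have hrec' := hrec.segment hp hJ hseg (o' := ∑ m, S.onTime m (Icc 0 t))
      (x' := fun m j => S.executed m j (Icc 0 t)) ?_ ?_ ?_ ?_
    · refine hrec'.update (hp.segment hJ hseg) hJ (h.update_left hu hut hc)
        (h.turnOns_step hu hut hc) (fun m j => S.executed_nonneg m j _) fun j => ?_
      simp [Schedule.remaining]
    · rw [← Finset.sum_add_distrib]
      exact Finset.sum_congr rfl fun m _ => h.onTime_step hu hut hc m
    · intro m j
      have := h.executed_sub m j hu hut.le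
      have h2 : 0 ≤ volume.real (Ioo u t ∩ S.slot m j) := measureReal_nonneg
      linarith
    · intro j
      simp only [h.remaining_sub j hu hut.le, h.executed_sub _ j hu hut.le]
    · intro m j hj
      have h1 := h.executed_sub m j hu hut.le
      rw [h.not_slot hu (fun v hv => hc v ⟨hv.1.le, hv.2⟩) fun hm hr => absurd hr (hj hm)] at h1
      linarith

/-- `Base.due` at the deadline shows that the job is finished, and `Record.sole` that a single
processor has executed it. -/
theorem IsRun.feasible (h : IsRun P 1 J S σ) (hJ : EDFCondition J) : S.Feasible J univ := by
  intro j _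
  have hd : 0 ≤ (J j).deadline := (J j).arrival_nonneg.trans (hJ.arrival_lt_deadline j).le
  obtain ⟨e, hp, hrec⟩ := h.invariant hJ hd
  have h0 : S.remaining J j (J j).deadline = 0 := hp.base.due j le_rfl
  have hexec : ∀ m, S.executed m j (Icc (J j).arrival (J j).deadline) =
      S.executed m j (Icc 0 (J j).deadline) := by
    intro m
    have hset : Icc (J j).arrival (J j).deadline ∩ S.slot m j =
        Icc 0 (J j).deadline ∩ S.slot m j := by
      ext v
      refine ⟨fun hv => ⟨⟨(J j).arrival_nonneg.trans hv.1.1, hv.1.2⟩, hv.2⟩, fun hv =>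
        ⟨⟨(h.mem_eligible hv.1.1 hv.2).1.1, hv.1.2⟩, hv.2⟩⟩
    rw [h.executed_Icc, ← hset]
    refine S.executed_eq_of_subset m j measurableSet_Icc fun v hv hj => ?_
    have hv0 := (J j).arrival_nonneg.trans hv.1
    exact (h.on_iff v hv0 m).1 (h.mem_eligible hv0 hj).2.1
  rw [Schedule.remaining, Fin.sum_univ_two] at h0
  rcases hrec.sole j with h1 | h1
  · exact ⟨1, by rw [hexec]; linarith⟩
  · exact ⟨0, by rw [hexec]; linarith⟩

theorem Schedule.sum_power (S : Schedule ι k) (P : PowerModel) (m : Fin k) (A : Set ℝ) :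
    ∑ I ∈ S.on m, ∫ t in Ico I.1 I.2 ∩ A, S.power P m t =
      P.standby * S.onTime m A + (P.busy - P.standby) * ∑ j, S.executed m j A := by
  unfold Schedule.onTime Schedule.executed
  rw [Finset.sum_comm, Finset.mul_sum, Finset.mul_sum, ← Finset.sum_add_distrib]
  refine Finset.sum_congr rfl fun I _ => ?_
  have hfin : IsFiniteMeasure (volume.restrict (Ico I.1 I.2 ∩ A)) :=
    ⟨by
      rw [Measure.restrict_apply_univ]
      exact (measure_mono inter_subset_left).trans_lt measure_Ico_lt_top⟩
  have hint : ∀ j, Integrable ({s | S.job m s = some j}.indicator fun _ => (1 : ℝ))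
      (volume.restrict (Ico I.1 I.2 ∩ A)) := fun j =>
    (integrable_const 1).indicator (S.job_measurable m (some j))
  have hpow : ∀ t, S.power P m t = P.standby + (P.busy - P.standby) *
      ∑ j, {s | S.job m s = some j}.indicator (fun _ => (1 : ℝ)) t := by
    intro t
    classical
    simp only [indicator_apply, mem_ofPred_eq]
    rcases Option.eq_none_or_eq_some (S.job m t) with hj | ⟨i, hj⟩ <;>
      simp [Schedule.power, hj]
  simp only [hpow]
  rw [integral_add (integrable_const _) ((integrable_finsetSum _ fun j _ => hint j).const_mul _),
    integral_const_mul, integral_finsetSum _ fun j _ => hint j, integral_const]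
  simp [mul_comm]

theorem Schedule.energyUpTo_eq (S : Schedule ι k) (P : PowerModel) (T : ℝ) :
    S.energyUpTo P T = P.standby * (∑ m, (P.breakEven * S.turnOns m T + S.onTime m (Icc 0 T))) +
      (P.busy - P.standby) * ∑ m, ∑ j, S.executed m j (Icc 0 T) := by
  rw [Finset.mul_sum, Finset.mul_sum, ← Finset.sum_add_distrib]
  refine Finset.sum_congr rfl fun m _ => ?_
  rw [Finset.sum_congr rfl fun I hI => by rw [S.Ico_inter_Iic hI T], S.sum_power,
    ← P.standby_mul_breakEven, Schedule.turnOns]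
  ring

theorem Schedule.energy_eq (S : Schedule ι k) (P : PowerModel) :
    S.energy P = P.standby * (∑ m, (P.breakEven * (S.on m).card + S.onTime m univ)) +
      (P.busy - P.standby) * ∑ m, ∑ j, S.executed m j univ := by
  rw [Finset.mul_sum, Finset.mul_sum, ← Finset.sum_add_distrib]
  refine Finset.sum_congr rfl fun m _ => ?_
  have := S.sum_power P m univ
  simp only [inter_univ] at this
  rw [this, ← P.standby_mul_breakEven]
  ring

end RunInvariant

/-! ### Lower bound for an arbitrary feasible schedule, and competitiveness. -/

section Comparison

variable {ι : Type*} {k : ℕ}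

/-- The set of times at which some processor is on. -/
def Schedule.onSet (S : Schedule ι k) : Set ℝ := ⋃ m, ⋃ I ∈ S.on m, Ico I.1 I.2

theorem Schedule.volume_onSet_ne_top (S : Schedule ι k) : volume S.onSet ≠ ⊤ := by
  refine ((measure_iUnion_le _).trans_lt ?_).ne
  rw [tsum_fintype]
  refine ENNReal.sum_lt_top.2 fun m _ => ?_
  refine (measure_biUnion_finset_le _ _).trans_lt (ENNReal.sum_lt_top.2 fun I _ => ?_)
  exact measure_Ico_lt_top

theorem volume_Ico_inter_ne_top (a b : ℝ) (A : Set ℝ) : volume (Ico a b ∩ A) ≠ ⊤ :=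
  ((measure_mono inter_subset_left).trans_lt measure_Ico_lt_top).ne

theorem Schedule.volume_onSet_inter_le (S : Schedule ι k) {A : Set ℝ} (hA : MeasurableSet A) :
    volume.real (S.onSet ∩ A) ≤ ∑ m, S.onTime m A := by
  rw [Schedule.onSet, iUnion_inter]
  refine (measureReal_iUnion_fintype_le _).trans (Finset.sum_le_sum fun m _ => ?_)
  rw [Schedule.onTime, S.sum_on_volume m hA]

theorem Schedule.onTime_add_compl (S : Schedule ι k) (m : Fin k) {A : Set ℝ}
    (hA : MeasurableSet A) : S.onTime m A + S.onTime m Aᶜ = S.onTime m univ := by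
  rw [Schedule.onTime, Schedule.onTime, Schedule.onTime, ← Finset.sum_add_distrib]
  refine Finset.sum_congr rfl fun I _ => ?_
  rw [inter_univ, ← sdiff_eq]
  exact measureReal_inter_add_sdiff hA (by simp)

theorem Schedule.executed_mono (S : Schedule ι k) (m : Fin k) (j : ι) {A B : Set ℝ}
    (h : ∀ I ∈ S.on m, Ico I.1 I.2 ∩ A ⊆ B) : S.executed m j A ≤ S.executed m j B := by
  rw [S.executed_eq, S.executed_eq]
  refine Finset.sum_le_sum fun I hI => measureReal_mono ?_ (volume_Ico_inter_ne_top _ _ _)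
  exact fun v hv => ⟨hv.1, h I hI ⟨hv.1, hv.2.1⟩, hv.2.2⟩

theorem Schedule.exists_mem_of_executed_pos (S : Schedule ι k) {m : Fin k} {j : ι} {A : Set ℝ}
    (h : 0 < S.executed m j A) : ∃ I ∈ S.on m, ∃ v ∈ A, v ∈ Ico I.1 I.2 := by
  by_contra hc
  push Not at hc
  rw [S.executed_eq] at h
  refine h.ne' (Finset.sum_eq_zero fun I hI => ?_)
  rw [show Ico I.1 I.2 ∩ (A ∩ S.slot m j) = ∅ from
    eq_empty_of_forall_notMem fun v hv => hc I hI v hv.2.1 hv.1, measureReal_empty]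

variable (O : Schedule ι k)

/-- The number of ends of on-intervals up to time `t`. -/
def Schedule.ends (S : Schedule ι k) (t : ℝ) : ℕ :=
  ∑ m, (((S.on m).filter fun I => I.1 ≤ t).card + ((S.on m).filter fun I => I.2 ≤ t).card)

theorem Schedule.ends_mono {p q : ℝ} (h : p ≤ q) : O.ends p ≤ O.ends q :=
  Finset.sum_le_sum fun _ _ => Nat.add_le_add
    (Finset.card_le_card (Finset.monotone_filter_right _ fun _ _ h1 => h1.trans h))
    (Finset.card_le_card (Finset.monotone_filter_right _ fun _ _ h1 => h1.trans h))

theorem Schedule.ends_lt {p q : ℝ} (h : p ≤ q) {m : Fin k} {I : ℝ × ℝ} (hI : I ∈ O.on m)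
    (hI' : p < I.1 ∧ I.1 ≤ q ∨ p < I.2 ∧ I.2 ≤ q) : O.ends p < O.ends q := by
  have h1 : ∀ m, ((O.on m).filter fun I => I.1 ≤ p) ⊆ (O.on m).filter fun I => I.1 ≤ q := fun m =>
    Finset.monotone_filter_right _ fun _ _ h1 => h1.trans h
  have h2 : ∀ m, ((O.on m).filter fun I => I.2 ≤ p) ⊆ (O.on m).filter fun I => I.2 ≤ q := fun m =>
    Finset.monotone_filter_right _ fun _ _ h1 => h1.trans h
  refine Finset.sum_lt_sum (fun m _ => Nat.add_le_add (Finset.card_le_card (h1 m))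
    (Finset.card_le_card (h2 m))) ⟨m, Finset.mem_univ m, ?_⟩
  rcases hI' with h3 | h3
  · refine Nat.add_lt_add_of_lt_of_le (Finset.card_lt_card ((Finset.ssubset_iff_of_subset (h1 m)).2
      ⟨I, ?_, ?_⟩)) (Finset.card_le_card (h2 m))
    · simp [hI, h3.2]
    · simp [h3.1]
  · refine Nat.add_lt_add_of_le_of_lt (Finset.card_le_card (h1 m)) (Finset.card_lt_card
      ((Finset.ssubset_iff_of_subset (h2 m)).2 ⟨I, ?_, ?_⟩))
    · simp [hI, h3.2]
    · simp [h3.1]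

theorem Schedule.ends_le (t : ℝ) : O.ends t ≤ ∑ m, 2 * (O.on m).card :=
  Finset.sum_le_sum fun m _ => by
    have h1 := Finset.card_filter_le (O.on m) fun I => I.1 ≤ t
    have h2 := Finset.card_filter_le (O.on m) fun I => I.2 ≤ t
    omega

theorem Schedule.ends_lt_of_lt {t : ℝ} {m : Fin k} {I : ℝ × ℝ} (hI : I ∈ O.on m)
    (hI' : t < I.2) : O.ends t < ∑ m, 2 * (O.on m).card := by
  refine Finset.sum_lt_sum (fun m _ => ?_) ⟨m, Finset.mem_univ m, ?_⟩
  · have h1 := Finset.card_filter_le (O.on m) fun I => I.1 ≤ t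
    have h2 := Finset.card_filter_le (O.on m) fun I => I.2 ≤ t
    omega
  · have h1 := Finset.card_filter_le (O.on m) fun I => I.1 ≤ t
    have h2 : ((O.on m).filter fun I => I.2 ≤ t).card < (O.on m).card :=
      Finset.card_lt_card (Finset.filter_ssubset.2 ⟨I, hI, not_le.2 hI'⟩)
    omega

theorem Schedule.exists_energy_eq (P : PowerModel) :
    ∃ T, 0 ≤ T ∧ O.energyUpTo P T = O.energy P := by
  classical
  obtain ⟨T2, hT2⟩ := (Finset.univ.biUnion fun m => (O.on m).image Prod.snd).bddAbove
  have h2 : ∀ m, ∀ I ∈ O.on m, I.2 ≤ max T2 0 := fun m I hI => by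
    refine le_trans (hT2 ?_) (le_max_left _ _)
    simp only [Finset.coe_biUnion, Finset.coe_image, mem_iUnion, mem_image, Finset.mem_coe]
    exact ⟨m, Finset.mem_univ m, I, hI, rfl⟩
  refine ⟨max T2 0, le_max_right _ _, ?_⟩
  refine Finset.sum_congr rfl fun m _ => ?_
  rw [Finset.filter_true_of_mem fun I hI => (O.on_lt m I hI).le.trans (h2 m I hI)]
  congr 1
  refine Finset.sum_congr rfl fun I hI => ?_
  rw [inter_eq_left.2 fun v hv => hv.2.le.trans (h2 m I hI)]

variable [Fintype ι]

theorem Schedule.sum_executed_le (S : Schedule ι k) (m : Fin k) {A : Set ℝ}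
    (hA : MeasurableSet A) : ∑ j, S.executed m j A ≤ S.onTime m A := by
  simp only [S.executed_eq]
  rw [Finset.sum_comm]
  refine Finset.sum_le_sum fun I _ => ?_
  rw [← measureReal_biUnion_finset (h := fun j _ => volume_Ico_inter_ne_top _ _ _)]
  · refine measureReal_mono (iUnion₂_subset fun j _ v hv => ⟨hv.1, hv.2.1⟩)
      (volume_Ico_inter_ne_top _ _ _)
  · intro i _ j _ hne
    exact Set.disjoint_left.2 fun v hv hv' => hne (Option.some.inj (hv.2.2.symm.trans hv'.2.2))
  · exact fun j _ => measurableSet_Ico.inter (hA.inter (S.measurableSet_slot m j))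

variable {P : PowerModel} {J : ι → Job}

/-- Feasibly scheduled jobs, which can only be executed within `R`, are executed within `R`. -/
theorem Schedule.total_le_sum_executed {A : Set ι} (hO : O.Feasible J A) {D : ι → Prop}
    (hD : ∀ j, D j → j ∈ A) {R : Set ℝ} (hR : ∀ j, D j → ∀ m, ∀ I ∈ O.on m,
      Ico I.1 I.2 ∩ Icc (J j).arrival (J j).deadline ⊆ R) :
    total D (fun j => (J j).exec) ≤ ∑ m, ∑ j, O.executed m j R := by
  classical
  rw [Finset.sum_comm]
  refine Finset.sum_le_sum fun j _ => ?_
  have hnn : ∀ m ∈ Finset.univ, 0 ≤ O.executed m j R := fun m _ => O.executed_nonneg m j R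
  split_ifs with hj
  · obtain ⟨m, hm⟩ := hO j (hD j hj)
    exact hm.trans ((O.executed_mono m j fun I hI => hR j hj m I hI).trans
      (Finset.single_le_sum hnn (Finset.mem_univ m)))
  · exact Finset.sum_nonneg hnn

theorem volume_real_extend {U U' : Set ℝ} (hUU : U ⊆ U') (hU' : volume U' ≠ ⊤) {p w q : ℝ}
    (hpw : p ≤ w) (hwq : w ≤ q) (hIoc : Ioc w q ⊆ U') :
    volume.real (U ∩ Iic p) + (q - w) ≤ volume.real (U' ∩ Iic q) := by
  have hfin : ∀ A, volume (U' ∩ A) ≠ ⊤ := fun A =>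
    ((measure_mono inter_subset_left).trans_lt hU'.lt_top).ne
  rw [← Real.volume_real_Ioc_of_le hwq, ← measureReal_union (h₁ := ((measure_mono
    (inter_subset_inter_left _ hUU)).trans_lt (hfin (Iic p)).lt_top).ne)
    (h₂ := measure_Ioc_lt_top.ne)
    (Set.disjoint_left.2 fun v hv hv' => absurd hv.2 (not_le.2 (hpw.trans_lt hv'.1)))
    measurableSet_Ioc]
  refine measureReal_mono (union_subset (fun v hv => ⟨hUU hv.1, ?_⟩) fun v hv =>
    ⟨hIoc hv, hv.2⟩) (hfin _)
  exact le_trans (mem_Iic.1 hv.2) (hpw.trans hwq)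

/-- Every period contains an end of an on-interval of `O`, or `O` is on all the time, or `O` is off
all the time.  In the latter case `O` has to execute, after the period, as much work as fits between
the turn-on of the period and some time `x`, before time `x`. -/
theorem Windows.exists_cover {n : ℕ} {e : ℝ} (h : Windows P J n e)
    (hO : O.Feasible J {j | (J j).arrival ≤ e}) :
    ∃ (R : Set ℝ) (D : ι → Prop), MeasurableSet R ∧ volume R ≠ ⊤ ∧
      volume.real R ≤ total D (fun j => (J j).exec) ∧ (∀ j, D j → (J j).arrival ≤ e) ∧
      (∀ j, D j → ∀ m, ∀ I ∈ O.on m, Ico I.1 I.2 ∩ Icc (J j).arrival (J j).deadline ⊆ R) ∧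
      P.breakEven * n ≤ P.breakEven * O.ends e + volume.real ((O.onSet ∪ R) ∩ Iic e) := by
  induction h with
  | zero =>
    refine ⟨∅, fun _ => False, MeasurableSet.empty, by simp, by simp [total], by simp, by simp, ?_⟩
    have := mul_nonneg P.breakEven_nonneg (Nat.cast_nonneg (α := ℝ) (O.ends (-1)))
    simp only [Nat.cast_zero, mul_zero]
    positivity
  | @succ n p w q hn hpw hwq htr ih =>
    have hB := P.breakEven_nonneg
    have hwq' : w ≤ q := by linarith
    have hpq : p ≤ q := hpw.le.trans hwq'
    obtain ⟨R, D, hR, hRfin, hRD, hDp, hDR, hle⟩ := ih fun j hj => hO j (le_trans hj hpq)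
    have hUfin : volume (O.onSet ∪ R) ≠ ⊤ :=
      (measure_union_lt_top O.volume_onSet_ne_top.lt_top hRfin.lt_top).ne
    have hends : (O.ends p : ℝ) ≤ O.ends q := by exact_mod_cast O.ends_mono hpq
    -- A start or an end of an on-interval within the period pays for the period.
    by_cases h1 : ∃ m, ∃ I ∈ O.on m, p < I.1 ∧ I.1 ≤ q ∨ p < I.2 ∧ I.2 ≤ q
    · obtain ⟨m, I, hI, hI'⟩ := h1
      refine ⟨R, D, hR, hRfin, hRD, fun j hj => (hDp j hj).trans hpq, hDR, ?_⟩
      have h2 : (O.ends p : ℝ) + 1 ≤ O.ends q := by exact_mod_cast O.ends_lt hpq hI hI'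
      have h3 : volume.real ((O.onSet ∪ R) ∩ Iic p) ≤ volume.real ((O.onSet ∪ R) ∩ Iic q) :=
        measureReal_mono (inter_subset_inter_right _ (Iic_subset_Iic.2 hpq))
          ((measure_mono inter_subset_left).trans_lt hUfin.lt_top).ne
      have h4 := mul_le_mul_of_nonneg_left h2 hB
      push_cast
      linarith
    push Not at h1
    have h4 := mul_le_mul_of_nonneg_left hends hB
    -- An on-interval spanning the period pays with on-time `q - p`, which exceeds the break-even
    -- time.
    by_cases h2 : ∃ m, ∃ I ∈ O.on m, I.1 ≤ p ∧ q < I.2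
    · obtain ⟨m, I, hI, hI'⟩ := h2
      refine ⟨R, D, hR, hRfin, hRD, fun j hj => (hDp j hj).trans hpq, hDR, ?_⟩
      have h3 := volume_real_extend (U := O.onSet ∪ R) le_rfl hUfin le_rfl hpq fun v hv =>
        Or.inl (mem_iUnion.2 ⟨m, mem_biUnion hI ⟨hI'.1.trans hv.1.le, hv.2.trans_lt hI'.2⟩⟩)
      push_cast
      linarith
    push Not at h2
    have hout : ∀ m, ∀ I ∈ O.on m, ∀ v ∈ Ico I.1 I.2, p < v → q < v := by
      intro m I hI v hv hpv
      rcases le_or_gt I.1 p with h5 | h5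
      · have h6 := h2 m I hI h5
        exact absurd ((h1 m I hI).2 (hpv.trans hv.2)) (not_lt.2 h6)
      · exact ((h1 m I hI).1 h5).trans_le hv.1
    have hexec : ∀ j, p < (J j).arrival → (J j).arrival ≤ w → q < (J j).deadline := by
      intro j hj hjw
      obtain ⟨m, hm⟩ := hO j (hjw.trans hwq')
      obtain ⟨I, hI, v, hv, hvI⟩ := O.exists_mem_of_executed_pos ((J j).exec_pos.trans_le hm)
      exact (hout m I hI v hvI (hj.trans_le hv.1)).trans_le hv.2
    -- Now `O` is off from just after `p` up to `q`, so no job arriving after `p` and by `w` is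
    -- executed by then. A wake-up by an anchor is impossible, as its job would be due by `w + B ≤
    -- q`.
    rcases htr with ⟨j, hj, hjw, hjd⟩ | ⟨x, hx, hxw⟩
    · exact absurd (hexec j hj hjw) (not_lt.2 (hjd.trans hwq))
    obtain ⟨j, hj, -⟩ := exists_of_total_pos (lt_of_lt_of_le (sub_pos.2 hx) hxw)
    have hqx : q < x := (hexec j hj.1.1 hj.1.2).trans_le hj.2
    -- The jobs in `N` must be executed between `q` and `x`, possibly in parallel, and need at least
    -- `x - w` of on-time. Laid out sequentially this on-time covers `[w, x]`, which contains the
    -- on-time of the period.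
    set N : ι → Prop := fun j => (p < (J j).arrival ∧ (J j).arrival ≤ w) ∧ (J j).deadline ≤ x
    refine ⟨R ∪ Icc w x, fun j => D j ∨ N j, hR.union measurableSet_Icc,
      (measure_union_lt_top hRfin.lt_top measure_Icc_lt_top).ne, ?_, ?_, ?_, ?_⟩
    · rw [total_split (B := D) (C := N) _ (fun j => Iff.rfl) fun j hj hj' =>
        absurd (hDp j hj) (not_le.2 hj'.1.1)]
      refine (measureReal_union_le _ _).trans ?_
      rw [Real.volume_real_Icc_of_le hx.le]
      linarith
    · rintro j (hj | hj)
      · exact (hDp j hj).trans hpq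
      · exact hj.1.2.trans hwq'
    · rintro j (hj | hj) m I hI v hv
      · exact Or.inl (hDR j hj m I hI hv)
      · exact Or.inr ⟨hwq'.trans (hout m I hI v hv.1 (hj.1.1.trans_le hv.2.1)).le,
          hv.2.2.trans hj.2⟩
    · have h3 := volume_real_extend (U := O.onSet ∪ R) (U' := O.onSet ∪ (R ∪ Icc w x))
        (union_subset_union_right _ subset_union_left)
        (measure_union_lt_top O.volume_onSet_ne_top.lt_top
          (measure_union_lt_top hRfin.lt_top measure_Icc_lt_top)).ne hpw.le hwq'
        fun v hv => Or.inr (Or.inr ⟨hv.1.le, hv.2.trans hqx.le⟩)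
      push_cast
      linarith

/-- Within `R` the on-time of `O`, summed over processors, is at least the work of `D` and hence the
length of `R`. Outside `R` it is at least the length of the time during which some processor is on.
-/
theorem Schedule.volume_union_le {A : Set ι} (hO : O.Feasible J A) {D : ι → Prop}
    (hD : ∀ j, D j → j ∈ A) {R : Set ℝ} (hRm : MeasurableSet R)
    (hRD : volume.real R ≤ total D (fun j => (J j).exec)) (hR : ∀ j, D j → ∀ m, ∀ I ∈ O.on m,
      Ico I.1 I.2 ∩ Icc (J j).arrival (J j).deadline ⊆ R) :
    volume.real (O.onSet ∪ R) ≤ ∑ m, O.onTime m univ := by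
  have h1 := O.total_le_sum_executed hO hD hR
  have h2 : ∑ m, ∑ j, O.executed m j R ≤ ∑ m, O.onTime m R :=
    Finset.sum_le_sum fun m _ => O.sum_executed_le m hRm
  have h3 := O.volume_onSet_inter_le hRm.compl
  have h4 : ∑ m, O.onTime m univ = ∑ m, O.onTime m R + ∑ m, O.onTime m Rᶜ := by
    rw [← Finset.sum_add_distrib]
    exact Finset.sum_congr rfl fun m _ => (O.onTime_add_compl m hRm).symm
  have h5 : O.onSet ∪ R = R ∪ (O.onSet ∩ Rᶜ) := by
    rw [union_comm, ← sdiff_eq, union_sdiff_self]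
  rw [h5]
  have h6 := measureReal_union_le (μ := volume) R (O.onSet ∩ Rᶜ)
  linarith

/-- The factor `2` counts both ends of each on-interval of `O`; all other periods are covered by
on-time. -/
theorem Record.turnOns_le {t e : ℝ} {r : ι → ℝ} {s : SysState} {n : Fin 2 → ℕ} {o : ℝ}
    {x : Fin 2 → ι → ℝ} (h : Record P J t e r s n o x) (het : e ≤ t)
    (hO : O.Feasible J {j | (J j).arrival ≤ t}) :
    P.breakEven * n 0 ≤ 2 * P.breakEven * ∑ m, (O.on m).card + ∑ m, O.onTime m univ := by
  obtain ⟨k, hk, hwin⟩ := h.windows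
  obtain ⟨R, D, hR, hRfin, hRD, hDe, hDR, hle⟩ := hk.exists_cover O fun j hj =>
    hO j (le_trans hj het)
  have hB := P.breakEven_nonneg
  have h1 := O.volume_union_le hO (fun j hj => (hDe j hj).trans het) hR hRD hDR
  have h2 : volume.real ((O.onSet ∪ R) ∩ Iic e) ≤ volume.real (O.onSet ∪ R) :=
    measureReal_mono inter_subset_left
      (measure_union_lt_top O.volume_onSet_ne_top.lt_top hRfin.lt_top).ne
  have hends : ∀ a : ℕ, a ≤ ∑ m, 2 * (O.on m).card →
      P.breakEven * a ≤ 2 * P.breakEven * ∑ m, (O.on m).card := by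
    intro a ha
    have : (a : ℝ) ≤ 2 * ∑ m, (O.on m).card := by
      rw [← Finset.mul_sum] at ha
      exact_mod_cast ha
    have := mul_le_mul_of_nonneg_left this hB
    linarith
  rcases hwin with ⟨-, hn⟩ | ⟨-, hn, -, hwt, htr⟩
  · have := hends _ (O.ends_le e)
    rw [hn]
    linarith
  -- The unfinished last period is paid by an end not yet counted: a job arriving after `e` forces
  -- an on-interval that ends after `e`.
  · obtain ⟨j, hj, hjw⟩ := htr.exists_job
    obtain ⟨m, hm⟩ := hO j (hjw.trans hwt)
    obtain ⟨I, hI, v, hv, hvI⟩ := O.exists_mem_of_executed_pos ((J j).exec_pos.trans_le hm)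
    have := hends _ (O.ends_lt_of_lt hI (hj.trans_le (hv.1.trans hvI.2.le)))
    rw [hn]
    push_cast at this ⊢
    linarith

theorem IsRun.energyUpTo_le {S : Schedule ι 2} {σ : ℝ → SysState} (h : IsRun P 1 J S σ)
    (hJ : EDFCondition J) {T : ℝ} (hT : 0 ≤ T) (hO : O.Feasible J {j | (J j).arrival ≤ T}) :
    S.energyUpTo P T ≤ 4 * O.energy P := by
  obtain ⟨e, hp, hrec⟩ := h.invariant hJ hT
  have h1 := hrec.turnOns_le O hp.base.e_le hO
  have h2 := hrec.cost
  have h3 := hp.ledger_le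
  set C := total (fun j => (J j).arrival ≤ T) (fun j => (J j).exec)
  have h4 : C ≤ ∑ m, ∑ j, O.executed m j univ :=
    O.total_le_sum_executed hO (fun _ hj => hj) fun _ _ _ _ _ => subset_univ _
  have h5 : ∑ m, ∑ j, O.executed m j univ ≤ ∑ m, O.onTime m univ :=
    Finset.sum_le_sum fun m _ => O.sum_executed_le m MeasurableSet.univ
  have h6 : ∑ m, ∑ j, S.executed m j (Icc 0 T) =
      total (fun _ => True) (fun j => (J j).exec - S.remaining J j T) := by
    rw [Finset.sum_comm]
    simp [total, Schedule.remaining]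
  have h7 : total (fun _ => True) (fun j => (J j).exec - S.remaining J j T) ≤ C := by
    refine total_le_total fun j => ?_
    simp only [if_true]
    split_ifs with hj
    · linarith [h.remaining_nonneg j hT]
    · rw [hp.base.future j (not_le.1 hj).le, sub_self]
  rw [S.energyUpTo_eq, O.energy_eq, h6]
  set X := total (fun _ => True) (fun j => (J j).exec - S.remaining J j T)
  set X' := ∑ m, ∑ j, O.executed m j univ
  have h8 : ∑ m, (P.breakEven * S.turnOns m T + S.onTime m (Icc 0 T)) =
      P.breakEven * (S.turnOns 0 T + S.turnOns 1 T) + ∑ m, S.onTime m (Icc 0 T) := by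
    simp only [Fin.sum_univ_two]
    ring
  have h9 : ∑ m, (P.breakEven * ((O.on m).card : ℝ) + O.onTime m univ) =
      P.breakEven * (∑ m, (O.on m).card : ℕ) + ∑ m, O.onTime m univ := by
    rw [Finset.sum_add_distrib, ← Finset.mul_sum]
    push_cast
    rfl
  have h10 : 0 ≤ P.breakEven * (∑ m, (O.on m).card : ℕ) :=
    mul_nonneg P.breakEven_nonneg (Nat.cast_nonneg _)
  rw [h8, h9]
  have h11 : P.breakEven * (S.turnOns 0 T + S.turnOns 1 T) + ∑ m, S.onTime m (Icc 0 T) ≤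
      4 * (P.breakEven * (∑ m, (O.on m).card : ℕ) + ∑ m, O.onTime m univ) := by
    linarith
  have h12 := mul_le_mul_of_nonneg_left h11 P.standby_pos.le
  have h0 : 0 ≤ X' :=
    Finset.sum_nonneg fun m _ => Finset.sum_nonneg fun j _ => O.executed_nonneg m j _
  -- The excess of busy power costs the algorithm no more than `O`, since `X ≤ C ≤ X'`; the factor
  -- `4` is needed only for turn-ons and on-time.
  have h13 : (P.busy - P.standby) * X ≤ (P.busy - P.standby) * (4 * X') :=
    mul_le_mul_of_nonneg_left (by linarith) (sub_nonneg.2 P.standby_le_busy)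
  linarith

theorem IsRun.isCompetitive {S : Schedule ι 2} {σ : ℝ → SysState} (h : IsRun P 1 J S σ)
    (hJ : EDFCondition J) : IsCompetitive 4 P J S := by
  refine ⟨fun T hT n O hO => h.energyUpTo_le O hJ hT hO, fun n O hO => ?_⟩
  obtain ⟨T, hT, hS⟩ := S.exists_energy_eq P
  rw [← hS]
  exact h.energyUpTo_le O hJ hT fun j _ => hO j trivial

end Comparison

/-! ### Composing runs from pieces. -/

section Existence

/-- From time `T` on, the set `A` of times is a finite union of separated intervals. -/
def OnRep (T : ℝ) (A : ℝ → Prop) : Prop :=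
  ∃ F : Finset (ℝ × ℝ), (∀ I ∈ F, T ≤ I.1) ∧ (∀ I ∈ F, I.1 < I.2) ∧
    (∀ I ∈ F, ∀ I' ∈ F, I ≠ I' → I.2 < I'.1 ∨ I'.2 < I.1) ∧
    ∀ t, T ≤ t → (A t ↔ ∃ I ∈ F, t ∈ Ico I.1 I.2)

/-- A processor that stays on across `T'` needs the new piece merged with the interval starting at
`T'`, because on-intervals must not touch. -/
theorem OnRep.extend {T T' : ℝ} (hT : T < T') {A A' : ℝ → Prop} (h : OnRep T' A') {b : Prop}
    (h1 : ∀ t, t < T' → (A t ↔ b)) (h2 : ∀ t, T' ≤ t → (A t ↔ A' t)) : OnRep T A := by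
  classical
  obtain ⟨F, hF1, hF2, hF3, hF4⟩ := h
  by_cases hb : b
  swap
  · refine ⟨F, fun I hI => hT.le.trans (hF1 I hI), hF2, hF3, fun t ht => ?_⟩
    rcases lt_or_ge t T' with htT | htT
    · rw [h1 t htT]
      exact ⟨fun h => absurd h hb, fun ⟨I, hI, hIt⟩ =>
        absurd htT (not_lt.2 ((hF1 I hI).trans hIt.1))⟩
    · rw [h2 t htT, hF4 t htT]
  by_cases hI : ∃ I ∈ F, I.1 = T'
  · obtain ⟨I, hI, hIT⟩ := hI
    have hsep : ∀ I' ∈ F.erase I, I.2 < I'.1 := by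
      intro I' hI'
      rw [Finset.mem_erase] at hI'
      rcases hF3 I hI I' hI'.2 (Ne.symm hI'.1) with h | h
      · exact h
      · exact absurd (hF1 I' hI'.2) (not_le.2 ((hF2 I' hI'.2).trans (hIT ▸ h)))
    refine ⟨insert (T, I.2) (F.erase I), fun I' hI' => ?_, fun I' hI' => ?_,
      fun I' hI' I'' hI'' hne => ?_, fun t ht => ?_⟩
    · rcases Finset.mem_insert.1 hI' with rfl | h
      · exact le_rfl
      · exact hT.le.trans (hF1 I' (Finset.mem_of_mem_erase h))
    · rcases Finset.mem_insert.1 hI' with rfl | h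
      · exact hT.trans (hIT ▸ hF2 I hI)
      · exact hF2 I' (Finset.mem_of_mem_erase h)
    · rcases Finset.mem_insert.1 hI' with rfl | h' <;>
        rcases Finset.mem_insert.1 hI'' with rfl | h''
      · exact absurd rfl hne
      · exact Or.inl (hsep _ h'')
      · exact Or.inr (hsep _ h')
      · exact hF3 _ (Finset.mem_of_mem_erase h') _ (Finset.mem_of_mem_erase h'') hne
    · rcases lt_or_ge t T' with htT | htT
      · rw [h1 t htT]
        exact ⟨fun _ => ⟨_, Finset.mem_insert_self _ _, ht, htT.trans (hIT ▸ hF2 I hI)⟩,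
          fun _ => hb⟩
      · rw [h2 t htT, hF4 t htT]
        constructor
        · rintro ⟨I', hI', hIt⟩
          by_cases hII : I' = I
          · exact ⟨_, Finset.mem_insert_self _ _, ht, hII ▸ hIt.2⟩
          · exact ⟨I', Finset.mem_insert_of_mem (Finset.mem_erase.2 ⟨hII, hI'⟩), hIt⟩
        · rintro ⟨I', hI', hIt⟩
          rcases Finset.mem_insert.1 hI' with rfl | h
          · exact ⟨I, hI, hIT.trans_le htT, hIt.2⟩
          · exact ⟨I', Finset.mem_of_mem_erase h, hIt⟩
  · push Not at hI
    have hgt : ∀ I ∈ F, T' < I.1 := fun I h => (hF1 I h).lt_of_ne (hI I h).symm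
    refine ⟨insert (T, T') F, fun I' hI' => ?_, fun I' hI' => ?_,
      fun I' hI' I'' hI'' hne => ?_, fun t ht => ?_⟩
    · rcases Finset.mem_insert.1 hI' with rfl | h
      · exact le_rfl
      · exact hT.le.trans (hF1 I' h)
    · rcases Finset.mem_insert.1 hI' with rfl | h
      · exact hT
      · exact hF2 I' h
    · rcases Finset.mem_insert.1 hI' with rfl | h' <;>
        rcases Finset.mem_insert.1 hI'' with rfl | h''
      · exact absurd rfl hne
      · exact Or.inl (hgt _ h'')
      · exact Or.inr (hgt _ h')
      · exact hF3 _ h' _ h'' hne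
    · rcases lt_or_ge t T' with htT | htT
      · rw [h1 t htT]
        exact ⟨fun _ => ⟨_, Finset.mem_insert_self _ _, ht, htT⟩, fun _ => hb⟩
      · rw [h2 t htT, hF4 t htT]
        constructor
        · rintro ⟨I', hI', hIt⟩
          exact ⟨I', Finset.mem_insert_of_mem hI', hIt⟩
        · rintro ⟨I', hI', hIt⟩
          rcases Finset.mem_insert.1 hI' with rfl | h
          · exact absurd hIt.2 (not_lt.2 htT)
          · exact ⟨I', h, hIt⟩

variable {ι : Type*} [Fintype ι]

/-- A run of the algorithm from time `T` on, starting in state `s` with the remaining execution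
times `r`. -/
structure Continuation (P : PowerModel) (J : ι → Job) (T : ℝ) (s : SysState) (r : ι → ℝ)
    (σ : ℝ → SysState) (job : Fin 2 → ℝ → Option ι) (ρ : ℝ → ι → ℝ) : Prop where
  start : σ T = s
  measurable : ∀ m x, MeasurableSet {t | job m t = x}
  evol : ∀ t, T ≤ t → ∀ j,
    ρ t j = r j - ∑ m, volume.real (Icc T t ∩ {v | job m v = some j})
  step : ∀ t, T < t → ∃ s' : SysState, (∀ᶠ u in 𝓝[<] t, σ u = s') ∧
    σ t = s'.update P 1 J (openJobs J (ρ t) t) (dueWork J (ρ t) t) t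
  right : ∀ t, T ≤ t → ∀ᶠ u in 𝓝[>] t, σ u = σ t
  on_rep : ∀ m, OnRep T fun t => (σ t).on m = true
  edf : ∀ t, T ≤ t → ∀ m, EDFChoice J ((σ t).eligible J (openJobs J (ρ t) t) m) (job m t)

open Classical in
/-- The remaining execution times after processor `m` has executed `jm m` for `δ` units of time. -/
def advance (r : ι → ℝ) (jm : Fin 2 → Option ι) (δ : ℝ) (j : ι) : ℝ :=
  r j - ∑ m, if jm m = some j then δ else 0

variable {P : PowerModel} {J : ι → Job} {s s' : SysState} {T T' e : ℝ} {r : ι → ℝ}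
  {jm : Fin 2 → Option ι}

theorem Continuation.prepend {σ : ℝ → SysState} {job : Fin 2 → ℝ → Option ι} {ρ : ℝ → ι → ℝ}
    (hT : T < T') (h : Continuation P J T' s' (advance r jm (T' - T)) σ job ρ)
    (hs' : s' = s.update P 1 J (openJobs J (advance r jm (T' - T)) T')
      (dueWork J (advance r jm (T' - T)) T') T')
    (hfix : ∀ v ∈ Ioo T T', s.update P 1 J (openJobs J (advance r jm (v - T)) v)
      (dueWork J (advance r jm (v - T)) v) v = s)
    (hedf : ∀ v ∈ Ico T T', ∀ m,
      EDFChoice J (s.eligible J (openJobs J (advance r jm (v - T)) v) m) (jm m)) :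
    ∃ σ' job' ρ', Continuation P J T s r σ' job' ρ' := by
  classical
  refine ⟨fun v => if v < T' then s else σ v, fun m v => if v < T' then jm m else job m v,
    fun v => if v < T' then advance r jm (v - T) else ρ v, ?_, fun m x => ?_, fun t ht j => ?_,
    fun t ht => ?_, fun t ht => ?_, fun m => ?_, fun t ht m => ?_⟩
  · simp [hT]
  · have : {t | (if t < T' then jm m else job m t) = x} =
        (Iio T' ∩ {_t | jm m = x}) ∪ (Ici T' ∩ {t | job m t = x}) := by
      ext t
      by_cases ht : t < T'
      · simp [ht, not_le.2 ht]
      · simp [ht, not_lt.1 ht]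
    rw [this]
    exact (measurableSet_Iio.inter (MeasurableSet.const _)).union
      (measurableSet_Ici.inter (h.measurable m x))
  · have hpiece : ∀ m, ∀ w, w ≤ T' → T ≤ w →
        volume.real (Ico T w ∩ {v | (if v < T' then jm m else job m v) = some j}) =
        if jm m = some j then w - T else 0 := by
      intro m w hw hTw
      have h1 : Ico T w ∩ {v | (if v < T' then jm m else job m v) = some j} =
          if jm m = some j then Ico T w else ∅ := by
        split_ifs with hj
        · exact inter_eq_left.2 fun v hv => by simp [hv.2.trans_le hw, hj]
        · exact eq_empty_of_forall_notMem fun v hv => hj (by simpa [hv.1.2.trans_le hw] using hv.2)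
      rw [h1]
      split_ifs
      · rw [Real.volume_real_Ico_of_le hTw]
      · simp
    rcases lt_or_ge t T' with htT | htT
    · simp only [htT, if_true, advance]
      congr 1
      refine Finset.sum_congr rfl fun m _ => ?_
      rw [← hpiece m t htT.le ht]
      exact measureReal_congr (ae_eq_set_inter Ico_ae_eq_Icc (ae_eq_refl _))
    · simp only [not_lt.2 htT, if_false]
      rw [h.evol t htT j, advance, sub_sub, ← Finset.sum_add_distrib]
      congr 1
      refine Finset.sum_congr rfl fun m _ => ?_
      have h1 : Icc T t ∩ {v | (if v < T' then jm m else job m v) = some j} =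
          (Ico T T' ∩ {v | (if v < T' then jm m else job m v) = some j}) ∪
          (Icc T' t ∩ {v | job m v = some j}) := by
        rw [← Ico_union_Icc_eq_Icc hT.le htT, union_inter_distrib_right]
        congr 1
        ext v
        refine and_congr_right fun hv => ?_
        simp [not_lt.2 hv.1]
      rw [h1, measureReal_union (h₁ := volume_Ico_inter_ne_top _ _ _)
        (h₂ := ((measure_mono inter_subset_left).trans_lt measure_Icc_lt_top).ne)
        (Set.disjoint_left.2 fun v hv hv' => absurd hv.1.2 (not_lt.2 hv'.1.1))
        (measurableSet_Icc.inter (h.measurable m (some j))), hpiece m T' le_rfl hT.le]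
  · rcases lt_trichotomy t T' with htT | rfl | htT
    · refine ⟨s, ?_, ?_⟩
      · filter_upwards [Ioo_mem_nhdsLT ht] with u hu
        simp [hu.2.trans htT]
      · simp only [htT, if_true]
        exact (hfix t ⟨ht, htT⟩).symm
    · refine ⟨s, ?_, ?_⟩
      · filter_upwards [Ioo_mem_nhdsLT ht] with u hu
        simp [hu.2]
      · have h1 : ρ t = advance r jm (t - T) := funext fun j => by
          rw [h.evol t le_rfl j, Finset.sum_eq_zero fun m _ => ?_, sub_zero]
          rw [Icc_self, measureReal_def,
            measure_mono_null inter_subset_left (measure_singleton t)]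
          rfl
        simp only [lt_irrefl, if_false, h.start, h1]
        exact hs'
    · obtain ⟨s1, h1, h2⟩ := h.step t htT
      refine ⟨s1, ?_, ?_⟩
      · filter_upwards [h1, Ioo_mem_nhdsLT htT] with u hu hu'
        simpa [not_lt.2 hu'.1.le] using hu
      · simpa [not_lt.2 htT.le] using h2
  · rcases lt_or_ge t T' with htT | htT
    · filter_upwards [Ioo_mem_nhdsGT htT] with u hu
      simp [hu.2, htT]
    · filter_upwards [h.right t htT, self_mem_nhdsWithin] with u hu hu'
      simpa [not_lt.2 htT, not_lt.2 (htT.trans (mem_Ioi.1 hu').le)] using hu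
  · refine (h.on_rep m).extend hT (b := s.on m = true) (fun t ht => ?_) fun t ht => ?_
    · simp [ht]
    · simp [not_lt.2 ht]
  · rcases lt_or_ge t T' with htT | htT
    · simpa only [htT, if_true] using hedf t ⟨ht, htT⟩ m
    · simpa only [not_lt.2 htT, if_false] using h.edf t htT m

theorem exists_continuation_of_fixed (hoff : s.IsOff)
    (hfix : ∀ v, T < v → s.update P 1 J (openJobs J r v) (dueWork J r v) v = s) :
    ∃ σ job ρ, Continuation P J T s r σ job ρ := by
  refine ⟨fun _ => s, fun _ _ => none, fun _ => r, rfl, fun _ _ => MeasurableSet.const _,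
    fun t _ j => by simp, fun t ht => ⟨s, by simp, (hfix t ht).symm⟩, fun t _ => by simp,
    fun m => ⟨∅, by simp, by simp, by simp, fun t _ => by simp [hoff m]⟩, fun t _ m => ?_⟩
  exact eq_empty_of_forall_notMem fun j hj => by simpa [hoff m] using hj.2.1

theorem exists_EDFChoice (J : ι → Job) (A : Set ι) : ∃ o, EDFChoice J A o := by
  rcases A.eq_empty_or_nonempty with hA | hA
  · exact ⟨none, hA⟩
  · obtain ⟨j, hj, hmin⟩ := A.toFinite.exists_minimalFor (fun j => (J j).deadline) A hA
    exact ⟨some j, hj, fun i hi => (le_total (J j).deadline (J i).deadline).elim id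
      fun h => hmin hi h⟩

/-- Nothing but the execution of the jobs `jm` happens between times `T` and `v`. -/
structure Uneventful (P : PowerModel) (J : ι → Job) (T : ℝ) (s : SysState) (r : ι → ℝ)
    (jm : Fin 2 → Option ι) (v : ℝ) : Prop where
  lt : T < v
  arrivals : ∀ j, (J j).arrival ≤ T ∨ v ≤ (J j).arrival
  completions : ∀ m j, jm m = some j → v - T ≤ r j
  anchors : s.IsOff → ∀ j ∈ openJobs J r T, v ≤ anchor P 1 (J j)
  slack : s.IsOff → ∀ j ∈ openJobs J r T,
    total (fun i => (J i).arrival ≤ T ∧ (J i).deadline ≤ (J j).deadline) r ≤ (J j).deadline - v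
  standby : ¬ s.IsOff → openJobs J r T = ∅ → v ≤ s.t1 + P.breakEven

/-- It suffices to test deadlines of open jobs: the work due by `x` equals the work due by the
latest open deadline up to `x`, or is zero if there is none. This keeps the set of events finite. -/
theorem Uneventful.total_le (h : Uneventful P J T s r jm T') (hb : Base J T e r) (ho : s.IsOff)
    (x : ℝ) : total (fun j => (J j).arrival ≤ T ∧ (J j).deadline ≤ x) r ≤ max 0 (x - T') := by
  classical
  by_cases hne : ((openJobs J r T) ∩ {j | (J j).deadline ≤ x}).Nonempty
  · obtain ⟨j, hj, hmax⟩ := (Set.toFinite _).exists_maximalFor (fun j => (J j).deadline) _ hne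
    have h1 := h.slack ho j hj.1
    have h2 : total (fun j => (J j).arrival ≤ T ∧ (J j).deadline ≤ x) r =
        total (fun i => (J i).arrival ≤ T ∧ (J i).deadline ≤ (J j).deadline) r := by
      refine Finset.sum_congr rfl fun i _ => ?_
      rcases (hb.nonneg i).eq_or_lt with h0 | h0
      · simp [← h0]
      · by_cases hi : (J i).arrival ≤ T
        · have : (J i).deadline ≤ x ↔ (J i).deadline ≤ (J j).deadline :=
            ⟨fun hx => (le_total (J i).deadline (J j).deadline).elim id fun h =>
              hmax ⟨⟨hi, h0⟩, hx⟩ h, fun hx => hx.trans hj.2⟩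
          simp [this]
        · simp [hi]
    have h3 : (J j).deadline ≤ x := hj.2
    exact le_max_of_le_right (by linarith)
  · refine le_max_of_le_left (total_eq_zero fun i hi => ?_).le
    by_contra h0
    exact hne ⟨i, ⟨hi.1, (hb.nonneg i).lt_of_ne (Ne.symm h0)⟩, hi.2⟩

end Existence

/-! ### Uneventful intervals and the bound on the number of events. -/

section Advance

variable {ι : Type*} {P : PowerModel} {J : ι → Job} {s s' : SysState}
  {T T' v e δ : ℝ} {r : ι → ℝ} {jm : Fin 2 → Option ι} {m : Fin 2} {j : ι}

theorem advance_of_ne (h : ∀ m, jm m ≠ some j) : advance r jm δ j = r j := by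
  simp [advance, h]

theorem advance_of_not_responsible
    (hjm : ∀ m, EDFChoice J (s.eligible J (openJobs J r T) m) (jm m))
    (h : ∀ m, s.on m = true → ¬ responsible J s m j) : advance r jm δ j = r j := by
  refine advance_of_ne fun m hm => ?_
  have h1 := hjm m
  rw [hm] at h1
  exact h m h1.1.2.1 h1.1.2.2

open Classical in
theorem advance_of_responsible (hs : s.urgent = false → s.on 0 = false ∨ s.on 1 = false)
    (hjm : ∀ m, EDFChoice J (s.eligible J (openJobs J r T) m) (jm m))
    (h : s.on m = true ∧ responsible J s m j) :
    advance r jm δ j = r j - if jm m = some j then δ else 0 := by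
  unfold advance
  rw [Finset.sum_eq_single m _ (by simp)]
  intro m' _ hne
  rw [if_neg fun hm' => ?_]
  have h1 := hjm m'
  rw [hm'] at h1
  exact responsible_disjoint hs hne.symm h ⟨h1.1.2.1, h1.1.2.2⟩

theorem exists_job_of_eligible
    (hjm : ∀ m, EDFChoice J (s.eligible J (openJobs J r T) m) (jm m))
    (h : (s.eligible J (openJobs J r T) m).Nonempty) :
    ∃ j, jm m = some j ∧ j ∈ s.eligible J (openJobs J r T) m := by
  have h1 := hjm m
  rcases Option.eq_none_or_eq_some (jm m) with h2 | ⟨j, h2⟩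
  · rw [h2] at h1
    exact absurd h1 h.ne_empty
  · rw [h2] at h1
    exact ⟨j, h2, h1.1⟩

theorem advance_cases (hs : s.urgent = false → s.on 0 = false ∨ s.on 1 = false)
    (hjm : ∀ m, EDFChoice J (s.eligible J (openJobs J r T) m) (jm m)) (j : ι) :
    advance r jm δ j = r j ∨ ∃ m, jm m = some j ∧ advance r jm δ j = r j - δ := by
  by_cases h : ∃ m, jm m = some j
  · obtain ⟨m, hm⟩ := h
    right
    have h1 := hjm m
    rw [hm] at h1
    refine ⟨m, hm, ?_⟩
    rw [advance_of_responsible hs hjm ⟨h1.1.2.1, h1.1.2.2⟩, if_pos hm]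
  · push Not at h
    exact Or.inl (advance_of_ne h)

variable [Fintype ι]

theorem Uneventful.mono (h : Uneventful P J T s r jm T') (h1 : T < v) (h2 : v ≤ T') :
    Uneventful P J T s r jm v :=
  ⟨h1, fun j => (h.arrivals j).imp_right h2.trans, fun m j hj => by
    linarith [h.completions m j hj], fun ho j hj => h2.trans (h.anchors ho j hj),
    fun ho j hj => by linarith [h.slack ho j hj], fun ho hQ => h2.trans (h.standby ho hQ)⟩

/-- Completions and arrivals happen at `T'` at the earliest, so the EDF choice made at `T` stays
valid on the half-open interval. -/
theorem Uneventful.openJobs_eq (h : Uneventful P J T s r jm T')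
    (hs : s.urgent = false → s.on 0 = false ∨ s.on 1 = false)
    (hjm : ∀ m, EDFChoice J (s.eligible J (openJobs J r T) m) (jm m)) (hv : v ∈ Ico T T') :
    openJobs J (advance r jm (v - T)) v = openJobs J r T := by
  ext j
  refine and_congr ⟨fun hj => (h.arrivals j).resolve_right (not_le.2 (hj.trans_lt hv.2)),
    fun hj => hj.trans hv.1⟩ ?_
  rcases advance_cases (δ := v - T) hs hjm j with h1 | ⟨m, hm, h1⟩
  · rw [h1]
  · have h2 := h.completions m j hm
    have h3 := hv.1
    have h4 := hv.2
    rw [h1]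
    constructor <;> intro <;> linarith

theorem Uneventful.segment (h : Uneventful P J T s r jm v) (hp : Phase P J T e r s)
    (hs : s.urgent = false → s.on 0 = false ∨ s.on 1 = false)
    (hjm : ∀ m, EDFChoice J (s.eligible J (openJobs J r T) m) (jm m)) :
    Segment P J s T r v (advance r jm (v - T)) := by
  classical
  have hb := hp.base
  have hδ : 0 ≤ v - T := sub_nonneg.2 h.lt.le
  refine ⟨h.lt, h.arrivals, fun j => ?_, fun j => ?_, fun j hj => ?_, fun ho => ?_,
    fun m hm x => ?_, fun ho => ⟨fun j hj hr => h.anchors ho j ⟨hj, hr⟩, fun x hx => ?_⟩,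
    fun hcalm ho htot => ?_, fun hur => ?_⟩
  · rcases advance_cases (δ := v - T) hs hjm j with h1 | ⟨m, hm, h1⟩
    · exact h1 ▸ hb.nonneg j
    · linarith [h.completions m j hm]
  · rcases advance_cases (δ := v - T) hs hjm j with h1 | ⟨m, hm, h1⟩ <;> linarith
  · refine advance_of_ne fun m hm => ?_
    have h1 := hjm m
    rw [hm] at h1
    exact absurd h1.1.1.1 (not_le.2 (h.lt.trans_le hj))
  · exact funext fun j => advance_of_not_responsible hjm fun m hm => by simp [ho m] at hm
  · set A : ι → Prop := fun j => ((J j).arrival ≤ T ∧ responsible J s m j) ∧ (J j).deadline ≤ x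
    have h1 : total A (advance r jm (v - T)) =
        total A r - total A fun j => if jm m = some j then v - T else 0 := by
      rw [← total_sub]
      exact total_congr (fun _ => Iff.rfl) fun j hj =>
        advance_of_responsible hs hjm ⟨hm, hj.1.2⟩
    by_cases hA : ∃ j, A j ∧ 0 < r j
    · obtain ⟨j, hj, hr⟩ := hA
      have hel : j ∈ s.eligible J (openJobs J r T) m := ⟨⟨hj.1.1, hr⟩, hm, hj.1.2⟩
      obtain ⟨i, hi, hiel⟩ := exists_job_of_eligible hjm ⟨j, hel⟩
      have h2 := hjm m
      rw [hi] at h2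
      have hAi : A i := ⟨⟨hiel.1.1, hiel.2.2⟩, (h2.2 j hel).trans hj.2⟩
      have h3 : total A (fun j => if jm m = some j then v - T else 0) = v - T := by
        unfold total
        rw [Finset.sum_eq_single i (fun i' _ hne => ?_) (by simp)]
        · simp [hAi, hi]
        · rw [hi]
          simp [hne.symm]
      have h4 := h.completions m i hi
      have h5 := single_le_total hb.nonneg hAi
      rw [h1, h3, max_eq_right]
      linarith
    · push Not at hA
      have h2 : total A r = 0 := total_eq_zero fun j hj => le_antisymm (hA j hj) (hb.nonneg j)
      have h3 : total A (advance r jm (v - T)) = 0 := total_eq_zero fun j hj => by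
        rw [advance_of_responsible hs hjm ⟨hm, hj.1.2⟩, if_neg fun hmj => ?_, sub_zero]
        · exact le_antisymm (hA j hj) (hb.nonneg j)
        · have h4 := hjm m
          rw [hmj] at h4
          exact absurd (hA j hj) (not_le.2 h4.1.1.2)
      rw [h3, h2, max_eq_left]
      linarith
  · exact (h.total_le hb ho x).trans (max_le (by linarith) le_rfl)
  · obtain ⟨m, hm⟩ : ∃ m, s.on m = true := by
      by_contra hno
      push Not at hno
      exact ho fun m => by simpa using hno m
    rcases (openJobs J r T).eq_empty_or_nonempty with hQ | ⟨j, hj⟩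
    · exact h.standby ho hQ
    · obtain ⟨i, hi, hiel⟩ := exists_job_of_eligible hjm (m := m)
        ⟨j, hj, hm, responsible_of_calm hcalm m j⟩
      have h1 := h.completions m i hi
      have h2 := single_le_total hb.nonneg (A := fun j => (J j).arrival ≤ T) (j := i) hiel.1.1
      linarith
  · rcases hp with hp | hp | hp | hp
    · simp [hp.calm] at hur
    · simp [hp.calm] at hur
    · obtain ⟨j, hj, hjt⟩ := hp.busy
      obtain ⟨i, hi, hiel⟩ := exists_job_of_eligible hjm (m := 0)
        ⟨j, hj, hp.on0, fun _ => by simpa using hjt⟩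
      have h1 := h.completions 0 i hi
      have h2 := single_le_total hb.nonneg
        (A := fun j => (J j).arrival ≤ T ∧ (J j).arrival < s.tStar) (j := i)
        ⟨hiel.1.1, by simpa using hiel.2.2 hur⟩
      linarith
    · simp [hp.calm] at hur

theorem Phase.calm_single (hp : Phase P J T e r s) :
    s.urgent = false → s.on 0 = false ∨ s.on 1 = false := by
  intro h
  rcases hp with hp | hp | hp | hp
  · exact Or.inl (hp.off 0)
  · exact Or.inr hp.on1
  · simp [hp.flag] at h
  · exact Or.inl hp.on0

theorem Uneventful.update_eq (h : Uneventful P J T s r jm T') (hp : Phase P J T e r s)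
    (hJ : EDFCondition J) (hjm : ∀ m, EDFChoice J (s.eligible J (openJobs J r T) m) (jm m))
    (hv : v ∈ Ioo T T') :
    s.update P 1 J (openJobs J (advance r jm (v - T)) v)
      (dueWork J (advance r jm (v - T)) v) v = s := by
  have hs := hp.calm_single
  have hseg := (h.mono hv.1 hv.2.le).segment hp hs hjm
  have hQ := h.openJobs_eq hs hjm ⟨hv.1.le, hv.2⟩
  have hlt : ∀ j, (J j).arrival ≤ v ↔ (J j).arrival < v := fun j =>
    ⟨fun hj => ((h.arrivals j).resolve_right (not_le.2 (hj.trans_lt hv.2))).trans_lt hv.1, le_of_lt⟩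
  have hawake : ¬ s.IsOff → (openJobs J (advance r jm (v - T)) v).Nonempty ∨
      v < s.t1 + P.breakEven := by
    intro ho
    rw [hQ]
    rcases (openJobs J r T).eq_empty_or_nonempty with h1 | h1
    · exact Or.inr (hv.2.trans_le (h.standby ho h1))
    · exact Or.inl h1
  rcases hp with hp | hp | hp | hp
  · have h1 := hp.segment hJ hseg
    have h2 := hseg.frozen hp.off
    rw [h2] at h1 hQ ⊢
    refine OffPhase.update_eq (e := e) ⟨h1.base, hp.off, hp.calm, h1.unstarted, fun j hj => ?_,
      fun x hx => ?_⟩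
    · rw [hQ] at hj
      exact hv.2.trans_le (h.anchors hp.off j hj)
    · have h3 := h.total_le hp.base hp.off x
      have h4 : ∀ j, (J j).arrival ≤ v ↔ (J j).arrival ≤ T := fun j =>
        ⟨fun hj => (h.arrivals j).resolve_right (not_le.2 (hj.trans_lt hv.2)),
          fun hj => hj.trans hv.1.le⟩
      simp only [h4]
      exact h3.trans_lt (max_lt (by linarith) (by linarith [hv.2]))
  · have h1 := hp.segment hJ hseg
    refine SinglePhase.update_eq (e := e) ⟨h1, fun x hx => ?_,
      hawake fun ho => by simpa [hp.on0] using ho 0⟩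
    simpa only [hlt] using h1.fits x hx.le
  · have h1 := hp.segment hJ hseg
    refine UrgentPhase.update_eq (e := e) ⟨h1, ?_⟩
    rw [hQ]
    exact hp.busy
  · have h1 := hp.segment hJ hseg
    exact TailPhase.update_eq (e := e) ⟨h1, hawake fun ho => by simpa [hp.on1] using ho 1⟩ hJ

/-- The position of a state within a period, counted backwards. -/
def SysState.rank (s : SysState) : ℕ :=
  if s.on 0 = true then (if s.on 1 = true then 2 else 3) else (if s.on 1 = true then 1 else 4)

/-- Within a period the rank decreases. A shut-down raises it by at most `3`, but moves `e` past the
job that caused the wake-up, which the weight `5` outbalances. -/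
theorem PrePhase.update (hp : PrePhase P J T e r s) (hJ : EDFCondition J)
    (hs' : s' = s.update P 1 J (openJobs J r T) (dueWork J r T) T) :
    ∃ e', Phase P J T e' r s' ∧ ((s' = s ∧ e' = e) ∨
      5 * {j | e' < (J j).arrival}.ncard + s'.rank < 5 * {j | e < (J j).arrival}.ncard + s.rank) := by
  have hoff : OffPhase P J T T r s' → e ≤ T → s.rank ≠ 0 → ∀ w ≤ T, Trigger P J e w →
      ∃ e', Phase P J T e' r s' ∧ ((s' = s ∧ e' = e) ∨ 5 * {j | e' < (J j).arrival}.ncard +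
        s'.rank < 5 * {j | e < (J j).arrival}.ncard + s.rank) := by
    intro h heT hrank w hw htr
    refine ⟨T, Or.inl h, Or.inr ?_⟩
    obtain ⟨j, hj, hjw⟩ := htr.exists_job
    have h1 : {j | T < (J j).arrival}.ncard < {j | e < (J j).arrival}.ncard :=
      Set.ncard_lt_ncard ⟨fun i hi => lt_of_le_of_lt heT hi, fun hc =>
        absurd (hjw.trans hw) (not_le.2 (hc hj))⟩ (Set.toFinite _)
    have h2 : s'.rank = 4 := by simp [SysState.rank, h.off 0, h.off 1]
    omega
  rcases hp with hp | hp | hp | hp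
  · have h4 : s.rank = 4 := by simp [SysState.rank, hp.off 0, hp.off 1]
    rcases hp.update hJ s' hs' with ⟨h1, h⟩ | ⟨rfl, h⟩ | ⟨rfl, h⟩
    · exact ⟨e, Or.inl (h1 ▸ h), Or.inl ⟨h1, rfl⟩⟩
    · refine ⟨e, Or.inr (Or.inl h), Or.inr ?_⟩
      rw [h4, SysState.rank]
      simp [h.on0, h.on1]
    · refine ⟨e, Or.inr (Or.inr (Or.inl h)), Or.inr ?_⟩
      rw [h4, SysState.rank]
      simp [h.on0, h.on1]
  · have h4 : s.rank = 3 := by simp [SysState.rank, hp.on0, hp.on1]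
    rcases hp.update hJ s' hs' with ⟨h1, h⟩ | ⟨rfl, h⟩ | ⟨-, -, -, h⟩
    · exact ⟨e, Or.inr (Or.inl (h1 ▸ h)), Or.inl ⟨h1, rfl⟩⟩
    · refine ⟨e, Or.inr (Or.inr (Or.inl h)), Or.inr ?_⟩
      rw [h4, SysState.rank]
      simp [h.on0, h.on1]
    · exact hoff h hp.base.e_le (by omega) _ hp.t1_le hp.trig
  · have h4 : s.rank = 2 := by simp [SysState.rank, hp.on0, hp.on1]
    rcases hp.update s' hs' with ⟨h1, h⟩ | ⟨rfl, h⟩ | ⟨-, -, -, h⟩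
    · exact ⟨e, Or.inr (Or.inr (Or.inl (h1 ▸ h))), Or.inl ⟨h1, rfl⟩⟩
    · refine ⟨e, Or.inr (Or.inr (Or.inr h)), Or.inr ?_⟩
      rw [h4, SysState.rank]
      simp [h.on0, h.on1]
    · exact hoff h hp.base.e_le (by omega) _ (hp.t1_le.trans hp.tStar_le) hp.trig
  · have h4 : s.rank = 1 := by simp [SysState.rank, hp.on0, hp.on1]
    rcases hp.update hJ s' hs' with ⟨h1, h⟩ | ⟨-, -, -, h⟩
    · exact ⟨e, Or.inr (Or.inr (Or.inr (h1 ▸ h))), Or.inl ⟨h1, rfl⟩⟩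
    · exact hoff h hp.base.e_le (by omega) _ (hp.t1_le.trans hp.tStar_le) hp.trig

/-- A bound for the number of the events that are still to come. -/
def eventBound (J : ι → Job) (t e : ℝ) (r : ι → ℝ) (s : SysState) : ℕ :=
  5 * {j | e < (J j).arrival}.ncard + s.rank + {j | 0 < r j}.ncard + {j | t < (J j).arrival}.ncard

/-- The times of the events that may end an uneventful time interval. -/
def eventTimes (P : PowerModel) (J : ι → Job) (T : ℝ) (s : SysState) (r : ι → ℝ)
    (jm : Fin 2 → Option ι) : Set ℝ :=
  ((fun j => (J j).arrival) '' {j | T < (J j).arrival}) ∪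
  ((fun j => T + r j) '' {j | ∃ m, jm m = some j}) ∪
  ((fun j => anchor P 1 (J j)) '' {j | s.IsOff ∧ j ∈ openJobs J r T}) ∪
  ((fun j => (J j).deadline -
    total (fun i => (J i).arrival ≤ T ∧ (J i).deadline ≤ (J j).deadline) r) ''
      {j | s.IsOff ∧ j ∈ openJobs J r T}) ∪
  {b | b = s.t1 + P.breakEven ∧ ¬ s.IsOff ∧ openJobs J r T = ∅}

theorem eventTimes_finite : (eventTimes P J T s r jm).Finite := by
  refine ((((Set.toFinite _).union (Set.toFinite _)).union (Set.toFinite _)).union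
    (Set.toFinite _)).union ((Set.finite_singleton (s.t1 + P.breakEven)).subset fun b hb => hb.1)

theorem uneventful_of_eventTimes (hT : T < v) (h : ∀ b ∈ eventTimes P J T s r jm, v ≤ b) :
    Uneventful P J T s r jm v := by
  refine ⟨hT, fun j => ?_, fun m j hj => ?_, fun ho j hj => ?_, fun ho j hj => ?_,
    fun ho hQ => ?_⟩
  · rcases le_or_gt (J j).arrival T with h1 | h1
    · exact Or.inl h1
    · exact Or.inr (h _ (Or.inl (Or.inl (Or.inl (Or.inl ⟨j, h1, rfl⟩)))))
  · have := h _ (Or.inl (Or.inl (Or.inl (Or.inr ⟨j, ⟨m, hj⟩, rfl⟩))))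
    simp only at this
    linarith
  · exact h _ (Or.inl (Or.inl (Or.inr ⟨j, ⟨ho, hj⟩, rfl⟩)))
  · have := h _ (Or.inl (Or.inr ⟨j, ⟨ho, hj⟩, rfl⟩))
    simp only at this
    linarith
  · exact h _ (Or.inr ⟨rfl, ho, hQ⟩)

/-- The strict inequalities `relaxed`, `loose` and `awake`, valid once the rules have been applied,
ensure that the next event lies strictly ahead. -/
theorem lt_of_mem_eventTimes (hp : Phase P J T e r s)
    (hjm : ∀ m, EDFChoice J (s.eligible J (openJobs J r T) m) (jm m)) {b : ℝ}
    (hb : b ∈ eventTimes P J T s r jm) : T < b := by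
  have hoff : s.IsOff → OffPhase P J T e r s := fun ho => by
    rcases hp with hp | hp | hp | hp
    · exact hp
    · simpa [hp.on0] using ho 0
    · simpa [hp.on0] using ho 0
    · simpa [hp.on1] using ho 1
  rcases hb with (((⟨j, hj, rfl⟩ | ⟨j, ⟨m, hm⟩, rfl⟩) | ⟨j, ⟨ho, hj⟩, rfl⟩) | ⟨j, ⟨ho, hj⟩, rfl⟩) |
    ⟨rfl, ho, hQ⟩
  · exact hj
  · have h1 := hjm m
    rw [hm] at h1
    have := h1.1.1.2
    simp only
    linarith
  · exact (hoff ho).relaxed j hj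
  · have hjT : T < (J j).deadline := by
      by_contra hc
      exact hj.2.ne' (hp.base.due j (not_lt.1 hc))
    have := (hoff ho).loose _ hjT
    simp only
    linarith
  · have hawake : (openJobs J r T).Nonempty ∨ T < s.t1 + P.breakEven := by
      rcases hp with hp | hp | hp | hp
      · exact absurd hp.off ho
      · exact hp.awake
      · obtain ⟨j, hj, -⟩ := hp.busy
        exact Or.inl ⟨j, hj⟩
      · exact hp.awake
    rcases hawake with h | h
    · exact absurd hQ h.ne_empty
    · exact h

/-- The run is extended to the earliest next event, where `eventBound` drops. If there is no next
event, the system is off for good. -/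
theorem exists_continuation (hJ : EDFCondition J) (n : ℕ) : ∀ (T e : ℝ) (r : ι → ℝ) (s : SysState),
    Phase P J T e r s → eventBound J T e r s = n → ∃ σ job ρ, Continuation P J T s r σ job ρ := by
  induction n using Nat.strong_induction_on with
  | _ n ih =>
  intro T e r s hp hn
  choose jm hjm using fun m => exists_EDFChoice J (s.eligible J (openJobs J r T) m)
  have hs := hp.calm_single
  have hb := hp.base
  rcases (eventTimes P J T s r jm).eq_empty_or_nonempty with hE | hE
  · have hun : ∀ v, T < v → Uneventful P J T s r jm v := fun v hv =>
      uneventful_of_eventTimes hv (by simp [hE])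
    have ho : s.IsOff := by
      by_contra ho
      rcases (openJobs J r T).eq_empty_or_nonempty with hQ | ⟨j, hj⟩
      · have : s.t1 + P.breakEven ∈ eventTimes P J T s r jm := Or.inr ⟨rfl, ho, hQ⟩
        simp [hE] at this
      · obtain ⟨m, hm⟩ : ∃ m, (s.eligible J (openJobs J r T) m).Nonempty := by
          rcases hp with hp | hp | hp | hp
          · exact absurd hp.off ho
          · exact ⟨0, j, hj, hp.on0, responsible_of_calm hp.calm 0 j⟩
          · obtain ⟨i, hi, hit⟩ := hp.busy
            exact ⟨0, i, hi, hp.on0, fun _ => by simpa using hit⟩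
          · exact ⟨1, j, hj, hp.on1, responsible_of_calm hp.calm 1 j⟩
        obtain ⟨i, hi, -⟩ := exists_job_of_eligible hjm hm
        have : T + r i ∈ eventTimes P J T s r jm :=
          Or.inl (Or.inl (Or.inl (Or.inr ⟨i, ⟨m, hi⟩, rfl⟩)))
        simp [hE] at this
    refine exists_continuation_of_fixed ho fun v hv => ?_
    have h1 := (hun (v + 1) (by linarith)).update_eq hp hJ hjm ⟨hv, by linarith⟩
    rwa [((hun v hv).segment hp hs hjm).frozen ho] at h1
  · obtain ⟨T', hT'E, hmin⟩ := eventTimes_finite.exists_minimalFor id _ hE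
    have hTT' : T < T' := lt_of_mem_eventTimes hp hjm hT'E
    have hun : Uneventful P J T s r jm T' := uneventful_of_eventTimes hTT' fun b hb =>
      (le_total T' b).elim id fun h => hmin hb h
    have hseg := hun.segment hp hs hjm
    set r' := advance r jm (T' - T) with hr'
    obtain ⟨e', hp', hdec⟩ := (hp.segment hJ hseg).update hJ
      (s' := s.update P 1 J (openJobs J r' T') (dueWork J r' T') T') rfl
    set s' := s.update P 1 J (openJobs J r' T') (dueWork J r' T') T' with hs'
    have hsub1 : {j | 0 < r' j} ⊆ {j | 0 < r j} := fun j hj => lt_of_lt_of_le hj (hseg.anti j)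
    have hsub2 : {j | T' < (J j).arrival} ⊆ {j | T < (J j).arrival} := fun j hj => hTT'.trans hj
    have hcard1 := Set.ncard_le_ncard hsub1 (Set.toFinite _)
    have hcard2 := Set.ncard_le_ncard hsub2 (Set.toFinite _)
    have hlt : eventBound J T' e' r' s' < n := by
      rw [← hn, eventBound, eventBound]
      rcases hdec with ⟨hss, rfl⟩ | hdec
      swap
      · omega
      rw [hss]
      by_cases harr : ∃ j, T < (J j).arrival ∧ (J j).arrival ≤ T'
      · obtain ⟨j, hj1, hj2⟩ := harr
        have := Set.ncard_lt_ncard (s := {j | T' < (J j).arrival}) (t := {j | T < (J j).arrival})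
          ⟨hsub2, fun hc => absurd hj2 (not_le.2 (hc hj1))⟩ (Set.toFinite _)
        omega
      push Not at harr
      by_cases hcomp : ∃ j, 0 < r j ∧ r' j = 0
      · obtain ⟨j, hj1, hj2⟩ := hcomp
        have := Set.ncard_lt_ncard (s := {j | 0 < r' j}) (t := {j | 0 < r j})
          ⟨hsub1, fun hc => (hc hj1 : 0 < r' j).ne' hj2⟩ (Set.toFinite _)
        omega
      push Not at hcomp
      -- With no arrival, completion or change of state, the event would be a reached anchor,
      -- exhausted slack or the break-even time; each contradicts the phase that holds at `T'` after
      -- the rules have been applied.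
      exfalso
      rw [hss] at hp'
      have hoff : s.IsOff → OffPhase P J T' e' r s := fun ho => by
        rw [hseg.frozen ho] at hp'
        rcases hp' with hp | hp | hp | hp
        · exact hp
        · simpa [hp.on0] using ho 0
        · simpa [hp.on0] using ho 0
        · simpa [hp.on1] using ho 1
      rcases hT'E with (((⟨j, hj, rfl⟩ | ⟨j, ⟨m, hm⟩, rfl⟩) | ⟨j, ⟨ho, hj⟩, rfl⟩) |
        ⟨j, ⟨ho, hj⟩, rfl⟩) | ⟨rfl, ho, hQ⟩
      · exact lt_irrefl _ (harr j hj)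
      · have h1 := hjm m
        rw [hm] at h1
        refine hcomp j h1.1.1.2 ?_
        rw [hr', advance_of_responsible hs hjm ⟨h1.1.2.1, h1.1.2.2⟩, if_pos hm]
        ring
      · exact lt_irrefl _ ((hoff ho).relaxed j ⟨hj.1.trans hTT'.le, hj.2⟩)
      · have h1 := single_le_total hb.nonneg (A := fun i => (J i).arrival ≤ T ∧
          (J i).deadline ≤ (J j).deadline) (j := j) ⟨hj.1, le_rfl⟩
        simp only at hTT' hoff
        have h2 := (hoff ho).loose (J j).deadline (by linarith [hj.2])
        have h3 := total_mono hb.nonneg (A := fun i => (J i).arrival ≤ T ∧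
          (J i).deadline ≤ (J j).deadline) (B := fun i => (J i).arrival ≤ (J j).deadline -
            total (fun i => (J i).arrival ≤ T ∧ (J i).deadline ≤ (J j).deadline) r ∧
          (J i).deadline ≤ (J j).deadline) fun i hi => ⟨hi.1.trans hTT'.le, hi.2⟩
        linarith
      · have hQ' : openJobs J r' (s.t1 + P.breakEven) = ∅ := by
          refine eq_empty_of_forall_notMem fun j hj => ?_
          have hjT : (J j).arrival ≤ T := not_lt.1 fun hc => absurd hj.1 (not_le.2 (harr j hc))
          have : j ∈ openJobs J r T := ⟨hjT, lt_of_lt_of_le hj.2 (hseg.anti j)⟩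
          simp [hQ] at this
        rcases hp' with hp' | hp' | hp' | hp'
        · exact ho hp'.off
        · rcases hp'.awake with h | h
          · exact h.ne_empty hQ'
          · exact lt_irrefl _ h
        · obtain ⟨j, hj, -⟩ := hp'.busy
          simp [hQ'] at hj
        · rcases hp'.awake with h | h
          · exact h.ne_empty hQ'
          · exact lt_irrefl _ h
    obtain ⟨σ, job, ρ, hc⟩ := ih _ hlt T' e' r' s' hp' rfl
    refine hc.prepend hTT' hs' (fun v hv => hun.update_eq hp hJ hjm hv) fun v hv m => ?_
    rw [hun.openJobs_eq hs hjm hv]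
    exact hjm m

theorem exists_isRun (P : PowerModel) (hJ : EDFCondition J) :
    ∃ (S : Schedule ι 2) (σ : ℝ → SysState), IsRun P 1 J S σ := by
  set r : ι → ℝ := fun j => (J j).exec
  obtain ⟨e, hp, -⟩ := PrePhase.update (Or.inl (PreOff.initial (P := P) hJ)) hJ rfl
  obtain ⟨σ, job, ρ, h⟩ := exists_continuation hJ _ 0 e _ _ hp rfl
  choose F hF1 hF2 hF3 hF4 using h.on_rep
  set S : Schedule ι 2 := ⟨F, job, hF1, hF2, hF3, h.measurable⟩ with hS
  have hρ : ∀ t, 0 ≤ t → (fun j => S.remaining J j t) = ρ t := by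
    intro t ht
    funext j
    rw [h.evol t ht j, Schedule.remaining]
    congr 1
    refine Finset.sum_congr rfl fun m _ => ?_
    refine S.executed_eq_of_subset m j measurableSet_Icc fun v hv hj => ?_
    have h1 := h.edf v hv.1 m
    rw [show job m v = some j from hj] at h1
    exact (hF4 m v hv.1).1 h1.1.2.1
  have hQ : ∀ t, 0 ≤ t → S.queue J t = openJobs J (ρ t) t := fun t ht => by
    rw [← hρ t ht]
    rfl
  have hW : ∀ t, 0 ≤ t → S.workload J t = dueWork J (ρ t) t := fun t ht => by
    rw [← hρ t ht]
    rfl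
  have h0 : ρ 0 = r := funext fun j => by
    rw [h.evol 0 le_rfl j, Finset.sum_eq_zero fun m _ => ?_, sub_zero]
    rw [Icc_self, measureReal_def, measure_mono_null inter_subset_left (measure_singleton (0 : ℝ))]
    rfl
  refine ⟨S, σ, ?_, fun t ht => ?_, h.right, fun t ht m => hF4 m t ht, fun t ht m => ?_⟩
  · rw [hQ 0 le_rfl, hW 0 le_rfl, h0]
    exact h.start
  · rw [hQ t ht.le, hW t ht.le]
    exact h.step t ht
  · rw [hQ t ht]
    exact h.edf t ht m

end Advance

end PowerSched

end

theorem mainTheorem2 {ι : Type*} [Fintype ι] (P : PowerSched.PowerModel) (J : ι → PowerSched.Job)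
    (hJ : PowerSched.EDFCondition J) :
    (∃ (S : PowerSched.Schedule ι 2) (σ : ℝ → PowerSched.SysState),
      PowerSched.IsRun P 1 J S σ) ∧
    ∀ (S : PowerSched.Schedule ι 2) (σ : ℝ → PowerSched.SysState),
      PowerSched.IsRun P 1 J S σ →
        S.Feasible J univ ∧ PowerSched.IsCompetitive 4 P J S :=
  ⟨PowerSched.exists_isRun P hJ, fun _ _ h => ⟨h.feasible hJ, h.isCompetitive hJ⟩⟩
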